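/- Let $\mathcal{E}$ be an elementary topos with a natural number object, and let $R$ be an ordered commutative ring object in $\mathcal{E}$: a commutative ring object with a relation $\leqslant\;\rightarrowtail R\times R$ that, in the internal language, is a total order ($i\leqslant j\vee j\leqslant i$) satisfying $i\leqslant j\Rightarrow k+i\leqslant k+j$ and $0\leqslant i\wedge 0\leqslant j\Rightarrow 0\leqslant i\cdot j$. Write $R_+=\{i:R\mid 0\leqslant i\}$ and let $\dot-$ be truncated subtraction on $R_+$. For each object $\Gamma$ let $\mathcal{E}(\Gamma)$ denote the families over $\Gamma$ in the category with families associated with $\mathcal{E}$. Assume that $R$ is connected: the morphism $1+1\to(1+1)^R$ sending a Boolean to the corresponding constant function is an isomorphism. **Moore paths.** For $x,y:\Gamma$, the object $x\sim y$ of Moore paths consists of the pairs $p=(f,\ell)$ with $f:R_+\to\Gamma$ and $\ell:R_+$ such that $f\,0=x$ and $f\,i=y$ for all $i\geqslant\ell$; write $p\,i=f\,i$ and $|p|=\ell$. For a function $\gamma$ let $\gamma\text{'}p=(\gamma\circ f,\ell)$. Let $\mathsf{idp}\,x=(\lambda i.\,x,\,0)$ and $\mathsf{rev}\,p=(\lambda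 i.\,p(|p|\mathbin{\dot-}i),\,|p|)$. For $p:x\sim y$ and $q:y\sim z$ let $q\bullet p:x\sim z$ be the path of shape $|p|+|q|$ that is $p\,i$ for $i\leqslant|p|$ and $q(i-|p|)$ for $i\geqslant|p|$. Let $\langle i\leqslant j\rangle\varphi(i)=(\lambda i.\,\varphi(\min(i,j)),\,j)$. For $i:R_+$ let $p^{\leqslant i}=\langle j\leqslant\min(|p|,i)\rangle\,p\,j : x\sim p\,i$ and $p^{\geqslant i}=\mathsf{rev}\big((\mathsf{rev}\,p)^{\leqslant|p|\mathbin{\dot-}i}\big): p\,i\sim y$. **Fibrations.** A transport-along-paths (tap) structure on $A\in\mathcal{E}(\Gamma)$ is a $(\Gamma\times\Gamma)$-indexed family of morphisms $x\sim y\to(A\,x\to A\,y)$, $p\mapsto p_*$, with $(\mathsf{idp}\,x)_*a=a$. The category with families $\mathbf{Fib}$ has as families over $\Gamma$ the families in $\mathcal{E}(\Gamma)$ with a tap structure; re-indexing along $\gamma:\Delta\to\Gamma$ transports along $\gamma\text{'}p$; the elements are those of the underlying families. It has the following types. * Booleans: the constant family $1+1$ with $p_*b=b$. * Dependent functions: for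 fibrations $A$ over $\Gamma$ and $B$ over $\Gamma.A$, the family $\big(\prod_{a:A\,x}B(x,a)\mid x:\Gamma\big)$ with $(p_*F)\,a=\big(\mathsf{rev}(\mathsf{lift}(\mathsf{rev}\,p,a))\big)_*\big(F((\mathsf{rev}\,p)_*a)\big)$, where $\mathsf{lift}(p,a)=\langle i\leqslant|p|\rangle\big(p\,i,\,(p^{\leqslant i})_*a\big)$ is a path from $(x,a)$ to $(y,p_*a)$ in $\Gamma.A$. * Identity types: for a fibration $A$ over $\Gamma$, the Moore path objects $a_1\sim a_2$ in the fibres $A\,x$, a family over the object of triples $(x,a_1,a_2)$, with $r_*q=\mathsf{snd}(r_2)\bullet\big((p_*)\text{'}q\big)\bullet\mathsf{rev}(\mathsf{snd}(r_1))$. Here $p$, $r_1$, $r_2$ are the images of $r:(x,a_1,a_2)\sim(y,b_1,b_2)$ in $\Gamma$ and, by $(x,a_1)$ and $(x,a_2)$, in $\Gamma.A$; and for a path $s:(x,a)\sim(y,b)$ in $\Gamma.A$ with image $p$ in $\Gamma$ and $s\,i=(p\,i,a_i)$, $\mathsf{snd}(s)=\langle i\leqslant|s|\rangle\,(p^{\geqslant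 i})_*a_i : p_*a\sim b$. **Universe.** Assume that $\mathcal{E}$ supports the inductive-recursive definition of an object $U$ and a family $T\in\mathcal{E}(U)$ where $U$ has the inductive constructors $$\mathsf{bool}:U,\qquad \mathsf{pi}:\textstyle\prod_{u:U}(T\,u\to U)\to U,\qquad \mathsf{eq}:\prod_{u:U}T\,u\to T\,u\to U$$ and $T$ satisfies $$T\,\mathsf{bool}=1+1,\qquad T(\mathsf{pi}\,u\,f)=\textstyle\prod_{x:T\,u}T(f\,x),\qquad T(\mathsf{eq}\,u\,x\,y)=(x\sim y).$$ That is, $U$ and $T$ are given with these constructors and equations (the equations as isomorphisms stable under re-indexing) and with the elimination rule: for every $P\in\mathcal{E}(U)$, elements $m_b:P\,\mathsf{bool}$, $m_p:\prod_{u:U}\prod_{f:T\,u\to U}P\,u\to\big(\prod_{x:T\,u}P(f\,x)\big)\to P(\mathsf{pi}\,u\,f)$ and $m_e:\prod_{u:U}\prod_{x,y:T\,u}P\,u\to P(\mathsf{eq}\,u\,x\,y)$ determine an element $s$ of $\prod_{u:U}P\,u$ with $s\,\mathsf{bool}=m_b$, $s(\mathsf{pi}\,u\,f)=m_p\,u\,f\,(s\,u)\,(\lambda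 x.\,s(f\,x))$ and $s(\mathsf{eq}\,u\,x\,y)=m_e\,u\,x\,y\,(s\,u)$. **Theorem.** Then $T$ has a tap structure that makes it a Tarski-style universe in $\mathbf{Fib}$ containing the Booleans and closed under dependent function types and Moore-path identity types: there is a tap structure on $T\in\mathcal{E}(U)$ such that, along the equations for $T$, re-indexing it along $\mathsf{bool}$, $\mathsf{pi}$ and $\mathsf{eq}$ gives respectively the tap structure of the Booleans, that of the dependent function types of $T\,u$ and $T(f\,x)$, and that of the identity types of $T\,u$, as described above. -/

import Mathlib

open CategoryTheory CategoryTheory.Limits MonoidalCategory CartesianMonoidalCategory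
open scoped CommRingObj

universe v u

namespace MooreTopos

set_option linter.unusedSectionVars false

section Glueing

variable {E : Type u} [Category.{v} E] [HasFiniteLimits E] [HasSubobjectClassifier E]

/-- Subobjects are determined by their generalized elements. -/
theorem subobject_ext {Z : E} {P Q : Subobject Z}
    (h : ∀ (Y : E) (z : Y ⟶ Z), P.Factors z ↔ Q.Factors z) : P = Q :=
  le_antisymm (Subobject.le_of_factors ((h _ _).1 P.factors_self))
    (Subobject.le_of_factors ((h _ _).2 Q.factors_self))

theorem mk_factors {Z V Y : E} (m : V ⟶ Z) [Mono m] (z : Y ⟶ Z) :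
    (Subobject.mk m).Factors z ↔ ∃ k : Y ⟶ V, k ≫ m = z := Iff.rfl

/-- The characteristic map of a subobject. -/
noncomputable def chi {V : E} (S : Subobject V) : V ⟶ HasSubobjectClassifier.Ω E :=
  HasSubobjectClassifier.exists_classifier.some.χ S.arrow

theorem comp_chi_eq_iff {V W : E} (h : W ⟶ V) (S S' : Subobject V) :
    h ≫ chi S = h ≫ chi S' ↔
      ∀ (Y : E) (y : Y ⟶ W), S.Factors (y ≫ h) ↔ S'.Factors (y ≫ h) := by
  have key : ∀ {V : E} (S : Subobject V), (Subobject.pullback (chi S)).obj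
      HasSubobjectClassifier.exists_classifier.some.truth_as_subobject = S := by
    intro V S
    simp [chi]
  have hpb : ∀ S : Subobject V, h ≫ chi S = chi ((Subobject.pullback h).obj S) := by
    intro S
    conv_rhs => rw [← key S, ← Subobject.pullback_comp]
    simp [chi]
  constructor
  · intro e Y y
    rw [hpb, hpb] at e
    have e' := (key ((Subobject.pullback h).obj S)).symm.trans ((congrArg (fun c =>
      (Subobject.pullback c).obj _) e).trans (key _))
    rw [← pullback_factors_iff, e', pullback_factors_iff]
  · intro H
    rw [hpb, hpb]
    congr 1
    refine subobject_ext fun Y y => ?_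
    rw [pullback_factors_iff, pullback_factors_iff]
    exact H Y y

variable [CartesianMonoidalCategory E] [MonoidalClosed E]

/-- Reasoning by cases: if the join of `P` and `Q` is everything, then a subobject `S` of `W`
that contains every generalized element lying over `P` or over `Q` is everything. -/
theorem factors_of_cases {Z : E} {P Q : Subobject Z} (hPQ : IsLUB {P, Q} (⊤ : Subobject Z))
    {W : E} (w : W ⟶ Z) (S : Subobject W)
    (hP : ∀ (Y : E) (y : Y ⟶ W), P.Factors (y ≫ w) → S.Factors y)
    (hQ : ∀ (Y : E) (y : Y ⟶ W), Q.Factors (y ≫ w) → S.Factors y) : S.Factors (𝟙 W) := by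
  have : Mono (lift (𝟙 W) w) := ⟨fun a b h => by simpa using congrArg (· ≫ fst _ _) h⟩
  let G : Subobject (W ⊗ Z) := Subobject.mk (lift (𝟙 W) w)
  let GS : Subobject (W ⊗ Z) := Subobject.mk (S.arrow ≫ lift (𝟙 W) w)
  have hG : ∀ {Y : E} (a : Y ⟶ W) (z : Y ⟶ Z), G.Factors (lift a z) ↔ a ≫ w = z := by
    intro Y a z
    rw [mk_factors]
    constructor
    · rintro ⟨g, hg⟩
      have h1 := congrArg (· ≫ fst _ _) hg
      have h2 := congrArg (· ≫ snd _ _) hg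
      simp at h1 h2
      rw [← h1, ← h2]
    · rintro rfl
      exact ⟨a, by simp⟩
  have hGS : ∀ {Y : E} (a : Y ⟶ W) (z : Y ⟶ Z),
      GS.Factors (lift a z) ↔ a ≫ w = z ∧ S.Factors a := by
    intro Y a z
    rw [mk_factors]
    constructor
    · rintro ⟨g, hg⟩
      have h1 := congrArg (· ≫ fst _ _) hg
      have h2 := congrArg (· ≫ snd _ _) hg
      simp at h1 h2
      refine ⟨by rw [← h1, ← h2, Category.assoc], ?_⟩
      rw [← h1]
      exact Subobject.factors_comp_arrow _
    · rintro ⟨rfl, hS⟩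
      exact ⟨S.factorThru a hS, by simp⟩
  let D : Subobject Z := equalizerSubobject (MonoidalClosed.curry (chi G))
    (MonoidalClosed.curry (chi GS))
  have hD : ∀ {V : E} (z : V ⟶ Z), D.Factors z ↔
      ∀ (Y : E) (a : Y ⟶ W) (k : Y ⟶ V), a ≫ w = k ≫ z → S.Factors a := by
    intro V z
    rw [equalizerSubobject_factors_iff, ← MonoidalClosed.curry_natural_left,
      ← MonoidalClosed.curry_natural_left, MonoidalClosed.curry_injective.eq_iff, comp_chi_eq_iff]
    constructor
    · intro H Y a k e
      have := H Y (lift a k)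
      rw [lift_whiskerLeft, hG, hGS] at this
      exact (this.1 e).2
    · intro H Y y
      have e : y ≫ W ◁ z = lift (y ≫ fst _ _) ((y ≫ snd _ _) ≫ z) := by
        ext <;> simp
      rw [e, hG, hGS]
      exact ⟨fun h => ⟨h, H Y _ _ h⟩, fun h => h.1⟩
  have htop : (⊤ : Subobject Z) ≤ D := hPQ.2 (by
    rintro B (rfl | rfl)
    · refine Subobject.le_of_factors ((hD _).2 fun Y a k e => hP _ _ ?_)
      rw [e]; exact Subobject.factors_comp_arrow _
    · refine Subobject.le_of_factors ((hD _).2 fun Y a k e => hQ _ _ ?_)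
      rw [e]; exact Subobject.factors_comp_arrow _)
  exact (hD (𝟙 Z)).1 (Subobject.factors_of_le _ htop (Subobject.top_factors _)) W (𝟙 W) w (by simp)

/-- Joins that are everything are stable under pullback. -/
theorem isLUB_pullback {Z W : E} {P Q : Subobject Z} (hPQ : IsLUB {P, Q} (⊤ : Subobject Z))
    (w : W ⟶ Z) :
    IsLUB {(Subobject.pullback w).obj P, (Subobject.pullback w).obj Q} (⊤ : Subobject W) := by
  refine ⟨fun _ _ => le_top, fun S hS => ?_⟩
  have h1 := hS (Set.mem_insert _ _)
  have h2 := hS (Set.mem_insert_of_mem _ rfl)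
  have := factors_of_cases hPQ w S
    (fun Y y h => Subobject.factors_of_le _ h1 ((pullback_factors_iff _ _ _).2 h))
    (fun Y y h => Subobject.factors_of_le _ h2 ((pullback_factors_iff _ _ _).2 h))
  refine Subobject.le_of_factors ?_
  simpa using Subobject.factors_of_factors_right (⊤ : Subobject W).arrow this

/-- Two maps that agree on two subobjects whose join is everything are equal. -/
theorem hom_ext_of_cases {Z Y : E} {P Q : Subobject Z} (hPQ : IsLUB {P, Q} (⊤ : Subobject Z))
    {f g : Z ⟶ Y} (hP : P.arrow ≫ f = P.arrow ≫ g) (hQ : Q.arrow ≫ f = Q.arrow ≫ g) : f = g := by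
  have := factors_of_cases hPQ (𝟙 Z) (equalizerSubobject f g)
    (fun V y h => by
      rw [Category.comp_id] at h
      rw [equalizerSubobject_factors_iff, ← Subobject.factorThru_arrow P y h]
      simp only [Category.assoc, hP])
    (fun V y h => by
      rw [Category.comp_id] at h
      rw [equalizerSubobject_factors_iff, ← Subobject.factorThru_arrow Q y h]
      simp only [Category.assoc, hQ])
  simpa using (equalizerSubobject_factors_iff f g (𝟙 Z)).1 this

/-- Definition by cases: compatible maps on two subobjects whose join is everything glue. -/
theorem exists_glue {Z Y : E} {P Q : Subobject Z} (hPQ : IsLUB {P, Q} (⊤ : Subobject Z))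
    (f : (P : E) ⟶ Y) (g : (Q : E) ⟶ Y)
    (hfg : ∀ (V : E) (k : V ⟶ (P : E)) (l : V ⟶ (Q : E)),
      k ≫ P.arrow = l ≫ Q.arrow → k ≫ f = l ≫ g) :
    ∃ c : Z ⟶ Y, P.arrow ≫ c = f ∧ Q.arrow ≫ c = g := by
  have hmono : ∀ (A : Subobject Z) (f : (A : E) ⟶ Y), Mono (lift A.arrow f) := fun A f =>
    ⟨fun a b h => by
      rw [← cancel_mono A.arrow]
      simpa using congrArg (· ≫ fst _ _) h⟩
  let Gr : ∀ (A : Subobject Z) (f : (A : E) ⟶ Y), Subobject (Z ⊗ Y) :=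
    fun A f => Subobject.mk (lift A.arrow f)
  let C : ∀ (A : Subobject Z) (f : (A : E) ⟶ Y), Subobject (Z ⊗ Y) :=
    fun A f => equalizerSubobject (chi (Gr A f)) (chi ((Subobject.pullback (fst Z Y)).obj A))
  have hGr : ∀ (A : Subobject Z) (f : (A : E) ⟶ Y) {V : E} (z : V ⟶ Z) (y : V ⟶ Y),
      (Gr A f).Factors (lift z y) ↔ ∃ k : V ⟶ (A : E), k ≫ A.arrow = z ∧ k ≫ f = y := by
    intro A f V z y
    rw [mk_factors]
    constructor
    · rintro ⟨k, hk⟩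
      exact ⟨k, by simpa using congrArg (· ≫ fst _ _) hk, by simpa using congrArg (· ≫ snd _ _) hk⟩
    · rintro ⟨k, rfl, rfl⟩
      exact ⟨k, by simp⟩
  have hC : ∀ (A : Subobject Z) (f : (A : E) ⟶ Y) {V : E} (z : V ⟶ Z) (y : V ⟶ Y),
      (C A f).Factors (lift z y) ↔
        ∀ (W : E) (h : W ⟶ V) (k : W ⟶ (A : E)), k ≫ A.arrow = h ≫ z → k ≫ f = h ≫ y := by
    intro A f V z y
    rw [equalizerSubobject_factors_iff, comp_chi_eq_iff]
    constructor
    · intro H W h k e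
      have := H W h
      rw [comp_lift, hGr, pullback_factors_iff, lift_fst] at this
      obtain ⟨k', h1, h2⟩ := this.2 (e ▸ Subobject.factors_comp_arrow k)
      rw [← h2]
      congr 1
      rw [← cancel_mono A.arrow, e, h1]
    · intro H W h
      rw [comp_lift, hGr, pullback_factors_iff, lift_fst]
      constructor
      · rintro ⟨k, hk, -⟩
        exact hk ▸ Subobject.factors_comp_arrow k
      · intro hk
        exact ⟨A.factorThru _ hk, by simp, H W h _ (by simp)⟩
  let K : Subobject (Z ⊗ Y) := C P f ⊓ C Q g
  have hK : ∀ {V : E} (z : V ⟶ Z) (y : V ⟶ Y), K.Factors (lift z y) ↔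
      (C P f).Factors (lift z y) ∧ (C Q g).Factors (lift z y) := fun z y =>
    Subobject.inf_factors _
  let t : (K : E) ⟶ Z := K.arrow ≫ fst Z Y
  have hKa : lift t (K.arrow ≫ snd Z Y) = K.arrow := by ext <;> simp [t]
  have hKP : ∀ {V : E} (m : V ⟶ (K : E)) (k : V ⟶ (P : E)), k ≫ P.arrow = m ≫ t →
      k ≫ f = m ≫ K.arrow ≫ snd Z Y := fun m k e =>
    (hC P f t (K.arrow ≫ snd Z Y)).1
      ((hK t _).1 (by rw [hKa]; exact K.factors_self)).1 _ m k e
  have hKQ : ∀ {V : E} (m : V ⟶ (K : E)) (k : V ⟶ (Q : E)), k ≫ Q.arrow = m ≫ t →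
      k ≫ g = m ≫ K.arrow ≫ snd Z Y := fun m k e =>
    (hC Q g t (K.arrow ≫ snd Z Y)).1
      ((hK t _).1 (by rw [hKa]; exact K.factors_self)).2 _ m k e
  have : Mono t := ⟨by
    intro V a b hab
    rw [← cancel_mono K.arrow, ← hKa, comp_lift, comp_lift, hab]
    congr 1
    refine hom_ext_of_cases (isLUB_pullback hPQ (a ≫ t)) ?_ ?_
    · obtain ⟨k, hk⟩ : ∃ k, k ≫ P.arrow =
          ((Subobject.pullback (a ≫ t)).obj P).arrow ≫ a ≫ t :=
        ⟨P.factorThru _ ((pullback_factors_iff _ _ _).1 (Subobject.factors_self _)),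
          by simp⟩
      have h1 := hKP (((Subobject.pullback (a ≫ t)).obj P).arrow ≫ a) k (by simpa using hk)
      have h2 := hKP (((Subobject.pullback (a ≫ t)).obj P).arrow ≫ b) k
        (by rw [hk, hab, Category.assoc])
      simpa using h1.symm.trans h2
    · obtain ⟨k, hk⟩ : ∃ k, k ≫ Q.arrow =
          ((Subobject.pullback (a ≫ t)).obj Q).arrow ≫ a ≫ t :=
        ⟨Q.factorThru _ ((pullback_factors_iff _ _ _).1 (Subobject.factors_self _)),
          by simp⟩
      have h1 := hKQ (((Subobject.pullback (a ≫ t)).obj Q).arrow ≫ a) k (by simpa using hk)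
      have h2 := hKQ (((Subobject.pullback (a ≫ t)).obj Q).arrow ≫ b) k
        (by rw [hk, hab, Category.assoc])
      simpa using h1.symm.trans h2⟩
  have hPf : K.Factors (lift P.arrow f) := by
    rw [hK, hC, hC]
    refine ⟨fun W h k e => ?_, fun W h k e => (hfg W h k e.symm).symm⟩
    rw [← (cancel_mono P.arrow).1 e]
  have hQg : K.Factors (lift Q.arrow g) := by
    rw [hK, hC, hC]
    refine ⟨fun W h k e => hfg W k h e, fun W h k e => ?_⟩
    rw [← (cancel_mono Q.arrow).1 e]
  have htop : Subobject.mk t = ⊤ := by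
    refine le_antisymm le_top (hPQ.2 ?_)
    rintro B (rfl | rfl)
    · refine Subobject.le_of_factors ?_
      rw [mk_factors]
      exact ⟨K.factorThru _ hPf, by
        rw [← Category.assoc, Subobject.factorThru_arrow, lift_fst]⟩
    · refine Subobject.le_of_factors ?_
      rw [mk_factors]
      exact ⟨K.factorThru _ hQg, by
        rw [← Category.assoc, Subobject.factorThru_arrow, lift_fst]⟩
  have : IsIso t := (Subobject.isIso_iff_mk_eq_top t).2 htop
  refine ⟨inv t ≫ K.arrow ≫ snd Z Y, ?_, ?_⟩
  · have := hKP (P.arrow ≫ inv t) (𝟙 _) (by simp)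
    simpa using this.symm
  · have := hKQ (Q.arrow ≫ inv t) (𝟙 _) (by simp)
    simpa using this.symm

end Glueing

/-! ### Order-ringed toposes -/

/-- A natural number object exists. -/
def HasNNO (E : Type u) [Category.{v} E] [CartesianMonoidalCategory E] : Prop :=
  ∃ (N : E) (zero : 𝟙_ E ⟶ N) (succ : N ⟶ N), ∀ (A : E) (a : 𝟙_ E ⟶ A) (s : A ⟶ A),
    ∃! f : N ⟶ A, zero ≫ f = a ∧ succ ≫ f = f ≫ s

/-- An object `X` is connected, relative to a coproduct `𝔹 = 1 + 1`, if the map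
`K : 𝔹 ⟶ (X ⟹ 𝔹)` sending a Boolean to the corresponding constant function (the transpose of
the projection `X ⊗ 𝔹 ⟶ 𝔹`) is an isomorphism. -/
def IsConnectedObject {E : Type u} [Category.{v} E] [CartesianMonoidalCategory E]
    [MonoidalClosed E] (𝔹 X : E) : Prop :=
  IsIso (MonoidalClosed.curry (snd X 𝔹) : 𝔹 ⟶ (ihom X).obj 𝔹)

/-- The order structure turning a commutative ring object `R` into an ordered commutative ring
object. Formulas of the internal language are spelled out on generalized elements `X ⟶ R`; totality
says that the join of `≤` and its opposite is all of `R ⊗ R`. -/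
structure RingOrder {E : Type u} [Category.{v} E] [CartesianMonoidalCategory E] [BraidedCategory E]
    [HasFiniteLimits E] (R : E) [CommRingObj R] where
  /-- the order relation -/
  le : Subobject (R ⊗ R)
  refl : ∀ {X : E} (i : X ⟶ R), le.Factors (lift i i)
  trans : ∀ {X : E} (i j k : X ⟶ R), le.Factors (lift i j) → le.Factors (lift j k) →
    le.Factors (lift i k)
  antisymm : ∀ {X : E} (i j : X ⟶ R), le.Factors (lift i j) → le.Factors (lift j i) → i = j
  total : IsLUB {le, (Subobject.pullback (lift (snd R R) (fst R R))).obj le} ⊤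
  add_le : ∀ {X : E} (i j k : X ⟶ R), le.Factors (lift i j) → le.Factors (lift (k + i) (k + j))
  mul_nonneg : ∀ {X : E} (i j : X ⟶ R), le.Factors (lift 0 i) → le.Factors (lift 0 j) →
    le.Factors (lift 0 (i * j))

namespace RingOrder

variable {E : Type u} [Category.{v} E] [CartesianMonoidalCategory E] [BraidedCategory E]
  [HasFiniteLimits E] {R : E} [CommRingObj R] (O : RingOrder R)

/-- The positive cone `{i : R | 0 ≤ i}`. -/
noncomputable def Pos : E := ((Subobject.pullback (lift (0 : R ⟶ R) (𝟙 R))).obj O.le : E)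

/-- The inclusion of the positive cone. -/
noncomputable def val : O.Pos ⟶ R := ((Subobject.pullback (lift (0 : R ⟶ R) (𝟙 R))).obj O.le).arrow

instance : Mono O.val := inferInstanceAs (Mono (Subobject.arrow _))

theorem pos_factors_iff {X : E} (i : X ⟶ R) :
    ((Subobject.pullback (lift (0 : R ⟶ R) (𝟙 R))).obj O.le).Factors i ↔
      O.le.Factors (lift 0 i) := by
  rw [pullback_factors_iff, comp_lift, AddMonObj.comp_zero, Category.comp_id]

/-- A generalized element `i` of `R` with `0 ≤ i`, as an element of the positive cone. -/
noncomputable def mkPos {X : E} (i : X ⟶ R) (h : O.le.Factors (lift 0 i)) : X ⟶ O.Pos :=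
  Subobject.factorThru _ i ((O.pos_factors_iff i).2 h)

theorem mkPos_val {X : E} (i : X ⟶ R) (h : O.le.Factors (lift 0 i)) : O.mkPos i h ≫ O.val = i :=
  Subobject.factorThru_arrow _ _ _

theorem val_nonneg {X : E} (i : X ⟶ O.Pos) : O.le.Factors (lift 0 (i ≫ O.val)) :=
  (O.pos_factors_iff _).1 (Subobject.factors_comp_arrow i)

/-- The order on generalized elements of the positive cone. -/
def Le {X : E} (i j : X ⟶ O.Pos) : Prop := O.le.Factors (lift (i ≫ O.val) (j ≫ O.val))

variable {O}

theorem Le.comp {X Y : E} {i j : X ⟶ O.Pos} (hij : O.Le i j) (h : Y ⟶ X) :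
    O.Le (h ≫ i) (h ≫ j) := by
  unfold Le
  rw [Category.assoc, Category.assoc, ← comp_lift]
  exact Subobject.factors_of_factors_right h hij

theorem Le.rfl {X : E} {i : X ⟶ O.Pos} : O.Le i i := O.refl _

theorem Le.of_eq {X : E} {i j : X ⟶ O.Pos} (h : i = j) : O.Le i j := h ▸ Le.rfl

theorem Le.trans {X : E} {i j k : X ⟶ O.Pos} (h : O.Le i j) (h' : O.Le j k) : O.Le i k :=
  O.trans _ _ _ h h'

theorem Le.antisymm {X : E} {i j : X ⟶ O.Pos} (h : O.Le i j) (h' : O.Le j i) : i = j :=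
  (cancel_mono O.val).1 (O.antisymm _ _ h h')

variable (O)

/-- The least element of the positive cone. -/
noncomputable def zero (X : E) : X ⟶ O.Pos := O.mkPos 0 (O.refl 0)

theorem zero_val (X : E) : O.zero X ≫ O.val = 0 := O.mkPos_val _ _

theorem comp_zero {X Y : E} (h : Y ⟶ X) : h ≫ O.zero X = O.zero Y := by
  rw [← cancel_mono O.val, Category.assoc, zero_val, zero_val, AddMonObj.comp_zero]

variable {O} in
theorem zero_le {X : E} (i : X ⟶ O.Pos) : O.Le (O.zero X) i := by
  unfold Le
  rw [zero_val]
  exact O.val_nonneg i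

theorem add_nonneg {X : E} (i j : X ⟶ R) (hi : O.le.Factors (lift 0 i))
    (hj : O.le.Factors (lift 0 j)) : O.le.Factors (lift 0 (i + j)) :=
  O.trans _ _ _ hi (by simpa using O.add_le _ _ i hj)

theorem sub_nonneg {X : E} {i j : X ⟶ R} (h : O.le.Factors (lift j i)) :
    O.le.Factors (lift 0 (i - j)) := by
  have := O.add_le _ _ (-j) h
  rwa [neg_add_cancel, neg_add_eq_sub] at this

/-- Addition on the positive cone. -/
noncomputable def add {X : E} (i j : X ⟶ O.Pos) : X ⟶ O.Pos :=
  O.mkPos (i ≫ O.val + j ≫ O.val) (O.add_nonneg _ _ (O.val_nonneg i) (O.val_nonneg j))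

theorem add_val {X : E} (i j : X ⟶ O.Pos) : O.add i j ≫ O.val = i ≫ O.val + j ≫ O.val :=
  O.mkPos_val _ _

theorem comp_add {X Y : E} (h : Y ⟶ X) (i j : X ⟶ O.Pos) :
    h ≫ O.add i j = O.add (h ≫ i) (h ≫ j) := by
  rw [← cancel_mono O.val, Category.assoc, add_val, add_val, AddMonObj.comp_add]
  simp only [Category.assoc]

theorem le_add_right {X : E} (i j : X ⟶ O.Pos) : O.Le i (O.add i j) := by
  have := O.add_le _ _ (i ≫ O.val) (O.val_nonneg j)
  unfold Le
  rwa [add_zero, ← add_val] at this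

variable [HasSubobjectClassifier E] [MonoidalClosed E]

/-- The subobject of the stage `X` where `i ≤ j`. -/
noncomputable def leSub {X : E} (i j : X ⟶ O.Pos) : Subobject X :=
  (Subobject.pullback (lift (i ≫ O.val) (j ≫ O.val))).obj O.le

theorem leSub_factors {X Y : E} (i j : X ⟶ O.Pos) (h : Y ⟶ X) :
    (O.leSub i j).Factors h ↔ O.Le (h ≫ i) (h ≫ j) := by
  unfold leSub Le
  rw [pullback_factors_iff, comp_lift, Category.assoc, Category.assoc]

theorem isLUB_leSub {X : E} (i j : X ⟶ O.Pos) : IsLUB {O.leSub i j, O.leSub j i} ⊤ := by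
  have := isLUB_pullback O.total (lift (i ≫ O.val) (j ≫ O.val))
  rw [← Subobject.pullback_comp, comp_lift, lift_snd, lift_fst] at this
  exact this

variable {O} in
theorem hom_ext_le {X Y : E} (i j : X ⟶ O.Pos) {f g : X ⟶ Y}
    (h1 : ∀ (Z : E) (h : Z ⟶ X), O.Le (h ≫ i) (h ≫ j) → h ≫ f = h ≫ g)
    (h2 : ∀ (Z : E) (h : Z ⟶ X), O.Le (h ≫ j) (h ≫ i) → h ≫ f = h ≫ g) : f = g :=
  hom_ext_of_cases (O.isLUB_leSub i j)
    (h1 _ _ ((O.leSub_factors _ _ _).1 (Subobject.factors_self _)))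
    (h2 _ _ ((O.leSub_factors _ _ _).1 (Subobject.factors_self _)))

/-- Definition by cases on `i ≤ j` or `j ≤ i`. -/
theorem exists_cases {X Y : E} (i j : X ⟶ O.Pos) (f g : X ⟶ Y)
    (hfg : ∀ (V : E) (h : V ⟶ X), h ≫ i = h ≫ j → h ≫ f = h ≫ g) :
    ∃ c : X ⟶ Y, (∀ (Z : E) (h : Z ⟶ X), O.Le (h ≫ i) (h ≫ j) → h ≫ c = h ≫ f) ∧
      (∀ (Z : E) (h : Z ⟶ X), O.Le (h ≫ j) (h ≫ i) → h ≫ c = h ≫ g) := by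
  obtain ⟨c, h1, h2⟩ := exists_glue (O.isLUB_leSub i j) ((O.leSub i j).arrow ≫ f)
    ((O.leSub j i).arrow ≫ g) (fun V k l e => by
      have hk := (O.leSub_factors i j (k ≫ (O.leSub i j).arrow)).1 (Subobject.factors_comp_arrow _)
      have hl := (O.leSub_factors j i (l ≫ (O.leSub j i).arrow)).1 (Subobject.factors_comp_arrow _)
      rw [← e] at hl
      have := hfg V _ (hk.antisymm hl)
      rw [← Category.assoc, this, e, Category.assoc])
  refine ⟨c, fun Y h hh => ?_, fun Y h hh => ?_⟩
  · rw [← Subobject.factorThru_arrow _ h ((O.leSub_factors _ _ _).2 hh), Category.assoc, h1,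
      Category.assoc]
  · rw [← Subobject.factorThru_arrow _ h ((O.leSub_factors _ _ _).2 hh), Category.assoc, h2,
      Category.assoc]

theorem exists_min {X : E} (i j : X ⟶ O.Pos) :
    ∃ c : X ⟶ O.Pos, (∀ (Y : E) (h : Y ⟶ X), O.Le (h ≫ i) (h ≫ j) → h ≫ c = h ≫ i) ∧
      (∀ (Y : E) (h : Y ⟶ X), O.Le (h ≫ j) (h ≫ i) → h ≫ c = h ≫ j) :=
  O.exists_cases i j i j fun _ _ h => h

/-- The minimum of two elements of the positive cone: the unique element that equals `i` where
`i ≤ j` and equals `j` where `j ≤ i`. -/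
noncomputable def min {X : E} (i j : X ⟶ O.Pos) : X ⟶ O.Pos := (O.exists_min i j).choose

theorem comp_min {X Y : E} (h : Y ⟶ X) (i j : X ⟶ O.Pos) :
    h ≫ O.min i j = O.min (h ≫ i) (h ≫ j) := by
  obtain ⟨a1, a2⟩ := (O.exists_min i j).choose_spec
  obtain ⟨b1, b2⟩ := (O.exists_min (h ≫ i) (h ≫ j)).choose_spec
  refine hom_ext_le (h ≫ i) (h ≫ j) (fun Z k hk => ?_) (fun Z k hk => ?_)
  · have := a1 Z (k ≫ h) (by simpa using hk)
    simp only [Category.assoc] at this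
    exact this.trans (b1 Z k hk).symm
  · have := a2 Z (k ≫ h) (by simpa using hk)
    simp only [Category.assoc] at this
    exact this.trans (b2 Z k hk).symm

variable {O}

theorem min_eq_left {X : E} {i j : X ⟶ O.Pos} (h : O.Le i j) : O.min i j = i := by
  have := (O.exists_min i j).choose_spec.1 X (𝟙 X) (by simpa using h)
  rwa [Category.id_comp, Category.id_comp] at this

theorem min_eq_right {X : E} {i j : X ⟶ O.Pos} (h : O.Le j i) : O.min i j = j := by
  have := (O.exists_min i j).choose_spec.2 X (𝟙 X) (by simpa using h)
  rwa [Category.id_comp, Category.id_comp] at this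

theorem min_le_left {X : E} (i j : X ⟶ O.Pos) : O.Le (O.min i j) i := by
  have : O.leSub (O.min i j) i = ⊤ := by
    refine le_antisymm le_top ((O.isLUB_leSub i j).2 ?_)
    rintro S (rfl | rfl)
    · refine Subobject.le_of_factors ((O.leSub_factors _ _ _).2 ?_)
      rw [comp_min, min_eq_left ((O.leSub_factors _ _ _).1 (Subobject.factors_self _))]
      exact Le.rfl
    · have h := (O.leSub_factors _ _ _).1 (Subobject.factors_self (O.leSub j i))
      refine Subobject.le_of_factors ((O.leSub_factors _ _ _).2 ?_)
      rw [comp_min, min_eq_right h]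
      exact h
  have := (O.leSub_factors (O.min i j) i (𝟙 X)).1 (this ▸ Subobject.top_factors _)
  simpa using this

variable (O)

/-- Truncated subtraction on the positive cone: `0` where `i ≤ j` and `i - j` where `j ≤ i`. -/
noncomputable def monus {X : E} (i j : X ⟶ O.Pos) : X ⟶ O.Pos :=
  O.mkPos (i ≫ O.val - O.min i j ≫ O.val) (O.sub_nonneg (min_le_left i j))

theorem monus_val {X : E} (i j : X ⟶ O.Pos) :
    O.monus i j ≫ O.val = i ≫ O.val - O.min i j ≫ O.val := O.mkPos_val _ _

theorem comp_monus {X Y : E} (h : Y ⟶ X) (i j : X ⟶ O.Pos) :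
    h ≫ O.monus i j = O.monus (h ≫ i) (h ≫ j) := by
  rw [← cancel_mono O.val, Category.assoc, monus_val, monus_val, ← comp_min, AddGrpObj.comp_sub]
  simp only [Category.assoc]

variable {O}

theorem monus_eq_zero {X : E} {i j : X ⟶ O.Pos} (h : O.Le i j) : O.monus i j = O.zero X := by
  rw [← cancel_mono O.val, monus_val, zero_val, min_eq_left h, sub_self]

theorem monus_val_of_le {X : E} {i j : X ⟶ O.Pos} (h : O.Le j i) :
    O.monus i j ≫ O.val = i ≫ O.val - j ≫ O.val := by
  rw [monus_val, min_eq_right h]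

theorem monus_zero {X : E} (i : X ⟶ O.Pos) : O.monus i (O.zero X) = i := by
  rw [← cancel_mono O.val, monus_val_of_le (zero_le i), zero_val, sub_zero]

theorem monus_le {X : E} (i j : X ⟶ O.Pos) : O.Le (O.monus i j) i := by
  unfold Le
  rw [monus_val]
  have := O.add_le _ _ (i ≫ O.val - O.min i j ≫ O.val) (O.val_nonneg (O.min i j))
  rwa [add_zero, sub_add_cancel] at this

theorem monus_monus {X : E} (i j : X ⟶ O.Pos) : O.monus i (O.monus i j) = O.min i j := by
  rw [← cancel_mono O.val, monus_val_of_le (monus_le i j), monus_val, sub_sub_cancel]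

theorem le_monus {X : E} {i j k : X ⟶ O.Pos} (h : O.Le (O.add i j) k) :
    O.Le j (O.monus k i) := by
  unfold Le
  rw [monus_val_of_le ((O.le_add_right i j).trans h)]
  have := O.add_le _ _ (-(i ≫ O.val)) h
  rwa [add_val, neg_add_cancel_left, neg_add_eq_sub] at this

end RingOrder

/-! ### Families -/

/-- A family of types over `Γ`, given through its generalized elements: `El x` is the set of
elements of the family over a generalized element `x : X ⟶ Γ`, and elements can be restricted along
a change of stage `h : Y ⟶ X`. -/
structure Fam {E : Type u} [Category.{v} E] (Γ : E) where
  /-- elements of the family over `x` -/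
  El : ∀ {X : E}, (X ⟶ Γ) → Type v
  /-- restriction of elements -/
  restr : ∀ {X Y : E} (h : Y ⟶ X) {x : X ⟶ Γ} {y : Y ⟶ Γ}, h ≫ x = y → El x → El y
  restr_id : ∀ {X : E} {x : X ⟶ Γ} (a : El x), restr (𝟙 X) (Category.id_comp x) a = a
  restr_comp : ∀ {X Y Z : E} (h : Y ⟶ X) (g : Z ⟶ Y) {x : X ⟶ Γ} {y : Y ⟶ Γ} {z : Z ⟶ Γ}
    (e : h ≫ x = y) (e' : g ≫ y = z) (a : El x),
    restr g e' (restr h e a) = restr (g ≫ h) (by rw [Category.assoc, e, e']) a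

/-- The type families of the category with families of `E`: families `A` over `Γ` that are
representable, with a choice, for every `x : X ⟶ Γ`, of a comprehension object `X.A[x]` with its
projection `proj x` and generic element `var x`; morphisms `Y ⟶ X.A[x]` correspond to pairs of a
morphism `h : Y ⟶ X` and an element of `A` over `h ≫ x`. Re-indexing along `γ : Δ ⟶ Γ` replaces
`x` by `x ≫ γ` and is strictly functorial. -/
structure Ty {E : Type u} [Category.{v} E] (Γ : E) extends Fam Γ where
  /-- comprehension -/
  ext : ∀ {X : E}, (X ⟶ Γ) → E
  /-- the projection of the comprehension -/
  proj : ∀ {X : E} (x : X ⟶ Γ), ext x ⟶ X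
  /-- the generic element -/
  var : ∀ {X : E} (x : X ⟶ Γ), El (proj x ≫ x)
  /-- pairing -/
  pair : ∀ {X Y : E} (x : X ⟶ Γ) (h : Y ⟶ X), El (h ≫ x) → (Y ⟶ ext x)
  pair_proj : ∀ {X Y : E} (x : X ⟶ Γ) (h : Y ⟶ X) (a : El (h ≫ x)), pair x h a ≫ proj x = h
  pair_var : ∀ {X Y : E} (x : X ⟶ Γ) (h : Y ⟶ X) (a : El (h ≫ x)),
    restr (pair x h a) (by rw [← Category.assoc, pair_proj]) (var x) = a
  pair_eta : ∀ {X Y : E} (x : X ⟶ Γ) (k : Y ⟶ ext x),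
    pair x (k ≫ proj x) (restr k (Category.assoc _ _ _).symm (var x)) = k

namespace Fam

variable {E : Type u} [Category.{v} E] {Γ : E}

/-- The constant family at an object `C`. -/
abbrev const (Γ C : E) : Fam Γ where
  El {X} _ := X ⟶ C
  restr h _ _ _ a := h ≫ a
  restr_id a := Category.id_comp a
  restr_comp h g _ _ _ _ _ a := (Category.assoc g h a).symm

theorem restr_congr (A : Fam Γ) {X Y : E} {h h' : Y ⟶ X} {x : X ⟶ Γ} {y : Y ⟶ Γ}
    (e : h ≫ x = y) (e' : h' ≫ x = y) {a : A.El x} (hh : h = h') :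
    A.restr h e a = A.restr h' e' a := by
  subst hh
  rfl

theorem restr_heq (A : Fam Γ) {X Y : E} {h h' : Y ⟶ X} {x x' : X ⟶ Γ} {y y' : Y ⟶ Γ}
    (e : h ≫ x = y) (e' : h' ≫ x' = y') {a : A.El x} {a' : A.El x'} (hh : h = h') (hx : x = x')
    (ha : HEq a a') : HEq (A.restr h e a) (A.restr h' e' a') := by
  subst hh hx ha e e'
  rfl

theorem restr_id_heq (A : Fam Γ) {X : E} {x y : X ⟶ Γ} (e : 𝟙 X ≫ x = y) (a : A.El x) :
    HEq (A.restr (𝟙 X) e a) a := by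
  have : x = y := by rw [← e, Category.id_comp]
  subst this
  exact heq_of_eq (A.restr_id a)

end Fam

namespace Ty

variable {E : Type u} [Category.{v} E] {Γ : E}

/-- The morphism `X.A[h ≫ x] ⟶ Y.A[x]` between comprehensions induced by `h : X ⟶ Y`. -/
def extMap (A : Ty Γ) {X Y : E} (h : X ⟶ Y) (x : Y ⟶ Γ) : A.ext (h ≫ x) ⟶ A.ext x :=
  A.pair x (A.proj (h ≫ x) ≫ h)
    (A.restr (𝟙 _) (by rw [Category.id_comp, Category.assoc]) (A.var (h ≫ x)))

theorem hom_ext (A : Ty Γ) {X Y : E} {x : X ⟶ Γ} {k l : Y ⟶ A.ext x}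
    (h1 : k ≫ A.proj x = l ≫ A.proj x)
    (h2 : HEq (A.restr k rfl (A.var x)) (A.restr l rfl (A.var x))) : k = l := by
  rw [← A.pair_eta x k, ← A.pair_eta x l]
  have : HEq (A.restr k (Category.assoc _ _ _).symm (A.var x))
      (A.restr l (Category.assoc _ _ _).symm (A.var x)) :=
    ((A.restr_heq _ _ rfl rfl HEq.rfl).trans h2).trans (A.restr_heq _ _ rfl rfl HEq.rfl)
  revert this
  generalize A.restr k (Category.assoc _ _ _).symm (A.var x) = a
  generalize A.restr l (Category.assoc _ _ _).symm (A.var x) = b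
  revert a b
  rw [h1]
  intro a b hab
  rw [eq_of_heq hab]

theorem pair_congr (A : Ty Γ) {X Y : E} (x : X ⟶ Γ) {h h' : Y ⟶ X} {a : A.El (h ≫ x)}
    {a' : A.El (h' ≫ x)} (hh : h = h') (ha : HEq a a') : A.pair x h a = A.pair x h' a' := by
  subst hh ha
  rfl

theorem comp_pair (A : Ty Γ) {X Y Z : E} (x : X ⟶ Γ) (h : Y ⟶ X) (a : A.El (h ≫ x)) (k : Z ⟶ Y) :
    k ≫ A.pair x h a = A.pair x (k ≫ h) (A.restr k (Category.assoc _ _ _).symm a) := by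
  conv_lhs => rw [← A.pair_eta x (k ≫ A.pair x h a)]
  refine A.pair_congr x (by rw [Category.assoc, A.pair_proj]) ?_
  conv_rhs => rw [← A.pair_var x h a]
  rw [A.restr_comp]
  exact A.restr_heq _ _ rfl rfl HEq.rfl

theorem pair_extMap (A : Ty Γ) {X Y Z : E} (h : X ⟶ Y) (x : Y ⟶ Γ) (k : Z ⟶ X)
    (a : A.El (k ≫ h ≫ x)) :
    A.pair (h ≫ x) k a ≫ A.extMap h x =
      A.pair x (k ≫ h) (A.restr (𝟙 Z) (by rw [Category.id_comp, Category.assoc]) a) := by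
  unfold extMap
  rw [A.comp_pair]
  refine A.pair_congr x (by rw [← Category.assoc, A.pair_proj]) ?_
  rw [A.restr_comp]
  refine HEq.trans ?_ (A.restr_id_heq _ _).symm
  conv_rhs => rw [← A.pair_var (h ≫ x) k a]
  exact A.restr_heq _ _ (Category.comp_id _) rfl HEq.rfl

end Ty

/-! ### Moore paths -/

section Paths

variable {E : Type u} [Category.{v} E] [CartesianMonoidalCategory E] [BraidedCategory E]
  [HasFiniteLimits E] {R : E} [CommRingObj R] (O : RingOrder R)

/-- Moore paths in the fibre over `x : X ⟶ Γ` of a family `A`: pairs of a function `fn` from the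
positive cone to the fibre and a shape `len` such that `fn` is `a` at `0` and is `b` at every
`j ≥ len`. -/
@[ext]
structure MoorePath {Γ : E} (A : Fam Γ) {X : E} {x : X ⟶ Γ} (a b : A.El x) where
  /-- the underlying function on the positive cone -/
  fn : A.El (fst X O.Pos ≫ x)
  /-- the shape -/
  len : X ⟶ O.Pos
  start : A.restr (lift (𝟙 X) (O.zero X)) (by simp) fn = a
  finish : ∀ {Y : E} (h : Y ⟶ X) {y : Y ⟶ Γ} (e : h ≫ x = y) (j : Y ⟶ O.Pos), O.Le (h ≫ len) j →
    A.restr (lift h j) (by rw [← Category.assoc, lift_fst, e]) fn = A.restr h e b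

/-- Moore paths in an object `C`, between generalized elements `x y : X ⟶ C`. -/
abbrev Path {C X : E} (x y : X ⟶ C) : Type v :=
  MoorePath O (Fam.const (𝟙_ E) C) (x := toUnit X) x y

variable {O}

namespace MoorePath

variable {Γ : E} {A : Fam Γ}

theorem finish_len {X : E} {x : X ⟶ Γ} {a b : A.El x} (p : MoorePath O A a b) :
    A.restr (lift (𝟙 X) p.len) (by simp) p.fn = b :=
  (p.finish (𝟙 X) (Category.id_comp x) p.len (RingOrder.Le.of_eq (Category.id_comp _))).trans
    (A.restr_id b)

/-- Change of endpoints along equalities. -/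
def copy {X : E} {x : X ⟶ Γ} {a b a' b' : A.El x} (p : MoorePath O A a b) (ha : a = a')
    (hb : b = b') : MoorePath O A a' b' where
  fn := p.fn
  len := p.len
  start := p.start.trans ha
  finish h _ e j hj := hb ▸ p.finish h e j hj

/-- Change of stage. -/
noncomputable def restr {X Y : E} {x : X ⟶ Γ} {a b : A.El x} (p : MoorePath O A a b) (h : Y ⟶ X) {y : Y ⟶ Γ}
    (e : h ≫ x = y) : MoorePath O A (A.restr h e a) (A.restr h e b) where
  fn := A.restr (h ▷ O.Pos) (by rw [← e, whiskerRight_fst_assoc]) p.fn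
  len := h ≫ p.len
  start := by
    refine Eq.trans ?_ (congrArg (A.restr h e) p.start)
    rw [A.restr_comp, A.restr_comp]
    apply A.restr_congr
    rw [comp_lift, O.comp_zero, lift_whiskerRight, Category.id_comp, Category.comp_id]
  finish {Z} k z e' j hj := by
    rw [A.restr_comp, A.restr_comp, ← p.finish (k ≫ h) (by rw [Category.assoc, e, e']) j
      (by rwa [Category.assoc])]
    apply A.restr_congr
    rw [lift_whiskerRight]

/-- The degenerate path. -/
noncomputable def idp {X : E} {x : X ⟶ Γ} (a : A.El x) : MoorePath O A a a where
  fn := A.restr (fst X O.Pos) rfl a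
  len := O.zero X
  start := by
    rw [A.restr_comp]
    exact (A.restr_congr _ _ (lift_fst _ _)).trans (A.restr_id a)
  finish h y e j _ := by
    rw [A.restr_comp]
    exact A.restr_congr _ _ (lift_fst _ _)

variable [HasSubobjectClassifier E] [MonoidalClosed E]

/-- Bounded abstraction `⟨i ≤ j⟩ φ i`: the path `(fun i => φ (min i j), j)` from `φ 0` to `φ j`. -/
noncomputable def abs {X : E} {x : X ⟶ Γ} (φ : A.El (fst X O.Pos ≫ x)) (j : X ⟶ O.Pos)
    {a b : A.El x} (ha : A.restr (lift (𝟙 X) (O.zero X)) (by simp) φ = a)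
    (hb : A.restr (lift (𝟙 X) j) (by simp) φ = b) : MoorePath O A a b where
  fn := A.restr (lift (fst X O.Pos) (O.min (snd X O.Pos) (fst X O.Pos ≫ j)))
    (by rw [← Category.assoc, lift_fst]) φ
  len := j
  start := by
    rw [← ha, A.restr_comp]
    apply A.restr_congr
    rw [comp_lift, O.comp_min, lift_fst, lift_snd, lift_fst_assoc, Category.id_comp,
      RingOrder.min_eq_left (RingOrder.zero_le _)]
  finish h y e k hk := by
    rw [← hb, A.restr_comp, A.restr_comp]
    apply A.restr_congr
    rw [comp_lift, comp_lift, O.comp_min, lift_fst, lift_snd, lift_fst_assoc, Category.comp_id,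
      RingOrder.min_eq_right hk]

/-- Path reversal: same shape, with `(rev p) i = p (len - i)` for truncated subtraction. -/
noncomputable def rev {X : E} {x : X ⟶ Γ} {a b : A.El x} (p : MoorePath O A a b) :
    MoorePath O A b a where
  fn := A.restr (lift (fst X O.Pos) (O.monus (fst X O.Pos ≫ p.len) (snd X O.Pos)))
    (by rw [← Category.assoc, lift_fst]) p.fn
  len := p.len
  start := by
    refine Eq.trans ?_ p.finish_len
    rw [A.restr_comp]
    apply A.restr_congr
    rw [comp_lift, O.comp_monus, lift_fst, lift_snd, lift_fst_assoc, Category.id_comp,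
      RingOrder.monus_zero]
  finish h y e k hk := by
    refine Eq.trans ?_ (congrArg (A.restr h e) p.start)
    rw [A.restr_comp, A.restr_comp]
    apply A.restr_congr
    rw [comp_lift, comp_lift, O.comp_monus, lift_fst, lift_snd, lift_fst_assoc, Category.comp_id,
      RingOrder.monus_eq_zero hk, O.comp_zero]

theorem exists_comp {A : Ty Γ} {X : E} {x : X ⟶ Γ} {a b c : A.El x}
    (p : MoorePath O A.toFam a b) (q : MoorePath O A.toFam b c) :
    ∃ r : MoorePath O A.toFam a c, r.len = O.add p.len q.len ∧
      (∀ (Y : E) (h : Y ⟶ X) (j : Y ⟶ O.Pos), O.Le j (h ≫ p.len) →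
        A.restr (lift h j) (lift_fst_assoc _ _ _) r.fn =
          A.restr (lift h j) (lift_fst_assoc _ _ _) p.fn) ∧
      (∀ (Y : E) (h : Y ⟶ X) (j : Y ⟶ O.Pos), O.Le (h ≫ p.len) j →
        A.restr (lift h j) (lift_fst_assoc _ _ _) r.fn =
          A.restr (lift h (O.monus j (h ≫ p.len))) (lift_fst_assoc _ _ _) q.fn) := by
  let f : X ⊗ O.Pos ⟶ A.ext x := A.pair x (fst X O.Pos) p.fn
  let g : X ⊗ O.Pos ⟶ A.ext x := A.pair x (fst X O.Pos)
    (A.restr (lift (fst X O.Pos) (O.monus (snd X O.Pos) (fst X O.Pos ≫ p.len)))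
      (lift_fst_assoc _ _ _) q.fn)
  obtain ⟨k, hk1, hk2⟩ := O.exists_cases (snd X O.Pos) (fst X O.Pos ≫ p.len) f g (by
    intro V h e
    rw [A.comp_pair, A.comp_pair, A.restr_comp]
    refine congrArg (A.pair x _) ?_
    have hh : h = lift (h ≫ fst X O.Pos) (h ≫ fst X O.Pos ≫ p.len) := by
      rw [← e]; ext <;> simp
    rw [A.restr_congr _ (by rw [lift_fst_assoc, Category.assoc]) hh, p.finish _ rfl _
      (RingOrder.Le.of_eq (by rw [Category.assoc]))]
    refine (congrArg (A.restr (h ≫ fst X O.Pos) rfl) q.start).symm.trans ?_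
    rw [A.restr_comp]
    apply A.restr_congr
    rw [comp_lift, comp_lift, O.comp_monus, e, RingOrder.monus_eq_zero RingOrder.Le.rfl,
      O.comp_zero, Category.comp_id])
  have hproj : k ≫ A.proj x = fst X O.Pos := by
    refine RingOrder.hom_ext_le (snd X O.Pos) (fst X O.Pos ≫ p.len) (fun Z h hh => ?_)
      (fun Z h hh => ?_)
    · rw [← Category.assoc, hk1 Z h hh, Category.assoc, A.pair_proj]
    · rw [← Category.assoc, hk2 Z h hh, Category.assoc, A.pair_proj]
  have h1 : ∀ (Y : E) (h : Y ⟶ X) (y : Y ⟶ Γ) (e : h ≫ x = y) (j : Y ⟶ O.Pos),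
      O.Le j (h ≫ p.len) →
      A.restr (lift h j) (by rw [lift_fst_assoc, e]) (A.restr k (by rw [← Category.assoc, hproj])
        (A.var x)) = A.restr (lift h j) (by rw [lift_fst_assoc, e]) p.fn := by
    intro Y h y ey j hj
    have e := hk1 Y (lift h j) (by rwa [lift_snd, lift_fst_assoc])
    conv_rhs => rw [← A.pair_var x (fst X O.Pos) p.fn]
    rw [A.restr_comp, A.restr_comp]
    exact A.restr_congr _ _ e
  have h2 : ∀ (Y : E) (h : Y ⟶ X) (y : Y ⟶ Γ) (e : h ≫ x = y) (j : Y ⟶ O.Pos),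
      O.Le (h ≫ p.len) j →
      A.restr (lift h j) (by rw [lift_fst_assoc, e]) (A.restr k (by rw [← Category.assoc, hproj])
        (A.var x)) =
        A.restr (lift h (O.monus j (h ≫ p.len))) (by rw [lift_fst_assoc, e]) q.fn := by
    intro Y h y ey j hj
    have e := hk2 Y (lift h j) (by rwa [lift_snd, lift_fst_assoc])
    have e' : A.restr (lift h (O.monus j (h ≫ p.len))) (by rw [lift_fst_assoc, ey]) q.fn =
        A.restr (lift h j) (by rw [lift_fst_assoc, ey])
          (A.restr (lift (fst X O.Pos) (O.monus (snd X O.Pos) (fst X O.Pos ≫ p.len)))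
            (lift_fst_assoc _ _ _) q.fn) := by
      rw [A.restr_comp]
      apply A.restr_congr
      rw [comp_lift, O.comp_monus, lift_fst, lift_snd, lift_fst_assoc]
    rw [e', ← A.pair_var x (fst X O.Pos) (A.restr (lift (fst X O.Pos)
      (O.monus (snd X O.Pos) (fst X O.Pos ≫ p.len))) (lift_fst_assoc _ _ _) q.fn)]
    rw [A.restr_comp, A.restr_comp]
    exact A.restr_congr _ _ e
  refine ⟨⟨A.restr k (by rw [← Category.assoc, hproj]) (A.var x), O.add p.len q.len, ?_, ?_⟩,
    rfl, fun Y h => h1 Y h _ rfl, fun Y h => h2 Y h _ rfl⟩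
  · exact (h1 X (𝟙 X) x (Category.id_comp x) (O.zero X) (RingOrder.zero_le _)).trans p.start
  · intro Y h y e j hj
    rw [O.comp_add] at hj
    exact (h2 Y h y e j ((O.le_add_right _ _).trans hj)).trans
      (q.finish h e _ (RingOrder.le_monus hj))

/-- Path composition: `comp p q` has shape `|p| + |q|`, follows `p` up to `|p|` and then follows
`q`. -/
noncomputable def comp {A : Ty Γ} {X : E} {x : X ⟶ Γ} {a b c : A.El x}
    (p : MoorePath O A.toFam a b) (q : MoorePath O A.toFam b c) : MoorePath O A.toFam a c :=
  (exists_comp p q).choose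

end MoorePath

namespace Path

variable {C X : E}

/-- The action of a morphism on paths. -/
noncomputable def map {D : E} {x y : X ⟶ C} (p : Path O x y) (γ : C ⟶ D) : Path O (x ≫ γ) (y ≫ γ) where
  fn := p.fn ≫ γ
  len := p.len
  start := (Category.assoc _ _ _).symm.trans (congrArg (· ≫ γ) p.start)
  finish h _ e j hj := (Category.assoc _ _ _).symm.trans
    ((congrArg (· ≫ γ) (p.finish h e j hj)).trans (Category.assoc _ _ _))

/-- Change of stage. -/
noncomputable def stage {Y : E} {x y : X ⟶ C} (p : Path O x y) (h : Y ⟶ X) :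
    Path O (h ≫ x) (h ≫ y) :=
  MoorePath.restr p h (toUnit_unique _ _)

/-- The point of a path at an element `i` of the positive cone. -/
noncomputable def pt {x y : X ⟶ C} (p : Path O x y) (i : X ⟶ O.Pos) : X ⟶ C :=
  lift (𝟙 X) i ≫ p.fn

theorem at_zero {x y : X ⟶ C} (p : Path O x y) : p.pt (O.zero X) = x := p.start

theorem at_len {x y : X ⟶ C} (p : Path O x y) : p.pt p.len = y := p.finish_len

theorem lift_fn_of_le {x y : X ⟶ C} (p : Path O x y) {Y : E} (h : Y ⟶ X) (j : Y ⟶ O.Pos)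
    (hj : O.Le (h ≫ p.len) j) : lift h j ≫ p.fn = h ≫ y :=
  p.finish h (toUnit_unique (h ≫ toUnit X) (toUnit Y)) j hj

variable [HasSubobjectClassifier E] [MonoidalClosed E]

theorem at_min {x y : X ⟶ C} (p : Path O x y) (i : X ⟶ O.Pos) :
    p.pt (O.min p.len i) = p.pt i := by
  unfold pt
  refine RingOrder.hom_ext_le p.len i (fun Z h hh => ?_) (fun Z h hh => ?_)
  · rw [← Category.assoc, ← Category.assoc, comp_lift, comp_lift, O.comp_min,
      RingOrder.min_eq_left hh, Category.comp_id, p.lift_fn_of_le _ _ RingOrder.Le.rfl,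
      p.lift_fn_of_le _ _ hh]
  · rw [← Category.assoc, ← Category.assoc, comp_lift, comp_lift, O.comp_min,
      RingOrder.min_eq_right hh]

/-- Path contraction: the initial segment of `p` from `x` to `p i`. -/
noncomputable def upto {x y : X ⟶ C} (p : Path O x y) (i : X ⟶ O.Pos) : Path O x (p.pt i) :=
  MoorePath.abs (A := Fam.const (𝟙_ E) C) (x := toUnit X) p.fn (O.min p.len i) p.start (p.at_min i)

/-- The final segment of `p` from `p i` to `y`, obtained from an initial segment of the reversed
path. -/
noncomputable def onward {x y : X ⟶ C} (p : Path O x y) (i : X ⟶ O.Pos) : Path O (p.pt i) y :=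
  (MoorePath.rev (Path.upto (MoorePath.rev p) (O.monus p.len i))).copy (by
    refine Eq.trans ?_ (p.at_min i)
    unfold pt
    change lift (𝟙 X) (O.monus p.len i) ≫
      lift (fst X O.Pos) (O.monus (fst X O.Pos ≫ p.len) (snd X O.Pos)) ≫ p.fn = _
    rw [← Category.assoc, comp_lift, O.comp_monus, lift_fst, lift_snd, lift_fst_assoc,
      Category.id_comp, RingOrder.monus_monus]) rfl

theorem upto_stage_fn {x y : X ⟶ C} (p : Path O x y) (t : X ⟶ O.Pos) :
    lift (𝟙 X) t ▷ O.Pos ≫ ((p.stage (fst X O.Pos)).upto (snd X O.Pos)).fn = (p.upto t).fn := by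
  change lift (𝟙 X) t ▷ O.Pos ≫ lift (fst _ O.Pos) (O.min (snd _ O.Pos) (fst _ O.Pos ≫
    O.min (fst X O.Pos ≫ p.len) (snd X O.Pos))) ≫ fst X O.Pos ▷ O.Pos ≫ p.fn =
      lift (fst X O.Pos) (O.min (snd X O.Pos) (fst X O.Pos ≫ O.min p.len t)) ≫ p.fn
  simp [comp_lift_assoc, RingOrder.comp_min]

theorem upto_stage_len {x y : X ⟶ C} (p : Path O x y) (t : X ⟶ O.Pos) :
    lift (𝟙 X) t ≫ ((p.stage (fst X O.Pos)).upto (snd X O.Pos)).len = (p.upto t).len := by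
  change lift (𝟙 X) t ≫ O.min (fst X O.Pos ≫ p.len) (snd X O.Pos) = O.min p.len t
  simp [RingOrder.comp_min]

theorem stage_pt {x y : X ⟶ C} (p : Path O x y) (t : X ⟶ O.Pos) :
    lift (𝟙 X) t ≫ (p.stage (fst X O.Pos)).pt (snd X O.Pos) = p.pt t := by
  change lift (𝟙 X) t ≫ lift (𝟙 _) (snd X O.Pos) ≫ fst X O.Pos ▷ O.Pos ≫ p.fn =
    lift (𝟙 X) t ≫ p.fn
  simp

theorem onward_fn {x y : X ⟶ C} (p : Path O x y) (i : X ⟶ O.Pos) :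
    (p.onward i).fn = lift (fst X O.Pos) (O.monus (fst X O.Pos ≫ p.len)
      (O.min (O.monus (fst X O.Pos ≫ O.min p.len (O.monus p.len i)) (snd X O.Pos))
        (fst X O.Pos ≫ O.min p.len (O.monus p.len i)))) ≫ p.fn := by
  change lift (fst X O.Pos) (O.monus (fst X O.Pos ≫ O.min p.len (O.monus p.len i))
    (snd X O.Pos)) ≫ lift (fst X O.Pos) (O.min (snd X O.Pos)
      (fst X O.Pos ≫ O.min p.len (O.monus p.len i))) ≫
    lift (fst X O.Pos) (O.monus (fst X O.Pos ≫ p.len) (snd X O.Pos)) ≫ p.fn = _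
  simp [comp_lift_assoc, RingOrder.comp_min, RingOrder.comp_monus]

theorem onward_stage_fn {x y : X ⟶ C} (p : Path O x y) (t : X ⟶ O.Pos) :
    lift (𝟙 X) t ▷ O.Pos ≫ ((p.stage (fst X O.Pos)).onward (snd X O.Pos)).fn =
      (p.onward t).fn := by
  rw [onward_fn, onward_fn]
  change lift (𝟙 X) t ▷ O.Pos ≫ lift (fst _ O.Pos) (O.monus (fst _ O.Pos ≫ fst X O.Pos ≫ p.len)
    (O.min (O.monus (fst _ O.Pos ≫ O.min (fst X O.Pos ≫ p.len) (O.monus (fst X O.Pos ≫ p.len)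
      (snd X O.Pos))) (snd _ O.Pos)) (fst _ O.Pos ≫ O.min (fst X O.Pos ≫ p.len)
        (O.monus (fst X O.Pos ≫ p.len) (snd X O.Pos))))) ≫ fst X O.Pos ▷ O.Pos ≫ p.fn = _
  simp [comp_lift_assoc, RingOrder.comp_min, RingOrder.comp_monus]

theorem onward_stage_len {x y : X ⟶ C} (p : Path O x y) (t : X ⟶ O.Pos) :
    lift (𝟙 X) t ≫ ((p.stage (fst X O.Pos)).onward (snd X O.Pos)).len = (p.onward t).len := by
  change lift (𝟙 X) t ≫ O.min (fst X O.Pos ≫ p.len) (O.monus (fst X O.Pos ≫ p.len)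
    (snd X O.Pos)) = O.min p.len (O.monus p.len t)
  simp [RingOrder.comp_min, RingOrder.comp_monus]

theorem lift_min_fn {x y : X ⟶ C} (p : Path O x y) :
    lift (fst X O.Pos) (O.min (snd X O.Pos) (fst X O.Pos ≫ p.len)) ≫ p.fn = p.fn := by
  refine RingOrder.hom_ext_le (snd X O.Pos) (fst X O.Pos ≫ p.len) (fun Z h hh => ?_)
    (fun Z h hh => ?_)
  · rw [← Category.assoc, comp_lift, O.comp_min, RingOrder.min_eq_left hh]
    congr 1
    ext <;> simp
  · rw [← Category.assoc, comp_lift, O.comp_min, RingOrder.min_eq_right hh,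
      p.lift_fn_of_le _ _ (by rw [Category.assoc]; exact RingOrder.Le.rfl)]
    have : h = lift (h ≫ fst X O.Pos) (h ≫ snd X O.Pos) := by ext <;> simp
    conv_rhs => rw [this]
    rw [p.lift_fn_of_le _ _ (by rw [Category.assoc]; exact hh)]

theorem fst_lift_fn {x y : X ⟶ C} (p : Path O x y) (j : X ⊗ O.Pos ⟶ O.Pos)
    (hj : j = O.zero _) : lift (fst X O.Pos) j ≫ p.fn = fst X O.Pos ≫ x := by
  subst hj
  have := congrArg (fst X O.Pos ≫ ·) p.at_zero
  simpa [pt, comp_lift_assoc, RingOrder.comp_zero] using this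

theorem upto_zero_fn {x y : X ⟶ C} (p : Path O x y) :
    (p.upto (O.zero X)).fn = fst X O.Pos ≫ x := by
  change lift (fst X O.Pos) (O.min (snd X O.Pos) (fst X O.Pos ≫ O.min p.len (O.zero X))) ≫ p.fn = _
  exact p.fst_lift_fn _ (by
    rw [RingOrder.min_eq_right (RingOrder.zero_le _), O.comp_zero,
      RingOrder.min_eq_right (RingOrder.zero_le _)])

theorem upto_zero_len {x y : X ⟶ C} (p : Path O x y) : (p.upto (O.zero X)).len = O.zero X :=
  RingOrder.min_eq_right (RingOrder.zero_le _)

theorem upto_len_fn {x y : X ⟶ C} (p : Path O x y) : (p.upto p.len).fn = p.fn := by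
  change lift (fst X O.Pos) (O.min (snd X O.Pos) (fst X O.Pos ≫ O.min p.len p.len)) ≫ p.fn = _
  rw [RingOrder.min_eq_right RingOrder.Le.rfl]
  exact p.lift_min_fn

theorem upto_len_len {x y : X ⟶ C} (p : Path O x y) : (p.upto p.len).len = p.len :=
  RingOrder.min_eq_right RingOrder.Le.rfl

theorem onward_zero_fn {x y : X ⟶ C} (p : Path O x y) : (p.onward (O.zero X)).fn = p.fn := by
  rw [onward_fn, RingOrder.monus_zero, RingOrder.min_eq_right (i := p.len) RingOrder.Le.rfl,
    RingOrder.min_eq_left (RingOrder.monus_le _ _), RingOrder.monus_monus]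
  refine Eq.trans ?_ p.lift_min_fn
  congr 2
  refine RingOrder.hom_ext_le (snd X O.Pos) (fst X O.Pos ≫ p.len) (fun Z h hh => ?_)
    (fun Z h hh => ?_)
  · rw [O.comp_min, O.comp_min, RingOrder.min_eq_left hh, RingOrder.min_eq_right hh]
  · rw [O.comp_min, O.comp_min, RingOrder.min_eq_left hh, RingOrder.min_eq_right hh]

theorem onward_zero_len {x y : X ⟶ C} (p : Path O x y) : (p.onward (O.zero X)).len = p.len := by
  change O.min p.len (O.monus p.len (O.zero X)) = _
  rw [RingOrder.monus_zero, RingOrder.min_eq_right RingOrder.Le.rfl]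

theorem onward_len_fn {x y : X ⟶ C} (p : Path O x y) :
    (p.onward p.len).fn = fst X O.Pos ≫ y := by
  rw [onward_fn, RingOrder.monus_eq_zero RingOrder.Le.rfl,
    RingOrder.min_eq_right (RingOrder.zero_le p.len), O.comp_zero,
    RingOrder.min_eq_right (RingOrder.zero_le _), RingOrder.monus_zero]
  exact p.lift_fn_of_le _ _ RingOrder.Le.rfl

theorem onward_len_len {x y : X ⟶ C} (p : Path O x y) :
    (p.onward p.len).len = O.zero X := by
  change O.min p.len (O.monus p.len p.len) = _
  rw [RingOrder.monus_eq_zero RingOrder.Le.rfl, RingOrder.min_eq_right (RingOrder.zero_le _)]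

end Path

/-! ### Transport-along-paths structures -/

/-- A transport-along-paths structure on a family `A` over `Γ`: for every path from `x` to `y` in
`Γ` a function from `A x` to `A y`, naturally in the stage, which is the identity for degenerate
paths. -/
structure Tap (O : RingOrder R) {Γ : E} (A : Fam Γ) where
  /-- transport -/
  tr : ∀ {X : E} {x y : X ⟶ Γ}, Path O x y → A.El x → A.El y
  tr_restr : ∀ {X Y : E} (h : Y ⟶ X) {x y : X ⟶ Γ} (p : Path O x y) (a : A.El x),
    A.restr h rfl (tr p a) = tr (p.stage h) (A.restr h rfl a)
  tr_idp : ∀ {X : E} (x : X ⟶ Γ) (a : A.El x),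
    tr (MoorePath.idp (A := Fam.const (𝟙_ E) Γ) (x := toUnit X) x) a = a

namespace Tap

theorem tr_heq {Γ : E} {A : Fam Γ} (τ : Tap O A) {X : E} {x y x' y' : X ⟶ Γ} (p : Path O x y)
    (p' : Path O x' y') (a : A.El x) (a' : A.El x') (hx : x = x') (hy : y = y')
    (hfn : p.fn = p'.fn) (hlen : p.len = p'.len) (ha : HEq a a') : HEq (τ.tr p a) (τ.tr p' a') := by
  subst hx hy ha
  rw [MoorePath.ext hfn hlen]

theorem restr_tr {Γ : E} {A : Fam Γ} (τ : Tap O A) {X Y : E} (h : Y ⟶ X) {x y : X ⟶ Γ}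
    {x' y' : Y ⟶ Γ} (p : Path O x y) (p' : Path O x' y') (a : A.El x) (a' : A.El x')
    (ex : h ≫ x = x') (ey : h ≫ y = y') (hfn : h ▷ O.Pos ≫ p.fn = p'.fn)
    (hlen : h ≫ p.len = p'.len) (ha : A.restr h ex a = a') :
    A.restr h ey (τ.tr p a) = τ.tr p' a' := by
  subst ex ey ha
  rw [τ.tr_restr]
  exact congrArg (fun q => τ.tr q _) (MoorePath.ext hfn hlen)

theorem tr_const {Γ : E} {A : Fam Γ} (τ : Tap O A) {X : E} {x y : X ⟶ Γ} (p : Path O x y)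
    (a : A.El x) (hfn : p.fn = fst X O.Pos ≫ x) (hlen : p.len = O.zero X) :
    HEq (τ.tr p a) a := by
  have hxy : x = y := by
    have h1 := p.at_len
    have h2 := p.at_zero
    rw [hlen] at h1
    exact h2.symm.trans h1
  subst hxy
  refine (heq_of_eq (congrArg (fun q => τ.tr q a) (MoorePath.ext hfn hlen))).trans
    (heq_of_eq (τ.tr_idp x a))

end Tap

/-! ### Lifted paths and the induced transports -/

variable [HasSubobjectClassifier E] [MonoidalClosed E]

variable {Δ Γ X : E}

/-- Path lifting: for a fibration `A` over `Δ`, re-indexed along `u : Γ ⟶ Δ`, the path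
`⟨i ≤ |p|⟩ (p i, tr (upto i p) a)` from `(x, a)` to `(y, tr p a)` in the comprehension `Γ.A[u]`. -/
noncomputable def liftPath {A : Ty Δ} (τ : Tap O A.toFam) (u : Γ ⟶ Δ) {x y : X ⟶ Γ}
    (p : Path O x y) (a : A.El (x ≫ u)) :
    Path O (A.pair u x a) (A.pair u y (τ.tr (p.map u) a)) :=
  MoorePath.abs (A := Fam.const (𝟙_ E) (A.ext u)) (x := toUnit X)
    (A.pair u ((p.stage (fst X O.Pos)).pt (snd X O.Pos))
      (τ.tr (((p.stage (fst X O.Pos)).upto (snd X O.Pos)).map u)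
        (A.restr (fst X O.Pos) (Category.assoc _ _ _).symm a)))
    p.len
    (by
      refine (A.comp_pair _ _ _ _).trans (A.pair_congr u ((p.stage_pt _).trans p.at_zero) ?_)
      refine (A.restr_heq _ (by rw [← Category.assoc, p.stage_pt]) rfl rfl HEq.rfl).trans
        ((heq_of_eq (τ.restr_tr (lift (𝟙 X) (O.zero X))
        (((p.stage (fst X O.Pos)).upto (snd X O.Pos)).map u)
        ((p.upto (O.zero X)).map u) (A.restr (fst X O.Pos) (Category.assoc _ _ _).symm a) a (by simp)
        (by rw [← Category.assoc, p.stage_pt])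
        ((Category.assoc _ _ _).symm.trans (congrArg (· ≫ u) (p.upto_stage_fn _)))
        (p.upto_stage_len _)
        (by
          rw [A.restr_comp]
          exact (A.restr_congr _ _ (lift_fst _ _)).trans (A.restr_id a)))).trans ?_)
      exact τ.tr_const _ _ ((congrArg (· ≫ u) p.upto_zero_fn).trans (Category.assoc _ _ _))
        p.upto_zero_len)
    (by
      refine (A.comp_pair _ _ _ _).trans (A.pair_congr u ((p.stage_pt _).trans p.at_len) ?_)
      refine (A.restr_heq _ (by rw [← Category.assoc, p.stage_pt]) rfl rfl HEq.rfl).trans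
        ((heq_of_eq (τ.restr_tr (lift (𝟙 X) p.len)
        (((p.stage (fst X O.Pos)).upto (snd X O.Pos)).map u)
        ((p.upto p.len).map u) (A.restr (fst X O.Pos) (Category.assoc _ _ _).symm a) a (by simp)
        (by rw [← Category.assoc, p.stage_pt])
        ((Category.assoc _ _ _).symm.trans (congrArg (· ≫ u) (p.upto_stage_fn _)))
        (p.upto_stage_len _)
        (by
          rw [A.restr_comp]
          exact (A.restr_congr _ _ (lift_fst _ _)).trans (A.restr_id a)))).trans ?_)
      exact τ.tr_heq _ _ _ _ rfl (by rw [p.at_len]) (congrArg (· ≫ u) p.upto_len_fn)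
        p.upto_len_len HEq.rfl)

/-- For an element `a` of a fibration `A` and a path `p` from `x` to `y`, the path
`⟨i ≤ |p|⟩ tr (onward i p) (a (p i))` from `tr p (a x)` to `a y` in the fibre over `y`. -/
noncomputable def apd {A : Ty Δ} (τ : Tap O A.toFam) {u : Γ ⟶ Δ} (a : A.El u) {x y : X ⟶ Γ}
    (p : Path O x y) :
    MoorePath O A.toFam (τ.tr (p.map u) (A.restr x rfl a)) (A.restr y rfl a) :=
  MoorePath.abs (A := A.toFam)
    (A.restr (𝟙 _) ((Category.id_comp _).trans (Category.assoc _ _ _))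
      (τ.tr (((p.stage (fst X O.Pos)).onward (snd X O.Pos)).map u)
        (A.restr ((p.stage (fst X O.Pos)).pt (snd X O.Pos)) rfl a)))
    p.len
    (by
      rw [A.restr_comp, A.restr_congr _ (by simp) (Category.comp_id _)]
      refine τ.restr_tr (lift (𝟙 X) (O.zero X)) _ (p.map u) _ _ (by
        rw [← Category.assoc, p.stage_pt, p.at_zero]) _ ?_ ?_ ?_
      · exact (Category.assoc _ _ _).symm.trans (congrArg (· ≫ u)
          ((p.onward_stage_fn _).trans p.onward_zero_fn))
      · exact (p.onward_stage_len _).trans p.onward_zero_len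
      · rw [A.restr_comp]
        exact A.restr_congr _ _ ((p.stage_pt _).trans p.at_zero))
    (by
      rw [A.restr_comp, A.restr_congr _ (by simp) (Category.comp_id _)]
      refine Eq.trans (τ.restr_tr (lift (𝟙 X) p.len) _ ((p.onward p.len).map u) _
        (A.restr (p.pt p.len) rfl a) (by
          rw [← Category.assoc, p.stage_pt]) (by simp)
        ((Category.assoc _ _ _).symm.trans (congrArg (· ≫ u) (p.onward_stage_fn _)))
        (p.onward_stage_len _) (by
          rw [A.restr_comp]
          exact A.restr_congr _ _ (p.stage_pt _))) ?_
      refine eq_of_heq ((τ.tr_const _ _ ?_ p.onward_len_len).trans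
        (A.restr_heq _ _ p.at_len rfl HEq.rfl))
      refine ((congrArg (· ≫ u) p.onward_len_fn).trans (Category.assoc _ _ _)).trans ?_
      exact congrArg (fun z => fst X O.Pos ≫ z ≫ u) p.at_len.symm)

/-- The path from `tr p a` to `tr p b` obtained by applying transport along `p` to a path from `a`
to `b` in a fibre. -/
noncomputable def trMap {A : Fam Γ} (τ : Tap O A) {x y : X ⟶ Γ} (p : Path O x y) {a b : A.El x}
    (q : MoorePath O A a b) : MoorePath O A (τ.tr p a) (τ.tr p b) where
  fn := τ.tr (p.stage (fst X O.Pos)) q.fn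
  len := q.len
  start := by
    refine τ.restr_tr _ _ p _ _ (by simp) _ ?_ ?_ q.start
    · change _ ≫ fst X O.Pos ▷ O.Pos ≫ p.fn = _
      rw [← Category.assoc, ← comp_whiskerRight, lift_fst, id_whiskerRight, Category.id_comp]
    · exact (lift_fst_assoc _ _ _).trans (Category.id_comp _)
  finish {Y} h y' e j hj := by
    subst e
    rw [τ.tr_restr h]
    refine τ.restr_tr _ _ (p.stage h) _ _ (by simp) _ ?_ ?_ (q.finish h rfl j hj)
    · change _ ≫ fst X O.Pos ▷ O.Pos ≫ p.fn = h ▷ O.Pos ≫ p.fn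
      rw [← Category.assoc, ← comp_whiskerRight, lift_fst]
    · exact lift_fst_assoc _ _ _

/-- Transport in the family of Moore path objects of a fibration `A`, re-indexed along a pair of
elements `a`, `b` of `A`: a path `q` from `a x` to `b x` is sent to the composite of the reverse of
`apd a p`, the image of `q` under transport along `p`, and `apd b p`. -/
noncomputable def idTransport {A : Ty Δ} (τ : Tap O A.toFam) {u : Γ ⟶ Δ} (a b : A.El u)
    {x y : X ⟶ Γ} (p : Path O x y)
    (q : MoorePath O A.toFam (A.restr x rfl a) (A.restr x rfl b)) :
    MoorePath O A.toFam (A.restr y rfl a) (A.restr y rfl b) :=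
  ((apd τ a p).rev.comp (trMap τ (p.map u) q)).comp (apd τ b p)

/-- The value at `(x, a)` of an element `F` of `B` over the fibre of `A` at `x`. -/
def appAt {Θ : E} {A : Ty Δ} {B : Ty Θ} (u : Γ ⟶ Δ) (f : A.ext u ⟶ Θ) (x : X ⟶ Γ)
    (F : B.El (A.extMap x u ≫ f)) (a : A.El (x ≫ u)) : B.El (A.pair u x a ≫ f) :=
  B.restr (A.pair (x ≫ u) (𝟙 X) (A.restr (𝟙 X) rfl a)) (by
    rw [← Category.assoc, A.pair_extMap]
    congr 1
    refine A.pair_congr u (Category.id_comp x) ?_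
    rw [A.restr_comp]
    exact (A.restr_heq _ (Category.id_comp _) (Category.comp_id _) rfl HEq.rfl).trans
      (A.restr_id_heq (Category.id_comp _) a)) F

/-- Transport in the dependent product of a fibration `B` over a fibration `A`, where `A` is
re-indexed along `u : Γ ⟶ Δ` and `B` along `f : Γ.A[u] ⟶ Θ`: an element `F` of the dependent
product over `x` is sent along a path `p` from `x` to `y` to the element of the dependent product
over `y` whose value at `a` is `tr (rev (lift (rev p) a)) (F (tr (rev p) a))`. -/
noncomputable def piTransport {Θ : E} {A : Ty Δ} {B : Ty Θ} (τ : Tap O A.toFam)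
    (σ : Tap O B.toFam) (u : Γ ⟶ Δ) (f : A.ext u ⟶ Θ) {x y : X ⟶ Γ} (p : Path O x y)
    (F : B.El (A.extMap x u ≫ f)) (a : A.El (y ≫ u)) : B.El (A.pair u y a ≫ f) :=
  σ.tr (Path.map (MoorePath.rev (liftPath τ u (MoorePath.rev p) a)) f)
    (appAt u f x F (τ.tr (Path.map (MoorePath.rev p) u) a))

/-! ### The inductive-recursive universe -/

/-- Formation and introduction rules for the inductive-recursive pair `(U, T)`: the constructors
`bool : U`, `pi : ∏ u : U, (T u → U) → U` and `eq : ∏ u : U, T u → T u → U` of `U`, together with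
the recursion equations `T bool = 𝔹`, `T (pi u f) = ∏ x : T u, T (f x)` and
`T (eq u a b) = (a ∼ b)` of `T`. In a context `Γ`, a function `T u → U` is a morphism
`Γ.T[u] ⟶ U`, an element of `∏ x : T u, T (f x)` is an element of `T` at `f : Γ.T[u] ⟶ U`, and an
element of `a ∼ b` is a Moore path. Everything is natural in `Γ`. -/
structure Codes (O : RingOrder R) (𝔹 : E) {U : E} (T : Ty U) where
  /-- the code of the Booleans -/
  bool : 𝟙_ E ⟶ U
  /-- codes of dependent products -/
  pi : ∀ {Γ : E} (u : Γ ⟶ U), (T.ext u ⟶ U) → (Γ ⟶ U)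
  pi_comp : ∀ {Γ Δ : E} (h : Δ ⟶ Γ) (u : Γ ⟶ U) (f : T.ext u ⟶ U),
    h ≫ pi u f = pi (h ≫ u) (T.extMap h u ≫ f)
  /-- codes of identity types -/
  eq : ∀ {Γ : E} (u : Γ ⟶ U), T.El u → T.El u → (Γ ⟶ U)
  eq_comp : ∀ {Γ Δ : E} (h : Δ ⟶ Γ) (u : Γ ⟶ U) (a b : T.El u),
    h ≫ eq u a b = eq (h ≫ u) (T.restr h rfl a) (T.restr h rfl b)
  /-- `T bool = 𝔹` -/
  boolEquiv : ∀ {Γ : E}, T.El (toUnit Γ ≫ bool) ≃ (Γ ⟶ 𝔹)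
  boolEquiv_restr : ∀ {Γ Δ : E} (h : Δ ⟶ Γ) (t : T.El (toUnit Γ ≫ bool)),
    boolEquiv (T.restr h (by rw [← Category.assoc, comp_toUnit]) t) = h ≫ boolEquiv t
  /-- `T (pi u f) = ∏ x : T u, T (f x)` -/
  piEquiv : ∀ {Γ : E} (u : Γ ⟶ U) (f : T.ext u ⟶ U), T.El (pi u f) ≃ T.El f
  piEquiv_restr : ∀ {Γ Δ : E} (h : Δ ⟶ Γ) (u : Γ ⟶ U) (f : T.ext u ⟶ U) (t : T.El (pi u f)),
    piEquiv (h ≫ u) (T.extMap h u ≫ f) (T.restr h (pi_comp h u f) t) =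
      T.restr (T.extMap h u) rfl (piEquiv u f t)
  /-- `T (eq u a b) = (a ∼ b)` -/
  eqEquiv : ∀ {Γ : E} (u : Γ ⟶ U) (a b : T.El u), T.El (eq u a b) ≃ MoorePath O T.toFam a b
  eqEquiv_restr : ∀ {Γ Δ : E} (h : Δ ⟶ Γ) (u : Γ ⟶ U) (a b : T.El u) (t : T.El (eq u a b)),
    eqEquiv (h ≫ u) (T.restr h rfl a) (T.restr h rfl b) (T.restr h (eq_comp h u a b) t) =
      (eqEquiv u a b t).restr h rfl

namespace Codes

variable {𝔹 U : E} {T : Ty U}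

/-- The elimination rule with its computation rules: `U` is inductively generated by the
constructors, simultaneously with the recursive definition of `T`. For every family `P` over `U`
with methods `mb : P bool`,
`mp : ∏ (u : U) (f : T u → U), P u → (∏ x : T u, P (f x)) → P (pi u f)` and
`me : ∏ (u : U) (a b : T u), P u → P (eq u a b)`, there is a section of `P` that satisfies the
computation rule for each constructor. -/
def IsInductiveRecursive (c : Codes O 𝔹 T) : Prop :=
  ∀ (P : Ty.{v, u} U) (mb : P.El c.bool)
    (mp : ∀ {Γ : E} (u : Γ ⟶ U) (f : T.ext u ⟶ U), P.El u → P.El f → P.El (c.pi u f))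
    (_ : ∀ {Γ Δ : E} (h : Δ ⟶ Γ) (u : Γ ⟶ U) (f : T.ext u ⟶ U) (r : P.El u) (s : P.El f),
      P.restr h (c.pi_comp h u f) (mp u f r s) =
        mp (h ≫ u) (T.extMap h u ≫ f) (P.restr h rfl r) (P.restr (T.extMap h u) rfl s))
    (me : ∀ {Γ : E} (u : Γ ⟶ U) (a b : T.El u), P.El u → P.El (c.eq u a b))
    (_ : ∀ {Γ Δ : E} (h : Δ ⟶ Γ) (u : Γ ⟶ U) (a b : T.El u) (r : P.El u),
      P.restr h (c.eq_comp h u a b) (me u a b r) =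
        me (h ≫ u) (T.restr h rfl a) (T.restr h rfl b) (P.restr h rfl r)),
    ∃ s : P.El (𝟙 U),
      P.restr c.bool (Category.comp_id _) s = mb ∧
      (∀ {Γ : E} (u : Γ ⟶ U) (f : T.ext u ⟶ U),
        P.restr (c.pi u f) (Category.comp_id _) s =
          mp u f (P.restr u (Category.comp_id _) s) (P.restr f (Category.comp_id _) s)) ∧
      (∀ {Γ : E} (u : Γ ⟶ U) (a b : T.El u),
        P.restr (c.eq u a b) (Category.comp_id _) s =
          me u a b (P.restr u (Category.comp_id _) s))

/-- Decoding of an element of `T (pi u f)` at `x` to an element of the dependent product. -/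
def piAt (c : Codes O 𝔹 T) (u : Γ ⟶ U) (f : T.ext u ⟶ U) (x : X ⟶ Γ)
    (t : T.El (x ≫ c.pi u f)) : T.El (T.extMap x u ≫ f) :=
  c.piEquiv (x ≫ u) (T.extMap x u ≫ f)
    (T.restr (𝟙 X) ((Category.id_comp _).trans (c.pi_comp x u f)) t)

/-- Decoding of an element of `T (eq u a b)` at `x` to a Moore path. -/
def eqAt (c : Codes O 𝔹 T) (u : Γ ⟶ U) (a b : T.El u) (x : X ⟶ Γ)
    (t : T.El (x ≫ c.eq u a b)) : MoorePath O T.toFam (T.restr x rfl a) (T.restr x rfl b) :=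
  c.eqEquiv (x ≫ u) (T.restr x rfl a) (T.restr x rfl b)
    (T.restr (𝟙 X) ((Category.id_comp _).trans (c.eq_comp x u a b)) t)

/-- A tap structure `τ` on `T` makes it a Tarski-style universe among the tap fibrations that
contains the Booleans and is closed under dependent function types and Moore-path identity types:
re-indexed along each of the coding functions, `τ` is the tap structure of the fibration of
Booleans (a constant family, where transport does nothing), of dependent function types and of
identity types respectively. -/
structure IsTarskiUniverse (c : Codes O 𝔹 T) (τ : Tap O T.toFam) : Prop where
  bool : ∀ {X : E} (p : Path O (toUnit X) (toUnit X)) (t : T.El (toUnit X ≫ c.bool)),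
    c.boolEquiv (τ.tr (p.map c.bool) t) = c.boolEquiv t
  pi : ∀ {Γ X : E} (u : Γ ⟶ U) (f : T.ext u ⟶ U) {x y : X ⟶ Γ} (p : Path O x y)
    (t : T.El (x ≫ c.pi u f)) (a : T.El (y ≫ u)),
    appAt u f y (c.piAt u f y (τ.tr (p.map (c.pi u f)) t)) a =
      piTransport τ τ u f p (c.piAt u f x t) a
  eq : ∀ {Γ X : E} (u : Γ ⟶ U) (a b : T.El u) {x y : X ⟶ Γ} (p : Path O x y)
    (t : T.El (x ≫ c.eq u a b)),
    c.eqAt u a b y (τ.tr (p.map (c.eq u a b)) t) = idTransport τ a b p (c.eqAt u a b x t)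

end Codes

end Paths

end MooreTopos

open MooreTopos

/-! A path in `U` cannot change the kind of its codes. Each of the three kinds (`bool`, `pi`, `eq`)
has a Boolean-valued indicator on `U`, obtained by recursion. Since `R` is connected and `R_+` is a
retract of `R`, every indicator is constant along a function `R_+ → U`. A function that is `bool` at
one argument is therefore constantly `bool`; one that meets a `pi` code is a `pi` code everywhere
and splits into a function of domains and a dependent function of codomains; likewise for `eq`
(`exists_decode`).

This suggests transport by recursion on the code `x` at which a path starts, but the product case
needs transport along `rev p`, which starts at the other end. The recursion is therefore
strengthened. Over `x` stands the structure `LTap` of transports along all functions `p : R_+ → U`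
with `p 0 = x`, between any two arguments `i` and `j` in either order, which are the identity for `i
= j`. Now the recursion is structural. If `p 0 = pi u f`, the domains start at `u`, so the
hypothesis for `u` carries an argument `a` over `p j` to every other `m`. The codomains along this
curve form a function `R_+ → U` that starts at a value of `f`, so the hypothesis for `f` transports
values from `i` to `j` (`piTap`). If `p 0 = eq u a b`, an element over `p i` is a path in a fibre.
It is transported pointwise and conjugated with the paths traced by the moving endpoints, which are
again given by the hypothesis for `u` (`eqTap`). The identity law for `i = j` has to take part in
the recursion, because the endpoints and codomains match only through it.

The elimination rule accepts only families of `E` over `U`, so `LTap` must be one. It is a dependent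
function set between objects of `E`, and such sets are represented inside a power object
(`exists_ty_funFam`); predicates used in inductions are handled by `Rep`.

The recursion computes transports along `p` itself from `i` to `j`, while the required tap
structures speak of `rev p`, `lift`, `upto` and `onward`, which are re-parametrized segments of `p`.
The bridge is coherence: transport depends only on the restriction of `p` to the interval between
`i` and `j` (`IsTransport.coherent`). It compares functions with different starting points, hence is
no statement about a single `LTap`, and is proved after the recursion by induction on the starting
code. The tap structure is transport from `0` to `|p|`, and its three equations follow from the
computation rules, coherence and truncated arithmetic on `R_+` (`tap_bool`, `tap_pi`, `tap_eq`). -/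

namespace MooreTopos

set_option linter.unusedSectionVars false

/-! ### Internal logic: representable predicates and power objects. -/

section InternalLogic

variable {E : Type u} [Category.{v} E] [HasFiniteLimits E] [HasSubobjectClassifier E]

/-- The subobject of true truth values. -/
noncomputable def truthSub : Subobject (HasSubobjectClassifier.Ω E) :=
  HasSubobjectClassifier.exists_classifier.some.truth_as_subobject

theorem pullback_chi {V : E} (S : Subobject V) :
    (Subobject.pullback (chi S)).obj truthSub = S := by
  simp [chi, truthSub]

theorem truthSub_factors_chi {V Y : E} (S : Subobject V) (z : Y ⟶ V) :
    truthSub.Factors (z ≫ chi S) ↔ S.Factors z := by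
  conv_rhs => rw [← pullback_chi S]
  rw [pullback_factors_iff]

theorem chi_pullback_truthSub {V : E} (f : V ⟶ HasSubobjectClassifier.Ω E) :
    chi ((Subobject.pullback f).obj truthSub) = f := by
  simp [chi, truthSub]

/-- Propositional extensionality: a map to `Ω` is the characteristic map of the pullback of truth
along it, and subobjects are determined by their generalized elements. -/
theorem omega_hom_ext {V : E} {f g : V ⟶ HasSubobjectClassifier.Ω E}
    (h : ∀ (Y : E) (y : Y ⟶ V), truthSub.Factors (y ≫ f) ↔ truthSub.Factors (y ≫ g)) :
    f = g := by
  rw [← chi_pullback_truthSub f, ← chi_pullback_truthSub g]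
  congr 1
  refine subobject_ext fun Y y => ?_
  rw [pullback_factors_iff, pullback_factors_iff]
  exact h Y y

/-- A predicate on the generalized elements of `Z` is representable if it is membership in a
subobject of `Z`. -/
def Rep {Z : E} (φ : ∀ {X : E}, (X ⟶ Z) → Prop) : Prop :=
  ∃ S : Subobject Z, ∀ {X : E} (z : X ⟶ Z), S.Factors z ↔ φ z

namespace Rep

theorem of_iff {Z : E} {φ ψ : ∀ {X : E}, (X ⟶ Z) → Prop} (hφ : Rep φ)
    (h : ∀ {X : E} (z : X ⟶ Z), φ z ↔ ψ z) : Rep ψ := by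
  obtain ⟨S, hS⟩ := hφ
  exact ⟨S, fun z => (hS z).trans (h z)⟩

theorem factors {Z : E} (S : Subobject Z) : Rep fun {_} z => S.Factors z :=
  ⟨S, fun _ => Iff.rfl⟩

theorem stable {Z : E} {φ : ∀ {X : E}, (X ⟶ Z) → Prop} (hφ : Rep φ) {X Y : E} (h : Y ⟶ X)
    {z : X ⟶ Z} (hz : φ z) : φ (h ≫ z) := by
  obtain ⟨S, hS⟩ := hφ
  exact (hS _).1 (Subobject.factors_of_factors_right h ((hS z).2 hz))

theorem eq {Z A : E} (f g : Z ⟶ A) : Rep fun {_} z => z ≫ f = z ≫ g :=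
  ⟨equalizerSubobject f g, fun z => equalizerSubobject_factors_iff f g z⟩

theorem and {Z : E} {φ ψ : ∀ {X : E}, (X ⟶ Z) → Prop} (hφ : Rep φ) (hψ : Rep ψ) :
    Rep fun {_} z => φ z ∧ ψ z := by
  obtain ⟨S, hS⟩ := hφ
  obtain ⟨S', hS'⟩ := hψ
  exact ⟨S ⊓ S', fun z => by rw [Subobject.inf_factors, hS, hS']⟩

theorem comp {Z W : E} (f : Z ⟶ W) {φ : ∀ {X : E}, (X ⟶ W) → Prop} (hφ : Rep φ) :
    Rep fun {_} z => φ (z ≫ f) := by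
  obtain ⟨S, hS⟩ := hφ
  exact ⟨(Subobject.pullback f).obj S, fun z => by rw [pullback_factors_iff, hS]⟩

variable [CartesianMonoidalCategory E] [MonoidalClosed E]

/-- In the power object of `W`, compare the names of the two families of subsets `z ↦ w⁻¹(z)` and `z
↦ w⁻¹(z) ∩ S`. They agree at `z` exactly when the fibre over `z` lies in `S`, so the equalizer of
the two names represents the quantification. -/
theorem forall_over {Z W : E} (w : W ⟶ Z) {φ : ∀ {X : E}, (X ⟶ W) → Prop} (hφ : Rep φ) :
    Rep fun {X} (z : X ⟶ Z) => ∀ (Y : E) (h : Y ⟶ X) (a : Y ⟶ W), a ≫ w = h ≫ z → φ a := by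
  obtain ⟨S, hS⟩ := hφ
  have : Mono (lift (𝟙 W) w) := ⟨fun a b h => by simpa using congrArg (· ≫ fst _ _) h⟩
  let G : Subobject (W ⊗ Z) := Subobject.mk (lift (𝟙 W) w)
  let GS : Subobject (W ⊗ Z) := Subobject.mk (S.arrow ≫ lift (𝟙 W) w)
  have hG : ∀ {Y : E} (a : Y ⟶ W) (z : Y ⟶ Z), G.Factors (lift a z) ↔ a ≫ w = z := by
    intro Y a z
    rw [mk_factors]
    constructor
    · rintro ⟨g, hg⟩
      have h1 := congrArg (· ≫ fst _ _) hg
      have h2 := congrArg (· ≫ snd _ _) hg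
      simp at h1 h2
      rw [← h1, ← h2]
    · rintro rfl
      exact ⟨a, by simp⟩
  have hGS : ∀ {Y : E} (a : Y ⟶ W) (z : Y ⟶ Z),
      GS.Factors (lift a z) ↔ a ≫ w = z ∧ S.Factors a := by
    intro Y a z
    rw [mk_factors]
    constructor
    · rintro ⟨g, hg⟩
      have h1 := congrArg (· ≫ fst _ _) hg
      have h2 := congrArg (· ≫ snd _ _) hg
      simp at h1 h2
      refine ⟨by rw [← h1, ← h2, Category.assoc], ?_⟩
      rw [← h1]
      exact Subobject.factors_comp_arrow _
    · rintro ⟨rfl, hS⟩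
      exact ⟨S.factorThru a hS, by simp⟩
  refine ⟨equalizerSubobject (MonoidalClosed.curry (chi G))
    (MonoidalClosed.curry (chi GS)), fun {V} z => ?_⟩
  rw [equalizerSubobject_factors_iff, ← MonoidalClosed.curry_natural_left,
    ← MonoidalClosed.curry_natural_left, MonoidalClosed.curry_injective.eq_iff, comp_chi_eq_iff]
  constructor
  · intro H Y k a e
    have := H Y (lift a k)
    rw [lift_whiskerLeft, hG, hGS] at this
    exact (hS _).1 (this.1 e).2
  · intro H Y y
    have e : y ≫ W ◁ z = lift (y ≫ fst _ _) ((y ≫ snd _ _) ≫ z) := by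
      ext <;> simp
    rw [e, hG, hGS]
    exact ⟨fun h => ⟨h, (hS _).2 (H Y _ _ h)⟩, fun h => h.1⟩

/-- Quantification along the projection that forgets `D`. -/
theorem all {Z : E} (D : E) {φ : ∀ {X : E}, (X ⟶ Z ⊗ D) → Prop} (hφ : Rep φ) :
    Rep fun {X} (z : X ⟶ Z) => ∀ (Y : E) (h : Y ⟶ X) (d : Y ⟶ D), φ (lift (h ≫ z) d) := by
  refine (forall_over (fst Z D) hφ).of_iff fun z => ⟨fun H Y h d => ?_, fun H Y h a e => ?_⟩
  · exact H Y h _ (lift_fst _ _)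
  · have : a = lift (h ≫ z) (a ≫ snd _ _) := by ext <;> simp [e]
    rw [this]
    exact H Y h _

/-- An implication is a quantification of its conclusion along the inclusion of the subobject where
its premise holds. -/
theorem imp {Z : E} {φ ψ : ∀ {X : E}, (X ⟶ Z) → Prop} (hφ : Rep φ) (hψ : Rep ψ) :
    Rep fun {X} (z : X ⟶ Z) => ∀ (Y : E) (h : Y ⟶ X), φ (h ≫ z) → ψ (h ≫ z) := by
  obtain ⟨S, hS⟩ := hφ
  refine (forall_over S.arrow (hψ.comp S.arrow)).of_iff fun z => ⟨fun H Y h hφ => ?_,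
    fun H Y h a e => ?_⟩
  · have := H Y h (S.factorThru _ ((hS _).2 hφ)) (by simp)
    rwa [Subobject.factorThru_arrow] at this
  · rw [e]
    refine H Y h ((hS _).1 ?_)
    rw [← e]
    exact Subobject.factors_comp_arrow _

end Rep

variable [CartesianMonoidalCategory E] [MonoidalClosed E]

/-- Membership of a generalized element of `A` in a generalized element of its power object. -/
def Mem {A Y : E} (a : Y ⟶ A) (k : Y ⟶ (ihom A).obj (HasSubobjectClassifier.Ω E)) : Prop :=
  truthSub.Factors (lift a k ≫ (ihom.ev A).app _)

theorem lift_comp_uncurry {A X Z Y : E} (a : Y ⟶ A) (h : Y ⟶ X) (k : X ⟶ (ihom A).obj Z) :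
    lift a (h ≫ k) ≫ (ihom.ev A).app Z = lift a h ≫ MonoidalClosed.uncurry k := by
  rw [MonoidalClosed.uncurry_eq, ← Category.assoc, lift_whiskerLeft]

theorem mem_comp_curry {A X Y : E} (a : Y ⟶ A) (h : Y ⟶ X) (S : Subobject (A ⊗ X)) :
    Mem a (h ≫ MonoidalClosed.curry (chi S)) ↔ S.Factors (lift a h) := by
  unfold Mem
  rw [lift_comp_uncurry, MonoidalClosed.uncurry_curry, truthSub_factors_chi]

theorem mem_ext {A X : E} {k l : X ⟶ (ihom A).obj (HasSubobjectClassifier.Ω E)}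
    (H : ∀ (Y : E) (h : Y ⟶ X) (a : Y ⟶ A), Mem a (h ≫ k) ↔ Mem a (h ≫ l)) : k = l := by
  apply MonoidalClosed.uncurry_injective
  refine omega_hom_ext fun Y y => ?_
  have := H Y (y ≫ snd _ _) (y ≫ fst _ _)
  unfold Mem at this
  rw [lift_comp_uncurry, lift_comp_uncurry] at this
  have e : lift (y ≫ fst _ _) (y ≫ snd _ _) = y := by ext <;> simp
  rwa [e] at this

theorem rep_mem {A Z : E} (a : Z ⟶ A) (k : Z ⟶ (ihom A).obj (HasSubobjectClassifier.Ω E)) :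
    Rep fun {_} z => Mem (z ≫ a) (z ≫ k) := by
  refine ((Rep.factors truthSub).comp (lift a k ≫ (ihom.ev A).app _)).of_iff fun z => ?_
  unfold Mem
  rw [← comp_lift_assoc]

/-- Unique existence says that the subset `{a | φ (z, a)}` is a singleton. The representing
subobject is the pullback of the singleton embedding `s` of `A` into its power object along the name
`k` of this subset. -/
theorem Rep.existsUnique {Z A : E} {φ : ∀ {X : E}, (X ⟶ Z ⊗ A) → Prop} (hφ : Rep φ) :
    Rep fun {X} (z : X ⟶ Z) => ∃ a : X ⟶ A, ∀ (Y : E) (h : Y ⟶ X) (b : Y ⟶ A),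
      φ (lift (h ≫ z) b) ↔ b = h ≫ a := by
  obtain ⟨S, hS⟩ := hφ
  let k : Z ⟶ (ihom A).obj (HasSubobjectClassifier.Ω E) :=
    MonoidalClosed.curry (chi ((Subobject.pullback (lift (snd A Z) (fst A Z))).obj S))
  have hk : ∀ {Y : E} (b : Y ⟶ A) (z : Y ⟶ Z), Mem b (z ≫ k) ↔ φ (lift z b) := by
    intro Y b z
    rw [mem_comp_curry, pullback_factors_iff, hS, comp_lift, lift_snd, lift_fst]
  let s : A ⟶ (ihom A).obj (HasSubobjectClassifier.Ω E) :=
    MonoidalClosed.curry (chi (equalizerSubobject (fst A A) (snd A A)))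
  have hs : ∀ {Y : E} (b a : Y ⟶ A), Mem b (a ≫ s) ↔ b = a := by
    intro Y b a
    rw [mem_comp_curry, equalizerSubobject_factors_iff, lift_fst, lift_snd]
  have : Mono s := ⟨fun a b h => by
    have := hs a b
    rw [← h, hs] at this
    exact this.1 rfl⟩
  refine ⟨(Subobject.pullback k).obj (Subobject.mk s), fun {X} z => ?_⟩
  rw [pullback_factors_iff, mk_factors]
  refine exists_congr fun a => ⟨fun e Y h b => ?_, fun H => mem_ext fun Y h b => ?_⟩
  · rw [← hk, Category.assoc, ← e, ← Category.assoc, hs]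
  · rw [← Category.assoc, hs, ← Category.assoc, hk, H]

/-! ### Families of types given by morphisms, and internal dependent function sets. -/

/-- The family of types over `U` with total object `W`. -/
noncomputable def Ty.ofMap {U W : E} (w : W ⟶ U) : Ty.{v, u} U where
  El {X} x := {k : X ⟶ W // k ≫ w = x}
  restr h _ _ e a := ⟨h ≫ a.1, by rw [Category.assoc, a.2, e]⟩
  restr_id a := Subtype.ext (Category.id_comp _)
  restr_comp h g _ _ _ _ _ a := Subtype.ext (Category.assoc _ _ _).symm
  ext x := Limits.pullback x w
  proj x := pullback.fst x w
  var x := ⟨pullback.snd x w, pullback.condition.symm⟩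
  pair x h a := pullback.lift h a.1 a.2.symm
  pair_proj x h a := pullback.lift_fst _ _ _
  pair_var x h a := Subtype.ext (pullback.lift_snd _ _ _)
  pair_eta x k := by
    apply pullback.hom_ext
    · exact pullback.lift_fst _ _ _
    · exact pullback.lift_snd _ _ _

/-- Natural families of functions, over `x : X ⟶ U`, from the elements `d` of `D` with `dom (x, d)`
to the elements `z` of `Z` with `cod (d, z)`: an internal dependent function set. -/
@[ext]
structure FunFam {U D Z : E} (dom : Subobject (U ⊗ D)) (cod : Subobject (D ⊗ Z)) {X : E}
    (x : X ⟶ U) where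
  app : ∀ {Y : E} (h : Y ⟶ X) (d : Y ⟶ D), dom.Factors (lift (h ≫ x) d) → (Y ⟶ Z)
  comp_app : ∀ {Y Y' : E} (k : Y' ⟶ Y) (h : Y ⟶ X) (d : Y ⟶ D)
    (hd : dom.Factors (lift (h ≫ x) d)) (hd' : dom.Factors (lift ((k ≫ h) ≫ x) (k ≫ d))),
    k ≫ app h d hd = app (k ≫ h) (k ≫ d) hd'
  cod_app : ∀ {Y : E} (h : Y ⟶ X) (d : Y ⟶ D) (hd : dom.Factors (lift (h ≫ x) d)),
    cod.Factors (lift d (app h d hd))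

namespace FunFam

variable {U D Z : E} {dom : Subobject (U ⊗ D)} {cod : Subobject (D ⊗ Z)}

theorem app_congr {X : E} {x : X ⟶ U} (F : FunFam dom cod x) {Y : E} {h h' : Y ⟶ X}
    {d d' : Y ⟶ D} (hd : dom.Factors (lift (h ≫ x) d)) (eh : h = h') (ed : d = d') :
    F.app h d hd = F.app h' d' (eh ▸ ed ▸ hd) := by
  subst eh ed
  rfl

theorem dom_comp {X Y Y' : E} (k : Y' ⟶ Y) (h : Y ⟶ X) (x : X ⟶ U) (d : Y ⟶ D)
    (hd : dom.Factors (lift (h ≫ x) d)) : dom.Factors (lift ((k ≫ h) ≫ x) (k ≫ d)) := by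
  rw [Category.assoc, ← comp_lift]
  exact Subobject.factors_of_factors_right k hd

/-- Change of stage. -/
def restr {X : E} {x : X ⟶ U} (F : FunFam dom cod x) {X' : E} (h : X' ⟶ X) {x' : X' ⟶ U}
    (e : h ≫ x = x') : FunFam dom cod x' where
  app g d hd := F.app (g ≫ h) d (by rwa [Category.assoc, e])
  comp_app k g d hd hd' := by
    rw [F.comp_app k (g ≫ h) d _ (by rwa [Category.assoc, Category.assoc, e, ← Category.assoc])]
    exact F.app_congr _ (Category.assoc _ _ _).symm rfl
  cod_app g d hd := F.cod_app _ _ _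

/-- The graph of a family of functions is representable. -/
theorem rep_graph {X : E} {x : X ⟶ U} (F : FunFam dom cod x) :
    Rep fun {Y} (y : Y ⟶ X ⊗ (D ⊗ Z)) => ∃ hd : dom.Factors
      (lift ((y ≫ fst _ _) ≫ x) (y ≫ snd _ _ ≫ fst _ _)),
      F.app (y ≫ fst _ _) (y ≫ snd _ _ ≫ fst _ _) hd = y ≫ snd _ _ ≫ snd _ _ := by
  let W : Subobject (X ⊗ D) := (Subobject.pullback (x ▷ D)).obj dom
  have hW : ∀ {Y : E} (y : Y ⟶ X ⊗ D), W.Factors y ↔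
      dom.Factors (lift ((y ≫ fst _ _) ≫ x) (y ≫ snd _ _)) := by
    intro Y y
    rw [pullback_factors_iff]
    have : y ≫ x ▷ D = lift ((y ≫ fst _ _) ≫ x) (y ≫ snd _ _) := by ext <;> simp
    rw [this]
  -- By naturality the family is determined by its value at the generic point of its domain `W`, so
  -- the graph is the image of `W` under the map that adjoins this value.
  let m : (W : E) ⟶ X ⊗ (D ⊗ Z) := lift (W.arrow ≫ fst _ _) (lift (W.arrow ≫ snd _ _)
    (F.app (W.arrow ≫ fst _ _) (W.arrow ≫ snd _ _) ((hW _).1 (Subobject.factors_self W))))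
  have : Mono m := ⟨fun a b h => by
    rw [← cancel_mono W.arrow]
    have h1 := congrArg (· ≫ fst _ _) h
    have h2 := congrArg (fun z => (z ≫ snd _ _) ≫ fst _ _) h
    simp only [m, comp_lift, lift_fst, lift_snd] at h1 h2
    apply CartesianMonoidalCategory.hom_ext
    · simpa using h1
    · simpa using h2⟩
  refine ⟨Subobject.mk m, fun {Y} y => ?_⟩
  rw [mk_factors]
  constructor
  · rintro ⟨k, rfl⟩
    have hk := (hW (k ≫ W.arrow)).1 (Subobject.factors_comp_arrow k)
    refine ⟨by simpa [m] using hk, ?_⟩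
    rw [F.app_congr (h' := k ≫ W.arrow ≫ fst _ _) (d' := k ≫ W.arrow ≫ snd _ _) _
      (by simp [m]) (by simp [m])]
    rw [← F.comp_app k _ _ ((hW _).1 (Subobject.factors_self W))]
    simp [m]
  · rintro ⟨hd, e⟩
    have hy : W.Factors (y ≫ lift (fst _ _) (snd _ _ ≫ fst _ _)) := by
      rw [hW]
      simpa using hd
    have ea := W.factorThru_arrow _ hy
    refine ⟨W.factorThru _ hy, ?_⟩
    have e1 : W.factorThru _ hy ≫ m ≫ fst _ _ = y ≫ fst _ _ := by
      simp [m]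
    have e2 : W.factorThru _ hy ≫ m ≫ snd _ _ ≫ fst _ _ = y ≫ snd _ _ ≫ fst _ _ := by
      simp [m]
    have e3 : W.factorThru _ hy ≫ m ≫ snd _ _ ≫ snd _ _ = y ≫ snd _ _ ≫ snd _ _ := by
      rw [← e]
      simp only [m, lift_snd_assoc, lift_snd]
      rw [F.comp_app _ _ _ _ (dom_comp _ _ _ _ ((hW _).1 (Subobject.factors_self W)))]
      refine F.app_congr _ ?_ ?_
      · rw [← Category.assoc, ea]; simp
      · rw [← Category.assoc, ea]; simp
    ext
    · simpa using e1
    · simpa using e2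
    · simpa using e3

end FunFam

/-- Dependent function sets are families of types. -/
theorem exists_ty_funFam {U D Z : E} (dom : Subobject (U ⊗ D)) (cod : Subobject (D ⊗ Z)) :
    ∃ (P : Ty.{v, u} U) (φ : ∀ {X : E} {x : X ⟶ U}, P.El x ≃ FunFam dom cod x),
      ∀ {X Y : E} (h : Y ⟶ X) {x : X ⟶ U} {y : Y ⟶ U} (e : h ≫ x = y) (a : P.El x),
        φ (P.restr h e a) = (φ a).restr h e := by
  let Ω := HasSubobjectClassifier.Ω E
  let N := U ⊗ (ihom (D ⊗ Z)).obj Ω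
  -- `k` names a relation between `D` and `Z` that is the graph of a function from the `d` allowed
  -- by `dom` to values allowed by `cod`. The doubled quantification over stages is the shape
  -- produced by `Rep.all` applied to `Rep.imp`; `good` below removes it by taking identities.
  let Good : ∀ {X : E}, (X ⟶ U) → (X ⟶ (ihom (D ⊗ Z)).obj Ω) → Prop := fun {X} x k =>
    (∀ (Y : E) (h : Y ⟶ X) (w : Y ⟶ D ⊗ Z), ∀ (Y' : E) (h' : Y' ⟶ Y),
      Mem (h' ≫ w) (h' ≫ h ≫ k) →
      dom.Factors (lift (h' ≫ h ≫ x) (h' ≫ w ≫ fst _ _)) ∧ cod.Factors (h' ≫ w)) ∧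
    (∀ (Y : E) (h : Y ⟶ X) (d : Y ⟶ D), ∀ (Y' : E) (h' : Y' ⟶ Y),
      dom.Factors (lift (h' ≫ h ≫ x) (h' ≫ d)) →
      ∃ z : Y' ⟶ Z, ∀ (Y'' : E) (g : Y'' ⟶ Y') (b : Y'' ⟶ Z),
        Mem (lift (g ≫ h' ≫ d) b) (g ≫ h' ≫ h ≫ k) ↔ b = g ≫ z)
  have hGood : Rep fun {X} (n : X ⟶ N) => Good (n ≫ fst _ _) (n ≫ snd _ _) := by
    have h1 := Rep.all (Z := N) (D ⊗ Z) (Rep.imp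
      (rep_mem (snd N (D ⊗ Z)) (fst N (D ⊗ Z) ≫ snd _ _))
      (Rep.and ((Rep.factors dom).comp (lift (fst N (D ⊗ Z) ≫ fst _ _)
        (snd N (D ⊗ Z) ≫ fst _ _))) ((Rep.factors cod).comp (snd N (D ⊗ Z)))))
    have h2 := Rep.all (Z := N) D (Rep.imp
      ((Rep.factors dom).comp (lift (fst N D ≫ fst _ _) (snd N D)))
      (Rep.existsUnique (A := Z) (rep_mem (A := D ⊗ Z) (lift (fst (N ⊗ D) Z ≫ snd N D)
        (snd (N ⊗ D) Z)) (fst (N ⊗ D) Z ≫ fst N D ≫ snd _ _))))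
    refine (h1.and h2).of_iff fun n => ?_
    simp [Good, comp_lift]
  obtain ⟨S, hS⟩ := hGood
  have good : ∀ {X : E} {x : X ⟶ U} {k : X ⟶ (ihom (D ⊗ Z)).obj Ω}, Good x k →
      (∀ (Y : E) (h : Y ⟶ X) (d : Y ⟶ D) (z : Y ⟶ Z), Mem (lift d z) (h ≫ k) →
        dom.Factors (lift (h ≫ x) d) ∧ cod.Factors (lift d z)) ∧
      (∀ (Y : E) (h : Y ⟶ X) (d : Y ⟶ D), dom.Factors (lift (h ≫ x) d) →
        ∃ z : Y ⟶ Z, ∀ (Y'' : E) (g : Y'' ⟶ Y) (b : Y'' ⟶ Z),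
        Mem (lift (g ≫ d) b) ((g ≫ h) ≫ k) ↔ b = g ≫ z) := by
    rintro X x k ⟨h1, h2⟩
    refine ⟨fun Y h d z H => ?_, fun Y h d H => ?_⟩
    · simpa using h1 Y h (lift d z) Y (𝟙 Y) (by simpa using H)
    · simpa using h2 Y h d Y (𝟙 Y) (by simpa using H)
  let w : (S : E) ⟶ U := S.arrow ≫ fst _ _
  have hk : ∀ {X : E} {x : X ⟶ U} (a : (Ty.ofMap w).El x), Good x (a.1 ≫ S.arrow ≫ snd _ _) := by
    rintro X x ⟨k, rfl⟩
    have := (hS (k ≫ S.arrow)).1 (Subobject.factors_comp_arrow k)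
    simpa [w] using this
  let toF : ∀ {X : E} {x : X ⟶ U}, (Ty.ofMap w).El x → FunFam dom cod x := fun {X} {x} a =>
    { app := fun h d hd => ((good (hk a)).2 _ h d hd).choose
      comp_app := fun k h d hd hd' => by
        refine (((good (hk a)).2 _ _ _ hd').choose_spec _ (𝟙 _) _).1 ?_ |>.trans
          (Category.id_comp _)
        simp only [Category.id_comp]
        exact (((good (hk a)).2 _ _ _ hd).choose_spec _ k _).2 rfl
      cod_app := fun h d hd => by
        refine ((good (hk a)).1 _ h d _ ?_).2
        have := (((good (hk a)).2 _ _ _ hd).choose_spec _ (𝟙 _) _).2 (Category.id_comp _).symm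
        simpa using this }
  -- The values of `toF` are chosen. This characterization by membership in the named relation is
  -- what injectivity, surjectivity and naturality rest on.
  have hto : ∀ {X : E} {x : X ⟶ U} (a : (Ty.ofMap w).El x) {Y : E} (h : Y ⟶ X) (d : Y ⟶ D)
      (z : Y ⟶ Z), Mem (lift d z) (h ≫ a.1 ≫ S.arrow ≫ snd _ _) ↔
        ∃ hd : dom.Factors (lift (h ≫ x) d), (toF a).app h d hd = z := by
    intro X x a Y h d z
    constructor
    · intro H
      have hd := ((good (hk a)).1 _ _ _ _ H).1
      refine ⟨hd, ?_⟩
      have := (((good (hk a)).2 _ _ _ hd).choose_spec _ (𝟙 _) z).1 (by simpa using H)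
      rw [this, Category.id_comp]
    · rintro ⟨hd, rfl⟩
      have := (((good (hk a)).2 _ _ _ hd).choose_spec _ (𝟙 _) _).2 (Category.id_comp _).symm
      rw [Category.id_comp, Category.id_comp] at this
      exact this
  have inj : ∀ {X : E} {x : X ⟶ U}, Function.Injective (toF (x := x)) := by
    intro X x a b e
    refine Subtype.ext ((cancel_mono S.arrow).1 ?_)
    have e1 : a.1 ≫ S.arrow ≫ fst _ _ = b.1 ≫ S.arrow ≫ fst _ _ := a.2.trans b.2.symm
    have e2 : a.1 ≫ S.arrow ≫ snd _ _ = b.1 ≫ S.arrow ≫ snd _ _ := by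
      refine mem_ext fun Y h y => ?_
      have ey : y = lift (y ≫ fst _ _) (y ≫ snd _ _) := by ext <;> simp
      rw [ey, hto, hto, e]
    apply CartesianMonoidalCategory.hom_ext
    · simpa using e1
    · simpa using e2
  have surj : ∀ {X : E} {x : X ⟶ U}, Function.Surjective (toF (x := x)) := by
    intro X x F
    -- Since its graph is representable, `F` has a name `k` in the power object of `D ⊗ Z`, which
    -- lands in the subobject `S` of functional relations.
    obtain ⟨G, hG⟩ := F.rep_graph
    let k : X ⟶ (ihom (D ⊗ Z)).obj Ω := MonoidalClosed.curry (chi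
      ((Subobject.pullback (lift (snd (D ⊗ Z) X) (fst (D ⊗ Z) X))).obj G))
    have hk' : ∀ {Y : E} (h : Y ⟶ X) (d : Y ⟶ D) (z : Y ⟶ Z), Mem (lift d z) (h ≫ k) ↔
        ∃ hd : dom.Factors (lift (h ≫ x) d), F.app h d hd = z := by
      intro Y h d z
      rw [mem_comp_curry, pullback_factors_iff, hG]
      simp
    have hgood : Good x k := by
      refine ⟨fun Y h y Y' h' H => ?_, fun Y h d Y' h' H => ⟨F.app (h' ≫ h) (h' ≫ d)
        (by simpa using H), fun Y'' g b => ?_⟩⟩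
      · have ey : h' ≫ y = lift (h' ≫ y ≫ fst _ _) (h' ≫ y ≫ snd _ _) := by ext <;> simp
        rw [ey, ← Category.assoc h' h k, hk'] at H
        obtain ⟨hd, e⟩ := H
        refine ⟨by simpa using hd, ?_⟩
        rw [ey, ← e]
        exact F.cod_app _ _ _
      · have := hk' (g ≫ h' ≫ h) (g ≫ h' ≫ d) b
        simp only [Category.assoc] at this
        have hd : dom.Factors (lift ((g ≫ h' ≫ h) ≫ x) (g ≫ h' ≫ d)) :=
          FunFam.dom_comp g (h' ≫ h) x (h' ≫ d) (by simpa using H)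
        rw [this, F.comp_app g _ _ _ hd]
        constructor
        · rintro ⟨_, e⟩
          exact e.symm
        · intro e
          exact ⟨by simpa using hd, e.symm⟩
    have hf : S.Factors (lift x k) := (hS _).2 (by simpa using hgood)
    have hx : S.factorThru (lift x k) hf ≫ w = x := by simp [w]
    refine ⟨⟨S.factorThru (lift x k) hf, hx⟩, ?_⟩
    refine FunFam.ext (funext fun Y => funext fun h => funext fun d => funext fun hd => ?_)
    refine ((hto ⟨S.factorThru (lift x k) hf, hx⟩ h d (F.app h d hd)).1 ?_).2
    have e : S.factorThru (lift x k) hf ≫ S.arrow ≫ snd _ _ = k := by simp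
    rw [e]
    exact (hk' h d _).2 ⟨hd, rfl⟩
  refine ⟨Ty.ofMap w, fun {X} {x} => Equiv.ofBijective toF ⟨inj, surj⟩, ?_⟩
  intro X Y h x y e a
  subst e
  refine FunFam.ext (funext fun Y' => funext fun g => funext fun d => funext fun hd => ?_)
  have := (hto ((Ty.ofMap w).restr h rfl a) g d ((toF a).app (g ≫ h) d (by simpa using hd))).1 (by
    have := (hto a (g ≫ h) d _).2 ⟨by simpa using hd, rfl⟩
    simpa [Ty.ofMap] using this)
  exact this.2

end InternalLogic

/-! ### Elements of families as morphisms to the total object -/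

namespace Ty

variable {E : Type u} [Category.{v} E] {Γ : E} (A : Ty.{v, u} Γ)

/-- The total object of a family. -/
abbrev total : E := A.ext (𝟙 Γ)

/-- The display map of a family. -/
def disp : A.total ⟶ Γ := A.proj (𝟙 Γ)

/-- An element of a family as a morphism to the total object. -/
def tot {X : E} {x : X ⟶ Γ} (a : A.El x) : X ⟶ A.total :=
  A.pair (𝟙 Γ) x (A.restr (𝟙 X) (by simp) a)

/-- A morphism to the total object as an element of the family. -/
def ofTot {X : E} {x : X ⟶ Γ} (v : X ⟶ A.total) (h : v ≫ A.disp = x) : A.El x :=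
  A.restr v (by rw [Category.comp_id]; exact h) (A.var (𝟙 Γ))

variable {A}

theorem tot_disp {X : E} {x : X ⟶ Γ} (a : A.El x) : A.tot a ≫ A.disp = x :=
  A.pair_proj _ _ _

theorem ofTot_tot {X : E} {x : X ⟶ Γ} (a : A.El x) : A.ofTot (A.tot a) (tot_disp a) = a := by
  have h := A.pair_var (𝟙 Γ) x (A.restr (𝟙 X) (by simp) a)
  have h' := congrArg (A.restr (𝟙 X) (y := x) (by simp)) h
  rw [A.restr_comp, A.restr_comp] at h'
  refine Eq.trans ?_ (h'.trans ?_)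
  · exact A.restr_congr _ _ (Category.id_comp _).symm
  · exact (A.restr_congr _ _ (Category.comp_id _)).trans (A.restr_id a)

theorem tot_ofTot {X : E} {x : X ⟶ Γ} (v : X ⟶ A.total) (h : v ≫ A.disp = x) :
    A.tot (A.ofTot v h) = v := by
  subst h
  refine Eq.trans ?_ (A.pair_eta (𝟙 Γ) v)
  refine congrArg (A.pair (𝟙 Γ) _) ?_
  unfold ofTot
  rw [A.restr_comp]
  exact A.restr_congr _ _ (Category.id_comp _)

theorem tot_restr {X Y : E} (h : Y ⟶ X) {x : X ⟶ Γ} {y : Y ⟶ Γ} (e : h ≫ x = y) (a : A.El x) :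
    A.tot (A.restr h e a) = h ≫ A.tot a := by
  subst e
  unfold tot
  rw [A.comp_pair]
  refine congrArg (A.pair (𝟙 Γ) _) ?_
  rw [A.restr_comp, A.restr_comp]
  exact A.restr_congr _ _ (by simp)

theorem tot_injective {X : E} {x : X ⟶ Γ} {a b : A.El x} (h : A.tot a = A.tot b) : a = b := by
  rw [← ofTot_tot a, ← ofTot_tot b]
  congr 1

theorem restr_ofTot {X Y : E} (h : Y ⟶ X) {x : X ⟶ Γ} {y : Y ⟶ Γ} (e : h ≫ x = y)
    (v : X ⟶ A.total) (hv : v ≫ A.disp = x) :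
    A.restr h e (A.ofTot v hv) = A.ofTot (h ≫ v) (by rw [Category.assoc, hv, e]) := by
  apply tot_injective
  rw [tot_restr, tot_ofTot, tot_ofTot]

variable (A)

/-- The morphism to a comprehension given by a morphism to the base and one to the total object. -/
def mkExt {X Y : E} (x : X ⟶ Γ) (h : Y ⟶ X) (v : Y ⟶ A.total) (e : v ≫ A.disp = h ≫ x) :
    Y ⟶ A.ext x :=
  A.pair x h (A.ofTot v e)

/-- The generic element of a comprehension as a morphism to the total object. -/
def tvar {X : E} (x : X ⟶ Γ) : A.ext x ⟶ A.total := A.tot (A.var x)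

variable {A}

theorem tvar_disp {X : E} (x : X ⟶ Γ) : A.tvar x ≫ A.disp = A.proj x ≫ x := tot_disp _

@[simp]
theorem mkExt_proj {X Y : E} (x : X ⟶ Γ) (h : Y ⟶ X) (v : Y ⟶ A.total)
    (e : v ≫ A.disp = h ≫ x) : A.mkExt x h v e ≫ A.proj x = h := A.pair_proj _ _ _

@[simp]
theorem mkExt_proj_assoc {X Y Z : E} (x : X ⟶ Γ) (h : Y ⟶ X) (v : Y ⟶ A.total)
    (e : v ≫ A.disp = h ≫ x) (g : X ⟶ Z) : A.mkExt x h v e ≫ A.proj x ≫ g = h ≫ g := by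
  rw [← Category.assoc, mkExt_proj]

@[simp]
theorem mkExt_tvar {X Y : E} (x : X ⟶ Γ) (h : Y ⟶ X) (v : Y ⟶ A.total)
    (e : v ≫ A.disp = h ≫ x) : A.mkExt x h v e ≫ A.tvar x = v := by
  unfold tvar mkExt
  rw [← tot_restr _ (by rw [← Category.assoc, A.pair_proj]), A.pair_var, tot_ofTot]

/-- Passing to the total object replaces the heterogeneous equality of elements in `Ty.hom_ext` by
an equality of morphisms. This is the purpose of working with `tot` and `tvar`. -/
theorem ext_hom_ext {X Y : E} {x : X ⟶ Γ} {k l : Y ⟶ A.ext x}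
    (h1 : k ≫ A.proj x = l ≫ A.proj x) (h2 : k ≫ A.tvar x = l ≫ A.tvar x) : k = l := by
  rw [← A.pair_eta x k, ← A.pair_eta x l]
  refine A.pair_congr x h1 ?_
  have e1 := Ty.tot_restr (A := A) k (Category.assoc _ _ _).symm (A.var x)
  have e2 := Ty.tot_restr (A := A) l (Category.assoc _ _ _).symm (A.var x)
  have e : A.tot (A.restr k (Category.assoc _ _ _).symm (A.var x)) =
    A.tot (A.restr l (Category.assoc _ _ _).symm (A.var x)) := e1.trans (h2.trans e2.symm)
  revert e
  generalize A.restr k (Category.assoc _ _ _).symm (A.var x) = a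
  generalize A.restr l (Category.assoc _ _ _).symm (A.var x) = b
  revert a b
  rw [h1]
  intro a b hab
  exact heq_of_eq (tot_injective hab)

theorem comp_mkExt {X Y Z : E} (k : Z ⟶ Y) (x : X ⟶ Γ) (h : Y ⟶ X) (v : Y ⟶ A.total)
    (e : v ≫ A.disp = h ≫ x) : k ≫ A.mkExt x h v e =
      A.mkExt x (k ≫ h) (k ≫ v) (by rw [Category.assoc, e, Category.assoc]) :=
  ext_hom_ext (by simp) (by simp)

theorem mkExt_congr {X Y : E} (x : X ⟶ Γ) {h h' : Y ⟶ X} {v v' : Y ⟶ A.total}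
    (e : v ≫ A.disp = h ≫ x) (hh : h = h') (hv : v = v') :
    A.mkExt x h v e = A.mkExt x h' v' (hh ▸ hv ▸ e) := by
  subst hh hv
  rfl

theorem pair_eq_mkExt {X Y : E} (x : X ⟶ Γ) (h : Y ⟶ X) (a : A.El (h ≫ x)) :
    A.pair x h a = A.mkExt x h (A.tot a) (tot_disp a) := by
  unfold mkExt
  rw [ofTot_tot]

theorem extMap_proj {X Y : E} (h : X ⟶ Y) (x : Y ⟶ Γ) :
    A.extMap h x ≫ A.proj x = A.proj (h ≫ x) ≫ h := A.pair_proj _ _ _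

theorem extMap_tvar {X Y : E} (h : X ⟶ Y) (x : Y ⟶ Γ) :
    A.extMap h x ≫ A.tvar x = A.tvar (h ≫ x) := by
  unfold extMap
  rw [pair_eq_mkExt, mkExt_tvar, tot_restr, Category.id_comp, tvar]

theorem mkExt_extMap {X Y Z : E} (h : X ⟶ Y) (x : Y ⟶ Γ) (k : Z ⟶ X) (v : Z ⟶ A.total)
    (e : v ≫ A.disp = k ≫ h ≫ x) : A.mkExt (h ≫ x) k v e ≫ A.extMap h x =
      A.mkExt x (k ≫ h) v (by rw [e, Category.assoc]) :=
  ext_hom_ext (by simp [extMap_proj]) (by simp [extMap_tvar])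

end Ty

/-! ### Elimination into families given by morphisms and functions -/

section Elim

variable {E : Type u} [Category.{v} E] [CartesianMonoidalCategory E] [BraidedCategory E]
  [HasFiniteLimits E] {R : E} [CommRingObj R] {O : RingOrder R}
  [HasSubobjectClassifier E] [MonoidalClosed E] {𝔹 U : E} {T : Ty.{v, u} U} {c : Codes O 𝔹 T}

namespace Codes.IsInductiveRecursive

/-- Elimination into the family displayed by the inclusion of the representing subobject. It has at
most one element over each code, so the naturality of the methods is automatic; a section of it
shows that the subobject contains every code. -/
theorem induction (hIR : c.IsInductiveRecursive) {φ : ∀ {X : E}, (X ⟶ U) → Prop} (hφ : Rep φ)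
    (hb : φ c.bool)
    (hp : ∀ {Γ : E} (u : Γ ⟶ U) (f : T.ext u ⟶ U), φ u → φ f → φ (c.pi u f))
    (he : ∀ {Γ : E} (u : Γ ⟶ U) (a b : T.El u), φ u → φ (c.eq u a b))
    {X : E} (x : X ⟶ U) : φ x := by
  obtain ⟨S, hS⟩ := hφ
  have el : ∀ {X : E} {x : X ⟶ U}, (Ty.ofMap S.arrow).El x → φ x := by
    rintro X x ⟨k, rfl⟩
    exact (hS _).1 (Subobject.factors_comp_arrow k)
  have mk : ∀ {X : E} {x : X ⟶ U}, φ x → (Ty.ofMap S.arrow).El x := fun {X} {x} h =>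
    ⟨S.factorThru x ((hS _).2 h), S.factorThru_arrow _ _⟩
  have sub : ∀ {X : E} {x : X ⟶ U} (a b : (Ty.ofMap S.arrow).El x), a = b := fun a b =>
    Subtype.ext ((cancel_mono S.arrow).1 (a.2.trans b.2.symm))
  obtain ⟨s, -⟩ := hIR (Ty.ofMap S.arrow) (mk hb) (fun u f r s => mk (hp u f (el r) (el s)))
    (fun _ _ _ _ _ => sub _ _) (fun u a b r => mk (he u a b (el r))) (fun _ _ _ _ _ => sub _ _)
  have := Rep.stable ⟨S, hS⟩ x (el s)
  rwa [Category.comp_id] at this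

/-- Recursion into a constant family, by cases. -/
theorem exists_cases (hIR : c.IsInductiveRecursive) (Z : E) (mb : 𝟙_ E ⟶ Z)
    (mp : ∀ {Γ : E} (u : Γ ⟶ U), (T.ext u ⟶ U) → (Γ ⟶ Z))
    (hmp : ∀ {Γ Δ : E} (h : Δ ⟶ Γ) (u : Γ ⟶ U) (f : T.ext u ⟶ U),
      h ≫ mp u f = mp (h ≫ u) (T.extMap h u ≫ f))
    (me : ∀ {Γ : E} (u : Γ ⟶ U), T.El u → T.El u → (Γ ⟶ Z))
    (hme : ∀ {Γ Δ : E} (h : Δ ⟶ Γ) (u : Γ ⟶ U) (a b : T.El u),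
      h ≫ me u a b = me (h ≫ u) (T.restr h rfl a) (T.restr h rfl b)) :
    ∃ s : U ⟶ Z, c.bool ≫ s = mb ∧
      (∀ {Γ : E} (u : Γ ⟶ U) (f : T.ext u ⟶ U), c.pi u f ≫ s = mp u f) ∧
      (∀ {Γ : E} (u : Γ ⟶ U) (a b : T.El u), c.eq u a b ≫ s = me u a b) := by
  -- The constant family at `Z` is displayed by the projection `U ⊗ Z ⟶ U`; the recursive hypotheses
  -- are discarded.
  obtain ⟨s, h1, h2, h3⟩ := hIR (Ty.ofMap (fst U Z)) ⟨lift c.bool mb, lift_fst _ _⟩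
    (fun u f _ _ => ⟨lift (c.pi u f) (mp u f), lift_fst _ _⟩)
    (fun h u f r s => Subtype.ext (by
      change h ≫ lift _ _ = lift _ _
      rw [comp_lift, hmp, c.pi_comp]))
    (fun u a b _ => ⟨lift (c.eq u a b) (me u a b), lift_fst _ _⟩)
    (fun h u a b r => Subtype.ext (by
      change h ≫ lift _ _ = lift _ _
      rw [comp_lift, hme, c.eq_comp]))
  refine ⟨s.1 ≫ snd U Z, ?_, fun u f => ?_, fun u a b => ?_⟩
  · have := congrArg (fun a => a.1 ≫ snd U Z) h1
    simpa [Ty.ofMap] using this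
  · have := congrArg (fun a => a.1 ≫ snd U Z) (h2 u f)
    simpa [Ty.ofMap] using this
  · have := congrArg (fun a => a.1 ≫ snd U Z) (h3 u a b)
    simpa [Ty.ofMap] using this

/-- Recursion into a family of dependent function sets. -/
theorem exists_funFam (hIR : c.IsInductiveRecursive) {D Z : E} (dom : Subobject (U ⊗ D))
    (cod : Subobject (D ⊗ Z)) (mb : FunFam dom cod c.bool)
    (mp : ∀ {Γ : E} (u : Γ ⟶ U) (f : T.ext u ⟶ U), FunFam dom cod u → FunFam dom cod f →
      FunFam dom cod (c.pi u f))
    (hmp : ∀ {Γ Δ : E} (h : Δ ⟶ Γ) (u : Γ ⟶ U) (f : T.ext u ⟶ U) (r : FunFam dom cod u)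
      (s : FunFam dom cod f), (mp u f r s).restr h (c.pi_comp h u f) =
        mp (h ≫ u) (T.extMap h u ≫ f) (r.restr h rfl) (s.restr (T.extMap h u) rfl))
    (me : ∀ {Γ : E} (u : Γ ⟶ U) (a b : T.El u), FunFam dom cod u → FunFam dom cod (c.eq u a b))
    (hme : ∀ {Γ Δ : E} (h : Δ ⟶ Γ) (u : Γ ⟶ U) (a b : T.El u) (r : FunFam dom cod u),
      (me u a b r).restr h (c.eq_comp h u a b) =
        me (h ≫ u) (T.restr h rfl a) (T.restr h rfl b) (r.restr h rfl)) :
    ∃ s : FunFam dom cod (𝟙 U), s.restr c.bool (Category.comp_id _) = mb ∧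
      (∀ {Γ : E} (u : Γ ⟶ U) (f : T.ext u ⟶ U), s.restr (c.pi u f) (Category.comp_id _) =
        mp u f (s.restr u (Category.comp_id _)) (s.restr f (Category.comp_id _))) ∧
      (∀ {Γ : E} (u : Γ ⟶ U) (a b : T.El u), s.restr (c.eq u a b) (Category.comp_id _) =
        me u a b (s.restr u (Category.comp_id _))) := by
  obtain ⟨P, φ, hφ⟩ := exists_ty_funFam dom cod
  obtain ⟨s, h1, h2, h3⟩ := hIR P (φ.symm mb)
    (fun u f r s => φ.symm (mp u f (φ r) (φ s)))
    (fun h u f r s => by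
      apply φ.injective
      rw [hφ, φ.apply_symm_apply, φ.apply_symm_apply, hφ, hφ, hmp])
    (fun u a b r => φ.symm (me u a b (φ r)))
    (fun h u a b r => by
      apply φ.injective
      rw [hφ, φ.apply_symm_apply, φ.apply_symm_apply, hφ, hme])
  refine ⟨φ s, ?_, fun u f => ?_, fun u a b => ?_⟩
  · rw [← hφ, h1, φ.apply_symm_apply]
  · rw [← hφ, h2, φ.apply_symm_apply, hφ, hφ]
  · rw [← hφ, h3, φ.apply_symm_apply, hφ]

/-- The components of codes of dependent products can be recovered. -/
theorem exists_pi_destructors (hIR : c.IsInductiveRecursive) :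
    ∃ (pfst : U ⟶ U) (psnd : T.ext pfst ⟶ U),
      (∀ {Γ : E} (u : Γ ⟶ U) (f : T.ext u ⟶ U), c.pi u f ≫ pfst = u) ∧
      (∀ {Γ Y : E} (u : Γ ⟶ U) (f : T.ext u ⟶ U) (k : Y ⟶ Γ) (a : Y ⟶ T.total)
        (h1 : a ≫ T.disp = (k ≫ c.pi u f) ≫ pfst) (h2 : a ≫ T.disp = k ≫ u),
        T.mkExt pfst (k ≫ c.pi u f) a h1 ≫ psnd = T.mkExt u k a h2 ≫ f) := by
  let dom : Subobject (U ⊗ T.total) := equalizerSubobject (fst _ _) (snd _ _ ≫ T.disp)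
  have hdom : ∀ {Y : E} (x : Y ⟶ U) (d : Y ⟶ T.total), dom.Factors (lift x d) ↔
      d ≫ T.disp = x := by
    intro Y x d
    rw [equalizerSubobject_factors_iff, lift_fst, lift_snd_assoc, eq_comm]
  obtain ⟨Q, φ, hφ⟩ := exists_ty_funFam dom (⊤ : Subobject (T.total ⊗ U))
  -- The morphism `f : Γ.T[u] ⟶ U` as a dependent function `T u → U`. The total object of `Q`
  -- consists of the pairs of a code `u` and such a function, that is, of the arguments of `pi`.
  let fam : ∀ {Γ : E} (u : Γ ⟶ U) (f : T.ext u ⟶ U), FunFam dom (⊤ : Subobject (T.total ⊗ U)) u :=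
    fun u f =>
    { app := fun h d hd => T.mkExt u h d ((hdom _ _).1 hd) ≫ f
      comp_app := fun k h d hd hd' => by rw [← Category.assoc, Ty.comp_mkExt]
      cod_app := fun h d hd => Subobject.top_factors _ }
  have hfam : ∀ {Γ Δ : E} (h : Δ ⟶ Γ) (u : Γ ⟶ U) (f : T.ext u ⟶ U),
      (fam u f).restr h rfl = fam (h ≫ u) (T.extMap h u ≫ f) := by
    intro Γ Δ h u f
    refine FunFam.ext (funext fun Y => funext fun g => funext fun d => funext fun hd => ?_)
    change T.mkExt _ _ _ _ ≫ f = T.mkExt _ _ _ _ ≫ T.extMap h u ≫ f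
    rw [← Category.assoc, Ty.mkExt_extMap]
  have htot : ∀ {Γ Δ : E} (h : Δ ⟶ Γ) (u : Γ ⟶ U)
      (F : FunFam dom (⊤ : Subobject (T.total ⊗ U)) u),
      h ≫ Q.tot (φ.symm F) = Q.tot (φ.symm (F.restr h rfl)) := by
    intro Γ Δ h u F
    rw [← Ty.tot_restr h rfl]
    congr 1
    apply φ.injective
    rw [hφ, φ.apply_symm_apply, φ.apply_symm_apply]
  -- `s` returns the arguments of a `pi` code. On `bool` and on `eq` codes it returns the default
  -- pair of `bool` and the constant function with value `bool`.
  obtain ⟨s, -, hs, -⟩ := hIR.exists_cases Q.total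
    (Q.tot (φ.symm (fam c.bool (T.proj _ ≫ c.bool))))
    (fun {Γ} u f => Q.tot (φ.symm (fam u f)))
    (fun h u f => by rw [htot, hfam])
    (fun {Γ} u a b => toUnit Γ ≫ Q.tot (φ.symm (fam c.bool (T.proj _ ≫ c.bool))))
    (fun h u a b => by rw [← Category.assoc, comp_toUnit])
  have hfst : ∀ {Γ : E} (u : Γ ⟶ U) (f : T.ext u ⟶ U), c.pi u f ≫ s ≫ Q.disp = u := by
    intro Γ u f
    rw [← Category.assoc, hs, Ty.tot_disp]
  let F := φ (Q.ofTot s rfl)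
  have hF : ∀ {Γ : E} (u : Γ ⟶ U) (f : T.ext u ⟶ U),
      F.restr (c.pi u f) (hfst u f) = fam u f := by
    intro Γ u f
    rw [← hφ]
    apply φ.symm.injective
    rw [φ.symm_apply_apply]
    apply Ty.tot_injective
    rw [Ty.tot_restr, Ty.tot_ofTot, hs]
  -- The second destructor is the function component of `s`, applied to the generic element of the
  -- first.
  refine ⟨s ≫ Q.disp, F.app (T.proj _) (T.tvar _) ((hdom _ _).2 (Ty.tvar_disp _)), hfst,
    fun {Γ Y} u f k a h1 h2 => ?_⟩
  have e : (fam u f).app k a ((hdom _ _).2 h2) = T.mkExt u k a h2 ≫ f := rfl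
  rw [← e]
  have e' := congrArg (fun G => G.app k a ((hdom _ _).2 h2)) (hF u f)
  rw [← e']
  refine (F.comp_app _ _ _ _ ?_).trans (F.app_congr _ ?_ ?_)
  · rw [hdom, Ty.mkExt_tvar, Ty.mkExt_proj, h1]
  · rw [Ty.mkExt_proj]
  · rw [Ty.mkExt_tvar]

/-- The endpoints of codes of identity types can be recovered. -/
theorem exists_eq_destructors (hIR : c.IsInductiveRecursive) (t : 𝟙_ E ⟶ 𝔹) :
    ∃ ea eb : U ⟶ T.total, ea ≫ T.disp = eb ≫ T.disp ∧
      ∀ {Γ : E} (u : Γ ⟶ U) (a b : T.El u), c.eq u a b ≫ ea = T.tot a ∧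
        c.eq u a b ≫ eb = T.tot b := by
  -- A closed element of `T bool`. Codes that are not `eq` codes need some pair of elements in a
  -- common fibre as default; `(t', t')` serves.
  let t' : 𝟙_ E ⟶ T.total := T.tot (c.boolEquiv.symm (toUnit _ ≫ t))
  let Z := Limits.pullback T.disp T.disp
  let z : 𝟙_ E ⟶ Z := pullback.lift t' t' rfl
  obtain ⟨s, -, -, hs⟩ := hIR.exists_cases Z z (fun {Γ} u f => toUnit Γ ≫ z)
    (fun h u f => by rw [← Category.assoc, comp_toUnit])
    (fun {Γ} u a b => pullback.lift (T.tot a) (T.tot b) (by rw [Ty.tot_disp, Ty.tot_disp]))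
    (fun h u a b => by
      apply pullback.hom_ext
      · rw [Category.assoc, pullback.lift_fst, pullback.lift_fst, Ty.tot_restr]
      · rw [Category.assoc, pullback.lift_snd, pullback.lift_snd, Ty.tot_restr])
  refine ⟨s ≫ pullback.fst _ _, s ≫ pullback.snd _ _, ?_, fun u a b => ⟨?_, ?_⟩⟩
  · rw [Category.assoc, Category.assoc, pullback.condition]
  · rw [← Category.assoc, hs, pullback.lift_fst]
  · rw [← Category.assoc, hs, pullback.lift_snd]

end Codes.IsInductiveRecursive

end Elim

variable {E : Type u} [Category.{v} E] [CartesianMonoidalCategory E] [BraidedCategory E]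
  [HasFiniteLimits E] {R : E} [CommRingObj R] {O : RingOrder R}
  [HasSubobjectClassifier E] [MonoidalClosed E] {𝔹 U : E} {T : Ty.{v, u} U}

/-! ### Arithmetic of the positive cone -/

namespace RingOrder

variable {X : E}

theorem add_comm' (i j : X ⟶ O.Pos) : O.add i j = O.add j i := by
  rw [← cancel_mono O.val, add_val, add_val, add_comm]

theorem add_assoc' (i j k : X ⟶ O.Pos) : O.add (O.add i j) k = O.add i (O.add j k) := by
  simp only [← cancel_mono O.val, add_val, add_assoc]

theorem add_zero' (i : X ⟶ O.Pos) : O.add i (O.zero X) = i := by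
  rw [← cancel_mono O.val, add_val, zero_val, add_zero]

theorem zero_add' (i : X ⟶ O.Pos) : O.add (O.zero X) i = i := by
  rw [add_comm', add_zero']

theorem add_monus_cancel_left (i j : X ⟶ O.Pos) : O.monus (O.add i j) i = j := by
  rw [← cancel_mono O.val, monus_val_of_le (O.le_add_right i j), add_val, add_sub_cancel_left]

theorem add_monus_of_le {i j : X ⟶ O.Pos} (h : O.Le i j) : O.add i (O.monus j i) = j := by
  rw [← cancel_mono O.val, add_val, monus_val_of_le h, add_sub_cancel]

theorem add_le_add_left' (k : X ⟶ O.Pos) {i j : X ⟶ O.Pos} (h : O.Le i j) :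
    O.Le (O.add k i) (O.add k j) := by
  have := O.add_le _ _ (k ≫ O.val) h
  unfold Le
  rwa [add_val, add_val]

theorem monus_self (i : X ⟶ O.Pos) : O.monus i i = O.zero X := monus_eq_zero Le.rfl

theorem zero_monus (i : X ⟶ O.Pos) : O.monus (O.zero X) i = O.zero X := monus_eq_zero (zero_le i)

theorem min_zero' (i : X ⟶ O.Pos) : O.min i (O.zero X) = O.zero X := min_eq_right (zero_le i)

theorem zero_min' (i : X ⟶ O.Pos) : O.min (O.zero X) i = O.zero X := min_eq_left (zero_le i)

theorem min_comm' (i j : X ⟶ O.Pos) : O.min i j = O.min j i := by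
  refine hom_ext_le i j (fun Z h hh => ?_) (fun Z h hh => ?_)
  · rw [comp_min, comp_min, min_eq_left hh, min_eq_right hh]
  · rw [comp_min, comp_min, min_eq_left hh, min_eq_right hh]

theorem min_le_right (i j : X ⟶ O.Pos) : O.Le (O.min i j) j := by
  rw [min_comm']
  exact min_le_left _ _

theorem add_min (k i j : X ⟶ O.Pos) : O.add k (O.min i j) = O.min (O.add k i) (O.add k j) := by
  refine hom_ext_le i j (fun Z h hh => ?_) (fun Z h hh => ?_)
  · rw [comp_add, comp_min, comp_min, comp_add, comp_add, min_eq_left hh,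
      min_eq_left (add_le_add_left' _ hh)]
  · rw [comp_add, comp_min, comp_min, comp_add, comp_add, min_eq_right hh,
      min_eq_right (add_le_add_left' _ hh)]

theorem min_self (i : X ⟶ O.Pos) : O.min i i = i := min_eq_left Le.rfl

theorem min_add_monus (m d : X ⟶ O.Pos) : O.add (O.min m d) (O.monus d m) = d := by
  refine hom_ext_le m d (fun Z h hh => ?_) (fun Z h hh => ?_)
  · rw [comp_add, comp_min, comp_monus, min_eq_left hh, add_monus_of_le hh]
  · rw [comp_add, comp_min, comp_monus, min_eq_right hh, monus_eq_zero hh, add_zero']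

theorem min_add_min_monus (m n d : X ⟶ O.Pos) :
    O.add (O.min m d) (O.min n (O.monus d m)) = O.min (O.add m n) d := by
  refine hom_ext_le m d (fun Z h hh => ?_) (fun Z h hh => ?_)
  · simp only [comp_add, comp_min, comp_monus]
    rw [min_eq_left hh, add_min, add_monus_of_le hh]
  · simp only [comp_add, comp_min, comp_monus]
    rw [min_eq_right hh, monus_eq_zero hh, min_zero', add_zero',
      min_eq_right (hh.trans (O.le_add_right _ _))]

theorem add_monus_add_left (m i j : X ⟶ O.Pos) :
    O.monus (O.add m i) (O.add m j) = O.monus i j := by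
  rw [← cancel_mono O.val, monus_val, monus_val, ← add_min, add_val, add_val]
  abel

theorem monus_monus_eq (d m n : X ⟶ O.Pos) :
    O.monus (O.monus d m) n = O.monus d (O.add m n) := by
  refine hom_ext_le d m (fun Z h hh => ?_) (fun Z h hh => ?_)
  · simp only [comp_add, comp_monus]
    rw [monus_eq_zero hh, zero_monus, monus_eq_zero (hh.trans (O.le_add_right _ _))]
  · simp only [comp_add, comp_monus]
    conv_rhs => rw [← add_monus_of_le hh]
    rw [add_monus_add_left]

theorem min_add_monus_monus (m n d : X ⟶ O.Pos) :
    O.add (O.min m d) (O.monus (O.monus d m) n) = O.monus d (O.min n (O.monus d m)) := by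
  rw [← cancel_mono O.val, add_val, monus_val, monus_val_of_le ((min_le_right _ _).trans
    (monus_le _ _)), min_comm' n]
  conv_rhs => rw [← min_add_monus m d, add_val]
  rw [min_add_monus]
  abel

theorem monus_min (d m : X ⟶ O.Pos) : O.monus d (O.min m d) = O.monus d m := by
  rw [← cancel_mono O.val, monus_val, monus_val, min_eq_right (min_le_right m d), min_comm']

variable (O)

/-- The point at distance `k` from `i` on the interval between `i` and `j`. -/
noncomputable def toward (i j k : X ⟶ O.Pos) : X ⟶ O.Pos :=
  O.monus (O.add i (O.min k (O.monus j i))) (O.min k (O.monus i j))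

/-- The distance between two elements of the positive cone. -/
noncomputable def dist (i j : X ⟶ O.Pos) : X ⟶ O.Pos := O.add (O.monus j i) (O.monus i j)

theorem comp_toward {Y : E} (h : Y ⟶ X) (i j k : X ⟶ O.Pos) :
    h ≫ O.toward i j k = O.toward (h ≫ i) (h ≫ j) (h ≫ k) := by
  simp only [toward, comp_monus, comp_add, comp_min]

theorem comp_dist {Y : E} (h : Y ⟶ X) (i j : X ⟶ O.Pos) :
    h ≫ O.dist i j = O.dist (h ≫ i) (h ≫ j) := by
  simp only [dist, comp_monus, comp_add]

variable {O}

theorem dist_comm' (i j : X ⟶ O.Pos) : O.dist i j = O.dist j i := add_comm' _ _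

/-- One of `j ∸ i` and `i ∸ j` always vanishes, so only one of the two corrections in `toward` is
active. With `toward_down`, and `hom_ext_add` to separate the cases, identities about `toward`
become truncated arithmetic on the difference `d`. -/
theorem toward_up (i d k : X ⟶ O.Pos) : O.toward i (O.add i d) k = O.add i (O.min k d) := by
  rw [toward, add_monus_cancel_left, monus_eq_zero (O.le_add_right i d), min_zero', monus_zero]

theorem toward_down (i d k : X ⟶ O.Pos) :
    O.toward (O.add i d) i k = O.add i (O.monus d k) := by
  rw [toward, add_monus_cancel_left, monus_eq_zero (O.le_add_right i d), min_zero', add_zero',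
    ← cancel_mono O.val, monus_val_of_le, add_val, add_val, monus_val, min_comm' d,
    add_sub_assoc]
  rw [add_comm']
  exact (min_le_right k d).trans (O.le_add_right d i)

theorem dist_up (i d : X ⟶ O.Pos) : O.dist i (O.add i d) = d := by
  rw [dist, add_monus_cancel_left, monus_eq_zero (O.le_add_right i d), add_zero']

theorem dist_down (i d : X ⟶ O.Pos) : O.dist (O.add i d) i = d := by
  rw [dist_comm', dist_up]

/-- Two maps are equal if they are so whenever `j = i + d` or `i = j + d`. -/
theorem hom_ext_add {Y : E} (i j : X ⟶ O.Pos) {f g : X ⟶ Y}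
    (h1 : ∀ (Z : E) (h : Z ⟶ X) (d : Z ⟶ O.Pos), h ≫ j = O.add (h ≫ i) d → h ≫ f = h ≫ g)
    (h2 : ∀ (Z : E) (h : Z ⟶ X) (d : Z ⟶ O.Pos), h ≫ i = O.add (h ≫ j) d → h ≫ f = h ≫ g) :
    f = g :=
  hom_ext_le i j (fun Z h hh => h1 Z h _ (add_monus_of_le hh).symm)
    (fun Z h hh => h2 Z h _ (add_monus_of_le hh).symm)

theorem toward_zero (i j : X ⟶ O.Pos) : O.toward i j (O.zero X) = i := by
  rw [toward, zero_min', zero_min', add_zero', monus_zero]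

theorem toward_dist (i j : X ⟶ O.Pos) : O.toward i j (O.dist i j) = j := by
  refine hom_ext_add i j (fun Z h d e => ?_) (fun Z h d e => ?_)
  · rw [comp_toward, comp_dist, e, toward_up, dist_up, min_self]
  · rw [comp_toward, comp_dist, e, toward_down, dist_down, monus_self, add_zero']

theorem toward_self (i k : X ⟶ O.Pos) : O.toward i i k = i := by
  have := toward_up i (O.zero X) k
  rwa [add_zero', min_zero', add_zero'] at this

theorem dist_self' (i : X ⟶ O.Pos) : O.dist i i = O.zero X := by
  rw [dist, monus_self, add_zero']

/-- Distances travelled towards the same end add up. In the increasing case `i + d` is regrouped as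
`(i + min m d) + (d ∸ m)`, so that the second move is again of the form treated by `toward_up`. -/
theorem toward_toward (i j m n : X ⟶ O.Pos) :
    O.toward (O.toward i j m) j n = O.toward i j (O.add m n) := by
  refine hom_ext_add i j (fun Z h d e => ?_) (fun Z h d e => ?_)
  · simp only [comp_toward, comp_add, e, toward_up]
    have : O.add (h ≫ i) d = O.add (O.add (h ≫ i) (O.min (h ≫ m) d)) (O.monus d (h ≫ m)) := by
      rw [add_assoc', min_add_monus]
    rw [this, toward_up, add_assoc', min_add_min_monus]
  · simp only [comp_toward, comp_add, e, toward_down, monus_monus_eq]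

theorem dist_toward (i j m : X ⟶ O.Pos) :
    O.dist (O.toward i j m) j = O.monus (O.dist i j) m := by
  refine hom_ext_add i j (fun Z h d e => ?_) (fun Z h d e => ?_)
  · simp only [comp_dist, comp_toward, comp_monus, e, toward_up, dist_up]
    have : O.add (h ≫ i) d = O.add (O.add (h ≫ i) (O.min (h ≫ m) d)) (O.monus d (h ≫ m)) := by
      rw [add_assoc', min_add_monus]
    rw [this, dist_up]
  · simp only [comp_dist, comp_toward, comp_monus, e, toward_down, dist_down]

/-- The part of the interval beyond the point at distance `m` has length `dist i j ∸ m`. Walking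
back from `j` is capped at this length, and the distance from `i` is what remains of `dist i j`. -/
theorem toward_toward_flip (i j m n : X ⟶ O.Pos) : O.toward j (O.toward i j m) n =
    O.toward i j (O.monus (O.dist i j) (O.min n (O.monus (O.dist i j) m))) := by
  refine hom_ext_add i j (fun Z h d e => ?_) (fun Z h d e => ?_)
  · simp only [comp_dist, comp_toward, comp_monus, comp_min, e, toward_up, dist_up]
    have : O.add (h ≫ i) d = O.add (O.add (h ≫ i) (O.min (h ≫ m) d)) (O.monus d (h ≫ m)) := by
      rw [add_assoc', min_add_monus]
    rw [this, toward_down, add_assoc', min_add_monus_monus, min_eq_left (monus_le _ _)]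
  · simp only [comp_dist, comp_toward, comp_monus, comp_min, e, toward_down, dist_down, toward_up,
      monus_monus]
    rw [min_eq_right ((min_le_right _ _).trans (monus_le _ _))]

theorem zero_toward (l k : X ⟶ O.Pos) : O.toward (O.zero X) l k = O.min k l := by
  have := toward_up (O.zero X) l k
  rwa [zero_add', zero_add'] at this

theorem toward_zero_right (l k : X ⟶ O.Pos) : O.toward l (O.zero X) k = O.monus l k := by
  have := toward_down (O.zero X) l k
  rwa [zero_add', zero_add'] at this

theorem zero_dist (l : X ⟶ O.Pos) : O.dist (O.zero X) l = l := by
  have := dist_up (O.zero X) l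
  rwa [zero_add'] at this

/-- The map `i ↦ max i 0`: glue the identity on `0 ≤ i` with zero on `i ≤ 0`, which agree on the
overlap by antisymmetry. It transfers connectedness from `R` to the positive cone. -/
theorem exists_retraction (O : RingOrder R) : ∃ ρ : R ⟶ O.Pos, O.val ≫ ρ = 𝟙 O.Pos := by
  let P := (Subobject.pullback (lift (0 : R ⟶ R) (𝟙 R))).obj O.le
  let Q := (Subobject.pullback (lift (0 : R ⟶ R) (𝟙 R))).obj
    ((Subobject.pullback (lift (snd R R) (fst R R))).obj O.le)
  obtain ⟨ρ, h, -⟩ := exists_glue (isLUB_pullback O.total (lift (0 : R ⟶ R) (𝟙 R)))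
    (𝟙 (P : E)) (O.zero (Q : E)) (by
      intro V k l e
      rw [Category.comp_id]
      refine Eq.trans ?_ (O.comp_zero l).symm
      refine (cancel_mono O.val).1 (Eq.trans ?_ (O.zero_val V).symm)
      refine O.antisymm _ _ ?_ (O.val_nonneg k)
      have h1 : Q.Factors (l ≫ Q.arrow) := Subobject.factors_comp_arrow l
      rw [pullback_factors_iff, pullback_factors_iff, comp_lift] at h1
      simp only [Category.assoc, lift_snd, lift_fst, Category.comp_id, AddMonObj.comp_zero] at h1
      change O.le.Factors (lift (k ≫ P.arrow) 0)
      have e' : k ≫ P.arrow = l ≫ Q.arrow := e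
      rw [e']
      exact h1)
  exact ⟨ρ, h⟩

/-- Maps from the positive cone to the Booleans are constant. -/
theorem eq_const_of_connected {𝔹 : E} (hR : IsConnectedObject 𝔹 R) (p : X ⊗ O.Pos ⟶ 𝔹) :
    p = fst X O.Pos ≫ lift (𝟙 X) (O.zero X) ≫ p := by
  obtain ⟨ρ, hρ⟩ := O.exists_retraction
  have hiso : IsIso (MonoidalClosed.curry (snd R 𝔹) : 𝔹 ⟶ (ihom R).obj 𝔹) := hR
  -- Connectedness with parameters: the transpose `X ⟶ 𝔹^R` factors through the constant functions
  -- because these are all of `𝔹^R`.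
  have key : ∀ q : R ⊗ X ⟶ 𝔹, ∃ b : X ⟶ 𝔹, q = snd R X ≫ b := by
    intro q
    refine ⟨MonoidalClosed.curry q ≫ inv (MonoidalClosed.curry (snd R 𝔹)), ?_⟩
    apply MonoidalClosed.curry_injective
    have : snd R X ≫ MonoidalClosed.curry q ≫ inv (MonoidalClosed.curry (snd R 𝔹)) =
      R ◁ (MonoidalClosed.curry q ≫ inv (MonoidalClosed.curry (snd R 𝔹))) ≫ snd R 𝔹 := by
      simp
    rw [this, MonoidalClosed.curry_natural_left]
    simp
  -- Extend `p` from the positive cone to `R` by precomposing with the retraction.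
  obtain ⟨b, hb⟩ := key (lift (snd R X) (fst R X ≫ ρ) ≫ p)
  have hp : p = fst X O.Pos ≫ b := by
    have := congrArg (lift (snd X O.Pos ≫ O.val) (fst X O.Pos) ≫ ·) hb
    simp only [comp_lift_assoc, lift_snd, lift_fst_assoc, Category.assoc, hρ, Category.comp_id,
      lift_snd_assoc] at this
    rw [← this]
    have e : lift (fst X O.Pos) (snd X O.Pos) = 𝟙 _ := by ext <;> simp
    rw [e, Category.id_comp]
  rw [hp, lift_fst_assoc, Category.id_comp]

end RingOrder

/-! ### Decoding codes and paths of codes -/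

/-- At a stage where the two Booleans agree, any two parallel maps agree. -/
theorem hom_ext_of_degenerate {tt ff : 𝟙_ E ⟶ 𝔹} (h𝔹 : IsColimit (BinaryCofan.mk tt ff)) {Y Z : E}
    (h : toUnit Y ≫ tt = toUnit Y ≫ ff) (f g : Y ⟶ Z) : f = g := by
  let nm : (Y ⟶ Z) → (𝟙_ E ⟶ (ihom Y).obj Z) := fun f => MonoidalClosed.curry (fst Y _ ≫ f)
  have hnm : ∀ f : Y ⟶ Z, lift (𝟙 Y) (toUnit Y ≫ nm f) ≫ (ihom.ev Y).app Z = f := fun f => by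
    rw [lift_comp_uncurry, MonoidalClosed.uncurry_curry, lift_fst_assoc, Category.id_comp]
  -- `f` and `g` become points of the exponential, and `d` sends one Boolean to each. Where the
  -- Booleans coincide, so do their images.
  let d : 𝔹 ⟶ (ihom Y).obj Z := h𝔹.desc (BinaryCofan.mk (nm f) (nm g))
  have h1 : tt ≫ d = nm f := h𝔹.fac (BinaryCofan.mk (nm f) (nm g)) ⟨WalkingPair.left⟩
  have h2 : ff ≫ d = nm g := h𝔹.fac (BinaryCofan.mk (nm f) (nm g)) ⟨WalkingPair.right⟩
  rw [← hnm f, ← hnm g, ← h1, ← h2, ← Category.assoc, h, Category.assoc]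

namespace Codes

theorem pi_congr (c : Codes O 𝔹 T) {Γ : E} {u u' : Γ ⟶ U} {f : T.ext u ⟶ U} {f' : T.ext u' ⟶ U}
    (hu : u = u') (hf : ∀ {Y : E} (k : Y ⟶ Γ) (a : Y ⟶ T.total) (h : a ≫ T.disp = k ≫ u)
      (h' : a ≫ T.disp = k ≫ u'), T.mkExt u k a h ≫ f = T.mkExt u' k a h' ≫ f') :
    c.pi u f = c.pi u' f' := by
  subst hu
  congr 1
  have := hf (T.proj u) (T.tvar u) (Ty.tvar_disp u) (Ty.tvar_disp u)
  have e : T.mkExt u (T.proj u) (T.tvar u) (Ty.tvar_disp u) = 𝟙 _ :=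
    Ty.ext_hom_ext (by simp) (by simp)
  simpa [e] using this

theorem eq_congr (c : Codes O 𝔹 T) {Γ : E} {u u' : Γ ⟶ U} {a b : T.El u} {a' b' : T.El u'}
    (hu : u = u') (ha : T.tot a = T.tot a') (hb : T.tot b = T.tot b') :
    c.eq u a b = c.eq u' a' b' := by
  subst hu
  rw [Ty.tot_injective ha, Ty.tot_injective hb]

/-- Total destructors of codes, together with the fact that a path of codes that passes through a
code of one of the three kinds consists of codes of that kind. -/
structure Decode (c : Codes O 𝔹 T) where
  /-- the domain of a code of a dependent product -/
  pfst : U ⟶ U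
  /-- the codomain of a code of a dependent product -/
  psnd : T.ext pfst ⟶ U
  pi_pfst : ∀ {Γ : E} (u : Γ ⟶ U) (f : T.ext u ⟶ U), c.pi u f ≫ pfst = u
  pi_psnd : ∀ {Γ Y : E} (u : Γ ⟶ U) (f : T.ext u ⟶ U) (k : Y ⟶ Γ) (a : Y ⟶ T.total)
    (h1 : a ≫ T.disp = (k ≫ c.pi u f) ≫ pfst) (h2 : a ≫ T.disp = k ≫ u),
    T.mkExt pfst (k ≫ c.pi u f) a h1 ≫ psnd = T.mkExt u k a h2 ≫ f
  /-- the first endpoint of a code of an identity type -/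
  ea : U ⟶ T.total
  /-- the second endpoint of a code of an identity type -/
  eb : U ⟶ T.total
  eb_disp : eb ≫ T.disp = ea ≫ T.disp
  eq_ea : ∀ {Γ : E} (u : Γ ⟶ U) (a b : T.El u), c.eq u a b ≫ ea = T.tot a
  eq_eb : ∀ {Γ : E} (u : Γ ⟶ U) (a b : T.El u), c.eq u a b ≫ eb = T.tot b
  path_bool : ∀ {X : E} (p : X ⊗ O.Pos ⟶ U) (i : X ⟶ O.Pos),
    lift (𝟙 X) i ≫ p = toUnit X ≫ c.bool → p = toUnit _ ≫ c.bool
  path_pi : ∀ {Γ X : E} (u : Γ ⟶ U) (f : T.ext u ⟶ U) (h : X ⟶ Γ) (p : X ⊗ O.Pos ⟶ U)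
    (i : X ⟶ O.Pos), lift (𝟙 X) i ≫ p = h ≫ c.pi u f → p ≫ c.pi pfst psnd = p
  path_eq : ∀ {Γ X : E} (u : Γ ⟶ U) (a b : T.El u) (h : X ⟶ Γ) (p : X ⊗ O.Pos ⟶ U)
    (i : X ⟶ O.Pos), lift (𝟙 X) i ≫ p = h ≫ c.eq u a b →
      p ≫ c.eq (ea ≫ T.disp) (T.ofTot ea rfl) (T.ofTot eb eb_disp) = p

/-- Along a function on `R_+` the indicator of a kind of code is constant by connectedness. By
induction on codes, any code whose indicator is true is fixed by taking it apart and rebuilding it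
as a code of that kind, so a function that meets the kind once is rebuilt from its components
everywhere. -/
theorem exists_decode {c : Codes O 𝔹 T} {tt ff : 𝟙_ E ⟶ 𝔹}
    (h𝔹 : IsColimit (BinaryCofan.mk tt ff)) (hR : IsConnectedObject 𝔹 R)
    (hIR : c.IsInductiveRecursive) : Nonempty (Decode c) := by
  obtain ⟨pfst, psnd, pi_pfst, pi_psnd⟩ := hIR.exists_pi_destructors
  obtain ⟨ea, eb, hab, heq⟩ := hIR.exists_eq_destructors tt
  -- A map `U ⟶ 𝔹` with prescribed values on the three kinds of codes; the three instances below are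
  -- the indicators.
  let tag := fun x y z : 𝟙_ E ⟶ 𝔹 => hIR.exists_cases 𝔹 x (fun {Γ} _ _ => toUnit Γ ≫ y)
    (fun h u f => by rw [← Category.assoc, comp_toUnit]) (fun {Γ} _ _ _ => toUnit Γ ≫ z)
    (fun h u a b => by rw [← Category.assoc, comp_toUnit])
  obtain ⟨sb, sb1, sb2, sb3⟩ := tag tt ff ff
  obtain ⟨sp, sp1, sp2, sp3⟩ := tag ff tt ff
  obtain ⟨se, se1, se2, se3⟩ := tag ff ff tt
  -- Proof by cases on a code, for an indicator `s` and a rebuilding map `e`. The constantly true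
  -- map enters as `g` because the induction predicate must be an implication between equations of
  -- maps.
  have exhaust : ∀ (s g : U ⟶ 𝔹) (e : U ⟶ U) (he : ∀ {X : E} (x : X ⟶ U), x ≫ g = toUnit X ≫ tt),
      (∀ (Y : E) (h : Y ⟶ 𝟙_ E), (h ≫ c.bool) ≫ s = toUnit Y ≫ tt → (h ≫ c.bool) ≫ e = h ≫ c.bool) →
      (∀ {Γ : E} (u : Γ ⟶ U) (f : T.ext u ⟶ U) (Y : E) (h : Y ⟶ Γ),
        (h ≫ c.pi u f) ≫ s = toUnit Y ≫ tt → (h ≫ c.pi u f) ≫ e = h ≫ c.pi u f) →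
      (∀ {Γ : E} (u : Γ ⟶ U) (a b : T.El u) (Y : E) (h : Y ⟶ Γ),
        (h ≫ c.eq u a b) ≫ s = toUnit Y ≫ tt → (h ≫ c.eq u a b) ≫ e = h ≫ c.eq u a b) →
      ∀ {X : E} (x : X ⟶ U), x ≫ s = toUnit X ≫ tt → x ≫ e = x := by
    intro s g e hg h1 h2 h3 X x hx
    have := hIR.induction (Rep.imp (Rep.eq s g) (Rep.eq e (𝟙 U)))
      (by intro Y h H; rw [hg] at H; simpa using h1 Y h H)
      (by intro Γ u f _ _ Y h H; rw [hg] at H; simpa using h2 u f Y h H)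
      (by intro Γ u a b _ Y h H; rw [hg] at H; simpa using h3 u a b Y h H) x X (𝟙 X)
    simp only [Category.id_comp, Category.comp_id] at this
    exact this (hx.trans (hg x).symm)
  have hconst : ∀ (s : U ⟶ 𝔹) {X : E} (p : X ⊗ O.Pos ⟶ U) (i : X ⟶ O.Pos),
      lift (𝟙 X) i ≫ p ≫ s = toUnit X ≫ tt → p ≫ s = toUnit _ ≫ tt := by
    intro s X p i h
    have e := RingOrder.eq_const_of_connected hR (p ≫ s)
    rw [e, lift_fst_assoc, Category.id_comp] at h
    rw [e, h, ← Category.assoc, comp_toUnit]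
  have hg : ∀ {X : E} (x : X ⟶ U), x ≫ toUnit U ≫ tt = toUnit X ≫ tt := fun x => by
    rw [← Category.assoc, comp_toUnit]
  -- A code of another kind has a false indicator. If it is also true, the Booleans coincide at this
  -- stage, and then any two parallel maps are equal.
  have absurd : ∀ {Y Γ : E} {Z : E} (h : Y ⟶ Γ) (s : Γ ⟶ 𝔹), s = toUnit Γ ≫ ff →
      h ≫ s = toUnit Y ≫ tt → ∀ f g : Y ⟶ Z, f = g := by
    intro Y Γ Z h s hs e f g
    refine hom_ext_of_degenerate h𝔹 ?_ f g
    rw [← e, hs, ← Category.assoc, comp_toUnit]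
  refine ⟨⟨pfst, psnd, pi_pfst, pi_psnd, ea, eb, hab.symm, fun u a b => (heq u a b).1,
    fun u a b => (heq u a b).2, fun {X} p i hp => ?_, fun {Γ X} u f h p i hp => ?_,
    fun {Γ X} u a b h p i hp => ?_⟩⟩
  · have := exhaust sb (toUnit U ≫ tt) (toUnit U ≫ c.bool) hg
      (fun Y h _ => by
        rw [← Category.assoc (h ≫ c.bool), comp_toUnit, toUnit_unique h (toUnit Y)])
      (fun u f Y h H => absurd h _ (sb2 u f) (by rw [← H, Category.assoc]) _ _)
      (fun u a b Y h H => absurd h _ (sb3 u a b) (by rw [← H, Category.assoc]) _ _) p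
      (hconst sb p i (by rw [← Category.assoc, hp, Category.assoc, sb1]))
    rw [← this, ← Category.assoc, comp_toUnit]
  · refine exhaust sp (toUnit U ≫ tt) (c.pi pfst psnd) hg
      (fun Y h H => absurd h (c.bool ≫ sp) (by rw [sp1, toUnit_unique (toUnit (𝟙_ E)) (𝟙 _),
        Category.id_comp]) (by rw [← H, Category.assoc]) _ _)
      (fun u f Y h _ => ?_)
      (fun u a b Y h H => absurd h _ (sp3 u a b) (by rw [← H, Category.assoc]) _ _) p
      (hconst sp p i (by rw [← Category.assoc, hp, Category.assoc, sp2, ← Category.assoc,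
        comp_toUnit]))
    rw [Category.assoc, c.pi_comp]
    congr 1
    refine c.pi_congr (pi_pfst u f) fun k a h h' => ?_
    rw [← Category.assoc, Ty.mkExt_extMap]
    exact pi_psnd u f k a _ _
  · refine exhaust se (toUnit U ≫ tt) _ hg
      (fun Y h H => absurd h (c.bool ≫ se) (by rw [se1, toUnit_unique (toUnit (𝟙_ E)) (𝟙 _),
        Category.id_comp]) (by rw [← H, Category.assoc]) _ _)
      (fun u f Y h H => absurd h _ (se2 u f) (by rw [← H, Category.assoc]) _ _)
      (fun u a b Y h _ => ?_) p
      (hconst se p i (by rw [← Category.assoc, hp, Category.assoc, se3, ← Category.assoc,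
        comp_toUnit]))
    rw [Category.assoc, c.eq_comp]
    congr 1
    refine c.eq_congr ?_ ?_ ?_
    · rw [← Category.assoc, (heq u a b).1, Ty.tot_disp]
    · rw [Ty.tot_restr, Ty.tot_ofTot, (heq u a b).1]
    · rw [Ty.tot_restr, Ty.tot_ofTot, (heq u a b).2]

/-! ### Application of elements of dependent products -/

variable (c : Codes O 𝔹 T)

/-- Application of an element of a dependent product. -/
def papp {X : E} (u : X ⟶ U) (f : T.ext u ⟶ U) (t : X ⟶ T.total) (ht : t ≫ T.disp = c.pi u f)
    {Y : E} (k : Y ⟶ X) (a : Y ⟶ T.total) (ha : a ≫ T.disp = k ≫ u) : Y ⟶ T.total :=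
  T.mkExt u k a ha ≫ T.tot (c.piEquiv u f (T.ofTot t ht))

variable {c}

theorem papp_disp {X : E} (u : X ⟶ U) (f : T.ext u ⟶ U) (t : X ⟶ T.total)
    (ht : t ≫ T.disp = c.pi u f) {Y : E} (k : Y ⟶ X) (a : Y ⟶ T.total)
    (ha : a ≫ T.disp = k ≫ u) : c.papp u f t ht k a ha ≫ T.disp = T.mkExt u k a ha ≫ f := by
  rw [papp, Category.assoc, Ty.tot_disp]

theorem comp_papp {X : E} (u : X ⟶ U) (f : T.ext u ⟶ U) (t : X ⟶ T.total)
    (ht : t ≫ T.disp = c.pi u f) {Y Z : E} (g : Z ⟶ Y) (k : Y ⟶ X) (a : Y ⟶ T.total)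
    (ha : a ≫ T.disp = k ≫ u) : g ≫ c.papp u f t ht k a ha =
      c.papp u f t ht (g ≫ k) (g ≫ a) (by rw [Category.assoc, ha, Category.assoc]) := by
  rw [papp, ← Category.assoc, Ty.comp_mkExt, papp]

theorem papp_stage {X X' : E} (h : X' ⟶ X) (u : X ⟶ U) (f : T.ext u ⟶ U) (t : X ⟶ T.total)
    (ht : t ≫ T.disp = c.pi u f) {Y : E} (k : Y ⟶ X') (a : Y ⟶ T.total)
    (ha : a ≫ T.disp = k ≫ h ≫ u) :
    c.papp (h ≫ u) (T.extMap h u ≫ f) (h ≫ t) (by rw [Category.assoc, ht, c.pi_comp]) k a ha =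
      c.papp u f t ht (k ≫ h) a (by rw [ha, Category.assoc]) := by
  have := congrArg T.tot (c.piEquiv_restr h u f (T.ofTot t ht))
  rw [Ty.restr_ofTot, Ty.tot_restr] at this
  rw [papp, this, ← Category.assoc, Ty.mkExt_extMap, papp]

theorem papp_congr {X : E} {u u' : X ⟶ U} {f : T.ext u ⟶ U} {f' : T.ext u' ⟶ U}
    {t t' : X ⟶ T.total} (ht : t ≫ T.disp = c.pi u f) (ht' : t' ≫ T.disp = c.pi u' f')
    (hu : u = u') (hf : ∀ {Y : E} (k : Y ⟶ X) (a : Y ⟶ T.total) (h : a ≫ T.disp = k ≫ u)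
      (h' : a ≫ T.disp = k ≫ u'), T.mkExt u k a h ≫ f = T.mkExt u' k a h' ≫ f') (e : t = t')
    {Y : E} {k k' : Y ⟶ X} {a a' : Y ⟶ T.total} (ha : a ≫ T.disp = k ≫ u)
    (ha' : a' ≫ T.disp = k' ≫ u') (ek : k = k') (ea : a = a') :
    c.papp u f t ht k a ha = c.papp u' f' t' ht' k' a' ha' := by
  subst hu e ek ea
  have := hf (T.proj u) (T.tvar u) (Ty.tvar_disp u) (Ty.tvar_disp u)
  have e : T.mkExt u (T.proj u) (T.tvar u) (Ty.tvar_disp u) = 𝟙 _ :=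
    Ty.ext_hom_ext (by simp) (by simp)
  rw [e, Category.id_comp, Category.id_comp] at this
  subst this
  rfl

theorem papp_ext {X : E} (u : X ⟶ U) (f : T.ext u ⟶ U) {t t' : X ⟶ T.total}
    (ht : t ≫ T.disp = c.pi u f) (ht' : t' ≫ T.disp = c.pi u f)
    (H : ∀ (Y : E) (k : Y ⟶ X) (a : Y ⟶ T.total) (ha : a ≫ T.disp = k ≫ u),
      c.papp u f t ht k a ha = c.papp u f t' ht' k a ha) : t = t' := by
  have := H _ (T.proj u) (T.tvar u) (Ty.tvar_disp u)
  have e : T.mkExt u (T.proj u) (T.tvar u) (Ty.tvar_disp u) = 𝟙 _ :=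
    Ty.ext_hom_ext (by simp) (by simp)
  rw [papp, papp, e, Category.id_comp, Category.id_comp] at this
  have := (c.piEquiv u f).injective (Ty.tot_injective this)
  rw [← Ty.tot_ofTot t ht, this, Ty.tot_ofTot]

theorem exists_plam (c : Codes O 𝔹 T) {X : E} (u : X ⟶ U) (f : T.ext u ⟶ U) (b : T.ext u ⟶ T.total)
    (hb : b ≫ T.disp = f) : ∃ (t : X ⟶ T.total) (ht : t ≫ T.disp = c.pi u f),
      ∀ (Y : E) (k : Y ⟶ X) (a : Y ⟶ T.total) (ha : a ≫ T.disp = k ≫ u),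
        c.papp u f t ht k a ha = T.mkExt u k a ha ≫ b := by
  refine ⟨T.tot ((c.piEquiv u f).symm (T.ofTot b hb)), Ty.tot_disp _, fun Y k a ha => ?_⟩
  rw [papp, Ty.ofTot_tot, Equiv.apply_symm_apply, Ty.tot_ofTot]

namespace Decode

variable (D : Decode c)

/-- The value at `a` of the codomain of the code `z` of a dependent product. -/
def cod {Y : E} (z : Y ⟶ U) (a : Y ⟶ T.total) (ha : a ≫ T.disp = z ≫ D.pfst) : Y ⟶ U :=
  T.mkExt D.pfst z a ha ≫ D.psnd

/-- Application of an element of the dependent product with code `z`. -/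
def app {Y : E} (z : Y ⟶ U) (t : Y ⟶ T.total) (ht : t ≫ T.disp = z ≫ c.pi D.pfst D.psnd)
    (a : Y ⟶ T.total) (ha : a ≫ T.disp = z ≫ D.pfst) : Y ⟶ T.total :=
  c.papp (z ≫ D.pfst) (T.extMap z D.pfst ≫ D.psnd) t (by rw [ht, c.pi_comp]) (𝟙 Y) a
    (by rw [ha, Category.id_comp])

variable {D}

theorem comp_cod {Y Z : E} (k : Z ⟶ Y) (z : Y ⟶ U) (a : Y ⟶ T.total)
    (ha : a ≫ T.disp = z ≫ D.pfst) : k ≫ D.cod z a ha =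
      D.cod (k ≫ z) (k ≫ a) (by rw [Category.assoc, ha, Category.assoc]) := by
  rw [cod, ← Category.assoc, Ty.comp_mkExt, cod]

theorem cod_congr {Y : E} {z z' : Y ⟶ U} {a a' : Y ⟶ T.total} (ha : a ≫ T.disp = z ≫ D.pfst)
    (ez : z = z') (ea : a = a') : D.cod z a ha = D.cod z' a' (ez ▸ ea ▸ ha) := by
  subst ez ea
  rfl

theorem app_disp {Y : E} (z : Y ⟶ U) (t : Y ⟶ T.total)
    (ht : t ≫ T.disp = z ≫ c.pi D.pfst D.psnd) (a : Y ⟶ T.total)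
    (ha : a ≫ T.disp = z ≫ D.pfst) : D.app z t ht a ha ≫ T.disp = D.cod z a ha := by
  rw [app, papp_disp, ← Category.assoc, Ty.mkExt_extMap, cod]
  congr 1
  exact Ty.mkExt_congr _ _ (Category.id_comp _) rfl

theorem app_congr {Y : E} {z z' : Y ⟶ U} {t t' : Y ⟶ T.total}
    (ht : t ≫ T.disp = z ≫ c.pi D.pfst D.psnd) {a a' : Y ⟶ T.total}
    (ha : a ≫ T.disp = z ≫ D.pfst) (ez : z = z') (et : t = t') (ea : a = a') :
    D.app z t ht a ha = D.app z' t' (ez ▸ et ▸ ht) a' (ez ▸ ea ▸ ha) := by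
  subst ez et ea
  rfl

/-- `papp` applies a function given at stage `X` to an argument given later, whereas `app` keeps
code, function and argument at one stage. Naturality of the decoding of products identifies them. -/
theorem papp_eq_app {X Y : E} (z : X ⟶ U) (t : X ⟶ T.total)
    (ht : t ≫ T.disp = z ≫ c.pi D.pfst D.psnd) (k : Y ⟶ X) (a : Y ⟶ T.total)
    (ha : a ≫ T.disp = k ≫ z ≫ D.pfst) :
    c.papp (z ≫ D.pfst) (T.extMap z D.pfst ≫ D.psnd) t (by rw [ht, c.pi_comp]) k a ha =
      D.app (k ≫ z) (k ≫ t) (by rw [Category.assoc, ht, Category.assoc]) a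
        (by rw [ha, Category.assoc]) := by
  have hp := c.pi_comp z D.pfst D.psnd
  have := papp_stage k (z ≫ D.pfst) (T.extMap z D.pfst ≫ D.psnd) t (by rw [ht, hp]) (𝟙 Y) a
    (by rw [ha, Category.id_comp])
  refine Eq.trans ?_ (this.symm.trans ?_)
  · exact papp_congr _ _ rfl (fun _ _ _ _ => rfl) rfl _ _ (Category.id_comp _).symm rfl
  · refine papp_congr _ _ (Category.assoc _ _ _).symm (fun g b h h' => ?_) rfl _ _ rfl rfl
    simp only [← Category.assoc]
    rw [Ty.mkExt_extMap, Ty.mkExt_extMap, Ty.mkExt_extMap]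
    congr 1
    exact Ty.mkExt_congr _ _ (Category.assoc _ _ _) rfl

theorem comp_app {Y Z : E} (k : Z ⟶ Y) (z : Y ⟶ U) (t : Y ⟶ T.total)
    (ht : t ≫ T.disp = z ≫ c.pi D.pfst D.psnd) (a : Y ⟶ T.total)
    (ha : a ≫ T.disp = z ≫ D.pfst) : k ≫ D.app z t ht a ha =
      D.app (k ≫ z) (k ≫ t) (by rw [Category.assoc, ht, Category.assoc]) (k ≫ a)
        (by rw [Category.assoc, ha, Category.assoc]) := by
  rw [app, comp_papp]
  refine Eq.trans ?_ (papp_eq_app z t ht k (k ≫ a) (by rw [Category.assoc, ha]))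
  exact papp_congr _ _ rfl (fun _ _ _ _ => rfl) rfl _ _ (Category.comp_id _) rfl

theorem app_ext {Y : E} (z : Y ⟶ U) {t t' : Y ⟶ T.total}
    (ht : t ≫ T.disp = z ≫ c.pi D.pfst D.psnd) (ht' : t' ≫ T.disp = z ≫ c.pi D.pfst D.psnd)
    (H : ∀ (Z : E) (k : Z ⟶ Y) (a : Z ⟶ T.total) (ha : a ≫ T.disp = (k ≫ z) ≫ D.pfst),
      D.app (k ≫ z) (k ≫ t) (by rw [Category.assoc, ht, Category.assoc]) a ha =
        D.app (k ≫ z) (k ≫ t') (by rw [Category.assoc, ht', Category.assoc]) a ha) : t = t' := by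
  refine papp_ext (z ≫ D.pfst) (T.extMap z D.pfst ≫ D.psnd) (by rw [ht, c.pi_comp])
    (by rw [ht', c.pi_comp]) fun Z k a ha => ?_
  rw [papp_eq_app z t ht, papp_eq_app z t' ht']
  exact H Z k a (by rw [ha, Category.assoc])

/-- Lambda abstraction for a natural family of values: the value at the generic argument is an
element over the comprehension, and naturality recovers all other values from it. -/
theorem exists_lam (D : Decode c) {Y : E} (z : Y ⟶ U)
    (b : ∀ {Z : E} (k : Z ⟶ Y) (a : Z ⟶ T.total), a ≫ T.disp = (k ≫ z) ≫ D.pfst → (Z ⟶ T.total))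
    (b_disp : ∀ {Z : E} (k : Z ⟶ Y) (a : Z ⟶ T.total) (ha : a ≫ T.disp = (k ≫ z) ≫ D.pfst),
      b k a ha ≫ T.disp = D.cod (k ≫ z) a ha)
    (comp_b : ∀ {Z Z' : E} (g : Z' ⟶ Z) (k : Z ⟶ Y) (a : Z ⟶ T.total)
      (ha : a ≫ T.disp = (k ≫ z) ≫ D.pfst) (ha' : (g ≫ a) ≫ T.disp = ((g ≫ k) ≫ z) ≫ D.pfst),
      g ≫ b k a ha = b (g ≫ k) (g ≫ a) ha') :
    ∃ (t : Y ⟶ T.total) (ht : t ≫ T.disp = z ≫ c.pi D.pfst D.psnd),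
      ∀ (Z : E) (k : Z ⟶ Y) (a : Z ⟶ T.total) (ha : a ≫ T.disp = (k ≫ z) ≫ D.pfst),
        D.app (k ≫ z) (k ≫ t) (by rw [Category.assoc, ht, Category.assoc]) a ha = b k a ha := by
  have h0 : T.tvar (z ≫ D.pfst) ≫ T.disp = (T.proj (z ≫ D.pfst) ≫ z) ≫ D.pfst := by
    rw [Ty.tvar_disp, Category.assoc]
  obtain ⟨t, ht, H⟩ := c.exists_plam (z ≫ D.pfst) (T.extMap z D.pfst ≫ D.psnd)
    (b (T.proj _) (T.tvar _) h0) (by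
      rw [b_disp, cod]
      congr 1
      exact Ty.ext_hom_ext (by simp [Ty.extMap_proj]) (by simp [Ty.extMap_tvar]))
  refine ⟨t, by rw [ht, c.pi_comp], fun Z k a ha => ?_⟩
  rw [← papp_eq_app z t (by rw [ht, c.pi_comp]) k a (by rw [ha, Category.assoc]), H,
    comp_b _ _ _ h0 (by rw [Ty.mkExt_tvar, Ty.mkExt_proj, ha])]
  congr 1
  · rw [Ty.mkExt_proj]
  · rw [Ty.mkExt_tvar]

end Decode

end Codes

/-! ### Functions on the positive cone -/

section Fn

variable {C C' Y Z : E}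

/-- The value at `i` of a function on the positive cone. -/
noncomputable def pt (p : Y ⊗ O.Pos ⟶ C) (i : Y ⟶ O.Pos) : Y ⟶ C := lift (𝟙 Y) i ≫ p

theorem comp_pt (k : Z ⟶ Y) (p : Y ⊗ O.Pos ⟶ C) (i : Y ⟶ O.Pos) :
    k ≫ pt p i = pt (k ▷ O.Pos ≫ p) (k ≫ i) := by
  simp [pt, comp_lift_assoc]

theorem pt_comp (p : Y ⊗ O.Pos ⟶ C) (i : Y ⟶ O.Pos) (g : C ⟶ C') :
    pt (p ≫ g) i = pt p i ≫ g := by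
  simp [pt]

theorem lift_comp_eq_pt (k : Z ⟶ Y) (i : Z ⟶ O.Pos) (p : Y ⊗ O.Pos ⟶ C) :
    lift k i ≫ p = pt (k ▷ O.Pos ≫ p) i := by
  simp [pt]

theorem pt_fst_snd (p : Y ⊗ O.Pos ⟶ C) : pt (fst Y O.Pos ▷ O.Pos ≫ p) (snd Y O.Pos) = p := by
  rw [← lift_comp_eq_pt]
  have : lift (fst Y O.Pos) (snd Y O.Pos) = 𝟙 _ := by ext <;> simp
  rw [this, Category.id_comp]

theorem pt_fst (x : Y ⟶ C) (i : Y ⟶ O.Pos) : pt (fst Y O.Pos ≫ x) i = x := by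
  simp [pt]

theorem whisker_comp (h : Z ⟶ Y) {W : E} (k : W ⟶ Z) (p : Y ⊗ O.Pos ⟶ C) :
    k ▷ O.Pos ≫ h ▷ O.Pos ≫ p = (k ≫ h) ▷ O.Pos ≫ p := by
  rw [comp_whiskerRight, Category.assoc]

theorem fn_ext {p q : Y ⊗ O.Pos ⟶ C}
    (H : ∀ (Z : E) (k : Z ⟶ Y) (i : Z ⟶ O.Pos), pt (k ▷ O.Pos ≫ p) i = pt (k ▷ O.Pos ≫ q) i) :
    p = q := by
  rw [← pt_fst_snd p, ← pt_fst_snd q, H]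

end Fn

/-! ### Local transport structures -/

/-- Transports in `T` along all intervals of all functions from the positive cone to `U` that start
at `x`. -/
@[ext]
structure LTap (O : RingOrder R) (T : Ty.{v, u} U) {X : E} (x : X ⟶ U) where
  /-- transport along `p` from `i` to `j` -/
  tr : ∀ {Y : E} (h : Y ⟶ X) (p : Y ⊗ O.Pos ⟶ U) (i _j : Y ⟶ O.Pos) (t : Y ⟶ T.total),
    pt p (O.zero Y) = h ≫ x → t ≫ T.disp = pt p i → (Y ⟶ T.total)
  tr_disp : ∀ {Y : E} (h : Y ⟶ X) (p : Y ⊗ O.Pos ⟶ U) (i j : Y ⟶ O.Pos) (t : Y ⟶ T.total)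
    (hp : pt p (O.zero Y) = h ≫ x) (ht : t ≫ T.disp = pt p i), tr h p i j t hp ht ≫ T.disp = pt p j
  comp_tr : ∀ {Y Z : E} (k : Z ⟶ Y) (h : Y ⟶ X) (p : Y ⊗ O.Pos ⟶ U) (i j : Y ⟶ O.Pos)
    (t : Y ⟶ T.total) (hp : pt p (O.zero Y) = h ≫ x) (ht : t ≫ T.disp = pt p i)
    (hp' : pt (k ▷ O.Pos ≫ p) (O.zero Z) = (k ≫ h) ≫ x)
    (ht' : (k ≫ t) ≫ T.disp = pt (k ▷ O.Pos ≫ p) (k ≫ i)),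
    k ≫ tr h p i j t hp ht = tr (k ≫ h) (k ▷ O.Pos ≫ p) (k ≫ i) (k ≫ j) (k ≫ t) hp' ht'
  tr_self : ∀ {Y : E} (h : Y ⟶ X) (p : Y ⊗ O.Pos ⟶ U) (i : Y ⟶ O.Pos) (t : Y ⟶ T.total)
    (hp : pt p (O.zero Y) = h ≫ x) (ht : t ≫ T.disp = pt p i), tr h p i i t hp ht = t

namespace LTap

theorem start_comp {X Y Z : E} (k : Z ⟶ Y) {x : X ⟶ U} {h : Y ⟶ X} {p : Y ⊗ O.Pos ⟶ U}
    (hp : pt p (O.zero Y) = h ≫ x) : pt (k ▷ O.Pos ≫ p) (O.zero Z) = (k ≫ h) ≫ x := by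
  rw [← O.comp_zero k, ← comp_pt, hp, Category.assoc]

theorem disp_comp {Y Z : E} (k : Z ⟶ Y) {p : Y ⊗ O.Pos ⟶ U} {i : Y ⟶ O.Pos} {t : Y ⟶ T.total}
    (ht : t ≫ T.disp = pt p i) : (k ≫ t) ≫ T.disp = pt (k ▷ O.Pos ≫ p) (k ≫ i) := by
  rw [Category.assoc, ht, comp_pt]

variable {X : E} {x : X ⟶ U}

theorem tr_congr (r : LTap O T x) {Y : E} {h h' : Y ⟶ X} {p p' : Y ⊗ O.Pos ⟶ U}
    {i i' j j' : Y ⟶ O.Pos} {t t' : Y ⟶ T.total} (hp : pt p (O.zero Y) = h ≫ x)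
    (ht : t ≫ T.disp = pt p i) (eh : h = h') (ep : p = p') (ei : i = i') (ej : j = j')
    (et : t = t') : r.tr h p i j t hp ht =
      r.tr h' p' i' j' t' (ep ▸ eh ▸ hp) (et ▸ ep ▸ ei ▸ ht) := by
  subst eh ep ei ej et
  rfl

theorem comp_tr' (r : LTap O T x) {Y Z : E} (k : Z ⟶ Y) (h : Y ⟶ X) (p : Y ⊗ O.Pos ⟶ U)
    (i j : Y ⟶ O.Pos) (t : Y ⟶ T.total) (hp : pt p (O.zero Y) = h ≫ x)
    (ht : t ≫ T.disp = pt p i) : k ≫ r.tr h p i j t hp ht = r.tr (k ≫ h) (k ▷ O.Pos ≫ p) (k ≫ i)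
      (k ≫ j) (k ≫ t) (start_comp k hp) (disp_comp k ht) := r.comp_tr _ _ _ _ _ _ _ _ _ _

/-- Change of stage. -/
def restr (r : LTap O T x) {X' : E} (h : X' ⟶ X) {x' : X' ⟶ U} (e : h ≫ x = x') :
    LTap O T x' where
  tr g p i j t hp ht := r.tr (g ≫ h) p i j t (by rw [hp, Category.assoc, e]) ht
  tr_disp _ _ _ _ _ _ _ := r.tr_disp _ _ _ _ _ _ _
  comp_tr k g p i j t hp ht hp' ht' := by
    rw [r.comp_tr']
    exact r.tr_congr _ _ (Category.assoc _ _ _).symm rfl rfl rfl rfl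
  tr_self g p i t hp ht := r.tr_self _ _ _ _ _ _

end LTap

/-! ### Local transport structures as internal dependent functions, and recursion into them. -/

/-- The object of quadruples of a function `p` to `U`, two elements `i`, `j` of the positive cone
and an element of the total object of `T`. -/
noncomputable abbrev TapData (O : RingOrder R) (T : Ty.{v, u} U) : E :=
  (ihom O.Pos).obj U ⊗ (O.Pos ⊗ (O.Pos ⊗ T.total))

namespace TapData

variable {Y Z : E}

/-- The quadruple with given components. -/
noncomputable def mk (p : Y ⊗ O.Pos ⟶ U) (i j : Y ⟶ O.Pos) (t : Y ⟶ T.total) : Y ⟶ TapData O T :=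
  lift (MonoidalClosed.curry (lift (snd O.Pos Y) (fst O.Pos Y) ≫ p)) (lift i (lift j t))

/-- The first component. -/
noncomputable def fn (d : Y ⟶ TapData O T) : Y ⊗ O.Pos ⟶ U :=
  lift (snd Y O.Pos) (fst Y O.Pos) ≫ MonoidalClosed.uncurry (d ≫ fst _ _)

/-- The second component. -/
noncomputable def src (d : Y ⟶ TapData O T) : Y ⟶ O.Pos := d ≫ snd _ _ ≫ fst _ _

/-- The third component. -/
noncomputable def tgt (d : Y ⟶ TapData O T) : Y ⟶ O.Pos := d ≫ snd _ _ ≫ snd _ _ ≫ fst _ _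

/-- The fourth component. -/
noncomputable def elt (d : Y ⟶ TapData O T) : Y ⟶ T.total := d ≫ snd _ _ ≫ snd _ _ ≫ snd _ _

theorem swap_swap (A B : E) : lift (snd A B) (fst A B) ≫ lift (snd B A) (fst B A) = 𝟙 _ := by
  ext <;> simp

theorem fn_mk (p : Y ⊗ O.Pos ⟶ U) (i j : Y ⟶ O.Pos) (t : Y ⟶ T.total) :
    fn (mk p i j t) = p := by
  rw [fn, mk, lift_fst, MonoidalClosed.uncurry_curry, ← Category.assoc, swap_swap,
    Category.id_comp]

theorem src_mk (p : Y ⊗ O.Pos ⟶ U) (i j : Y ⟶ O.Pos) (t : Y ⟶ T.total) :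
    src (mk p i j t) = i := by simp [src, mk]

theorem tgt_mk (p : Y ⊗ O.Pos ⟶ U) (i j : Y ⟶ O.Pos) (t : Y ⟶ T.total) :
    tgt (mk p i j t) = j := by simp [tgt, mk]

theorem elt_mk (p : Y ⊗ O.Pos ⟶ U) (i j : Y ⟶ O.Pos) (t : Y ⟶ T.total) :
    elt (mk p i j t) = t := by simp [elt, mk]

theorem mk_eta (d : Y ⟶ TapData O T) : mk (fn d) (src d) (tgt d) (elt d) = d := by
  unfold mk
  have : lift (snd O.Pos Y) (fst O.Pos Y) ≫ fn d = MonoidalClosed.uncurry (d ≫ fst _ _) := by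
    rw [fn, ← Category.assoc, swap_swap, Category.id_comp]
  rw [this, MonoidalClosed.curry_uncurry]
  ext <;> simp [src, tgt, elt]

theorem fn_comp (k : Z ⟶ Y) (d : Y ⟶ TapData O T) : fn (k ≫ d) = k ▷ O.Pos ≫ fn d := by
  unfold fn
  rw [Category.assoc, MonoidalClosed.uncurry_natural_left, ← Category.assoc, ← Category.assoc]
  congr 1
  ext <;> simp

theorem src_comp (k : Z ⟶ Y) (d : Y ⟶ TapData O T) : src (k ≫ d) = k ≫ src d := by simp [src]

theorem tgt_comp (k : Z ⟶ Y) (d : Y ⟶ TapData O T) : tgt (k ≫ d) = k ≫ tgt d := by simp [tgt]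

theorem elt_comp (k : Z ⟶ Y) (d : Y ⟶ TapData O T) : elt (k ≫ d) = k ≫ elt d := by simp [elt]

theorem comp_mk (k : Z ⟶ Y) (p : Y ⊗ O.Pos ⟶ U) (i j : Y ⟶ O.Pos) (t : Y ⟶ T.total) :
    k ≫ mk p i j t = mk (k ▷ O.Pos ≫ p) (k ≫ i) (k ≫ j) (k ≫ t) := by
  rw [← mk_eta (k ≫ mk p i j t), fn_comp, src_comp, tgt_comp, elt_comp, fn_mk, src_mk, tgt_mk,
    elt_mk]

end TapData

namespace LTap

/-- Local transport structures as dependent functions. -/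
theorem exists_dom_cod (O : RingOrder R) (T : Ty.{v, u} U) :
    ∃ (dom : Subobject (U ⊗ TapData O T)) (cod : Subobject (TapData O T ⊗ T.total)),
      (∀ {Y : E} (x : Y ⟶ U) (d : Y ⟶ TapData O T), dom.Factors (lift x d) ↔
        pt (TapData.fn d) (O.zero Y) = x ∧
          TapData.elt d ≫ T.disp = pt (TapData.fn d) (TapData.src d)) ∧
      (∀ {Y : E} (d : Y ⟶ TapData O T) (z : Y ⟶ T.total), cod.Factors (lift d z) ↔
        z ≫ T.disp = pt (TapData.fn d) (TapData.tgt d) ∧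
          ∀ (Z : E) (h : Z ⟶ Y), h ≫ TapData.src d = h ≫ TapData.tgt d →
            h ≫ z = h ≫ TapData.elt d) := by
  have h1 := (Rep.eq (pt (TapData.fn (snd U (TapData O T))) (O.zero _)) (fst U (TapData O T))).and
    (Rep.eq (TapData.elt (snd U (TapData O T)) ≫ T.disp)
      (pt (TapData.fn (snd U (TapData O T))) (TapData.src (snd U (TapData O T)))))
  -- Besides lying over `p j`, a value must equal the given element wherever `i` and `j` agree.
  -- Placing this law in the codomain makes `tr_self` part of the dependent function set.
  have h2 := (Rep.eq (snd (TapData O T) T.total ≫ T.disp)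
    (pt (TapData.fn (fst (TapData O T) T.total)) (TapData.tgt (fst (TapData O T) T.total)))).and
    (Rep.imp (Rep.eq (TapData.src (fst (TapData O T) T.total))
      (TapData.tgt (fst (TapData O T) T.total)))
      (Rep.eq (snd (TapData O T) T.total) (TapData.elt (fst (TapData O T) T.total))))
  obtain ⟨dom, hdom⟩ := h1
  obtain ⟨cod, hcod⟩ := h2
  refine ⟨dom, cod, fun {Y} x d => ?_, fun {Y} d z => ?_⟩
  · rw [hdom]
    simp only [comp_pt, ← TapData.fn_comp, ← TapData.src_comp, ← Category.assoc,
      ← TapData.elt_comp, lift_snd, lift_fst, O.comp_zero]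
  · rw [hcod]
    simp only [comp_pt, ← TapData.fn_comp, ← TapData.src_comp, ← TapData.tgt_comp,
      ← TapData.elt_comp, Category.assoc, lift_snd, lift_fst, lift_snd_assoc]

end LTap

/-- Recursion into local transport structures. -/
theorem Codes.IsInductiveRecursive.exists_lTap {c : Codes O 𝔹 T} (hIR : c.IsInductiveRecursive)
    (mb : LTap O T c.bool)
    (mp : ∀ {Γ : E} (u : Γ ⟶ U) (f : T.ext u ⟶ U), LTap O T u → LTap O T f → LTap O T (c.pi u f))
    (hmp : ∀ {Γ Δ : E} (h : Δ ⟶ Γ) (u : Γ ⟶ U) (f : T.ext u ⟶ U) (r : LTap O T u)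
      (s : LTap O T f), (mp u f r s).restr h (c.pi_comp h u f) =
        mp (h ≫ u) (T.extMap h u ≫ f) (r.restr h rfl) (s.restr (T.extMap h u) rfl))
    (me : ∀ {Γ : E} (u : Γ ⟶ U) (a b : T.El u), LTap O T u → LTap O T (c.eq u a b))
    (hme : ∀ {Γ Δ : E} (h : Δ ⟶ Γ) (u : Γ ⟶ U) (a b : T.El u) (r : LTap O T u),
      (me u a b r).restr h (c.eq_comp h u a b) =
        me (h ≫ u) (T.restr h rfl a) (T.restr h rfl b) (r.restr h rfl)) :
    ∃ s : LTap O T (𝟙 U), s.restr c.bool (Category.comp_id _) = mb ∧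
      (∀ {Γ : E} (u : Γ ⟶ U) (f : T.ext u ⟶ U), s.restr (c.pi u f) (Category.comp_id _) =
        mp u f (s.restr u (Category.comp_id _)) (s.restr f (Category.comp_id _))) ∧
      (∀ {Γ : E} (u : Γ ⟶ U) (a b : T.El u), s.restr (c.eq u a b) (Category.comp_id _) =
        me u a b (s.restr u (Category.comp_id _))) := by
  obtain ⟨dom, cod, hdom, hcod⟩ := LTap.exists_dom_cod O T
  let enc : ∀ {X : E} {x : X ⟶ U}, LTap O T x → FunFam dom cod x := fun {X} {x} r =>
    { app := fun h d hd => r.tr h (TapData.fn d) (TapData.src d) (TapData.tgt d) (TapData.elt d)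
        ((hdom _ _).1 hd).1 ((hdom _ _).1 hd).2
      comp_app := fun k h d hd hd' => by
        rw [r.comp_tr']
        exact r.tr_congr _ _ rfl (TapData.fn_comp _ _).symm (TapData.src_comp _ _).symm
          (TapData.tgt_comp _ _).symm (TapData.elt_comp _ _).symm
      cod_app := fun h d hd => by
        refine (hcod _ _).2 ⟨r.tr_disp _ _ _ _ _ _ _, fun Z k e => ?_⟩
        rw [r.comp_tr']
        refine Eq.trans (r.tr_congr _ _ rfl rfl rfl e.symm rfl) (r.tr_self _ _ _ _ _ _) }
  let dec : ∀ {X : E} {x : X ⟶ U}, FunFam dom cod x → LTap O T x := fun {X} {x} F =>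
    { tr := fun h p i j t hp ht => F.app h (TapData.mk p i j t) ((hdom _ _).2 (by
        rw [TapData.fn_mk, TapData.src_mk, TapData.elt_mk]
        exact ⟨hp, ht⟩))
      tr_disp := fun h p i j t hp ht => by
        refine ((hcod _ _).1 (F.cod_app _ _ _)).1.trans ?_
        rw [TapData.fn_mk, TapData.tgt_mk]
      comp_tr := fun k h p i j t hp ht hp' ht' => by
        refine (F.comp_app k h _ _ ?_).trans (F.app_congr _ rfl (TapData.comp_mk _ _ _ _ _))
        rw [TapData.comp_mk, hdom, TapData.fn_mk, TapData.src_mk, TapData.elt_mk]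
        exact ⟨hp', ht'⟩
      tr_self := fun h p i t hp ht => by
        have := ((hcod _ _).1 (F.cod_app h (TapData.mk p i i t) ((hdom _ _).2 (by
          rw [TapData.fn_mk, TapData.src_mk, TapData.elt_mk]
          exact ⟨hp, ht⟩)))).2 _ (𝟙 _) (by rw [TapData.src_mk, TapData.tgt_mk])
        rw [Category.id_comp, Category.id_comp] at this
        exact this.trans (TapData.elt_mk _ _ _ _) }
  -- Only this composite is needed: it removes the coding from the computation rules, while the
  -- recursion itself takes place among dependent functions.
  have dec_enc : ∀ {X : E} {x : X ⟶ U} (r : LTap O T x), dec (enc r) = r := by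
    intro X x r
    refine LTap.ext ?_
    funext Y h p i j t hp ht
    exact r.tr_congr _ _ rfl (TapData.fn_mk _ _ _ _) (TapData.src_mk _ _ _ _)
      (TapData.tgt_mk _ _ _ _) (TapData.elt_mk _ _ _ _)
  have enc_restr : ∀ {X X' : E} {x : X ⟶ U} (r : LTap O T x) (h : X' ⟶ X) {x' : X' ⟶ U}
      (e : h ≫ x = x'), enc (r.restr h e) = (enc r).restr h e := fun _ _ _ _ => rfl
  have dec_restr : ∀ {X X' : E} {x : X ⟶ U} (r : FunFam dom cod x) (h : X' ⟶ X) {x' : X' ⟶ U}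
      (e : h ≫ x = x'), dec (r.restr h e) = (dec r).restr h e := fun _ _ _ _ => rfl
  obtain ⟨s, h1, h2, h3⟩ := hIR.exists_funFam dom cod (enc mb)
    (fun u f r s => enc (mp u f (dec r) (dec s)))
    (fun h u f r s => by rw [← enc_restr, hmp, dec_restr, dec_restr])
    (fun u a b r => enc (me u a b (dec r)))
    (fun h u a b r => by rw [← enc_restr, hme, dec_restr])
  refine ⟨dec s, ?_, fun u f => ?_, fun u a b => ?_⟩
  · rw [← dec_restr, h1, dec_enc]
  · rw [← dec_restr, h2, dec_enc, dec_restr, dec_restr]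
  · rw [← dec_restr, h3, dec_enc, dec_restr]

/-! ### Transport in the Booleans and in dependent products -/

namespace LTap

variable {X Y Z : E} {x : X ⟶ U}

/-- The curve `m ↦ tr j m a` over `p`. -/
noncomputable def curve (r : LTap O T x) (h : Y ⟶ X) (p : Y ⊗ O.Pos ⟶ U) (j : Y ⟶ O.Pos)
    (a : Y ⟶ T.total) (hp : pt p (O.zero Y) = h ≫ x) (ha : a ≫ T.disp = pt p j) :
    Y ⊗ O.Pos ⟶ T.total :=
  r.tr (fst _ _ ≫ h) (fst _ _ ▷ O.Pos ≫ p) (fst _ _ ≫ j) (snd _ _) (fst _ _ ≫ a)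
    (start_comp _ hp) (disp_comp _ ha)

variable (r : LTap O T x) (h : Y ⟶ X) (p : Y ⊗ O.Pos ⟶ U) (i j : Y ⟶ O.Pos)
    (a : Y ⟶ T.total) (hp : pt p (O.zero Y) = h ≫ x) (ha : a ≫ T.disp = pt p j)

theorem curve_disp : r.curve h p j a hp ha ≫ T.disp = p := by
  rw [curve, r.tr_disp, pt_fst_snd]

theorem pt_curve (m : Y ⟶ O.Pos) : pt (r.curve h p j a hp ha) m = r.tr h p j m a hp ha := by
  rw [curve, pt, r.comp_tr']
  exact r.tr_congr _ _ (by rw [lift_fst_assoc, Category.id_comp])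
    (by rw [whisker_comp, lift_fst, id_whiskerRight, Category.id_comp])
    (by rw [lift_fst_assoc, Category.id_comp]) (lift_snd _ _)
    (by rw [lift_fst_assoc, Category.id_comp])

theorem comp_curve (k : Z ⟶ Y) : k ▷ O.Pos ≫ r.curve h p j a hp ha =
    r.curve (k ≫ h) (k ▷ O.Pos ≫ p) (k ≫ j) (k ≫ a) (start_comp k hp) (disp_comp k ha) := by
  rw [curve, r.comp_tr']
  exact r.tr_congr _ _ (by rw [whiskerRight_fst_assoc])
    (by rw [whisker_comp, whiskerRight_fst, ← whisker_comp])
    (by rw [whiskerRight_fst_assoc]) (whiskerRight_snd _ _) (by rw [whiskerRight_fst_assoc])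

theorem curve_congr {h' : Y ⟶ X} {p' : Y ⊗ O.Pos ⟶ U} {j' : Y ⟶ O.Pos}
    {a' : Y ⟶ T.total} (eh : h = h') (ep : p = p') (ej : j = j') (ea : a = a') :
    r.curve h p j a hp ha = r.curve h' p' j' a' (ep ▸ eh ▸ hp) (ea ▸ ep ▸ ej ▸ ha) := by
  subst eh ep ej ea
  rfl

end LTap

namespace Codes

variable {c : Codes O 𝔹 T}

namespace Decode

variable (D : Decode c)

/-- Transport in the Booleans. -/
def boolTap : LTap O T c.bool where
  tr _ _ _ _ t _ _ := t
  tr_disp h p i j t hp ht := by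
    -- A function starting at `bool` is constantly `bool`, so all its fibres coincide and an element
    -- can stay where it is.
    have := D.path_bool p _ (hp.trans (congrArg (· ≫ c.bool) (toUnit_unique _ _)))
    rw [ht, this, pt, pt, ← Category.assoc, ← Category.assoc, comp_toUnit, comp_toUnit]
  comp_tr _ _ _ _ _ _ _ _ _ _ := rfl
  tr_self _ _ _ _ _ _ := rfl

section Pi

variable {Γ Y Z : E} {u : Γ ⟶ U} {f : T.ext u ⟶ U} (r : LTap O T u) (s : LTap O T f)

variable {D} in
theorem start_pfst {h : Y ⟶ Γ} {p : Y ⊗ O.Pos ⟶ U} (hp : pt p (O.zero Y) = h ≫ c.pi u f) :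
    pt (p ≫ D.pfst) (O.zero Y) = h ≫ u := by
  rw [pt_comp, hp, Category.assoc, D.pi_pfst]

theorem pt_pi {h : Y ⟶ Γ} {p : Y ⊗ O.Pos ⟶ U} (hp : pt p (O.zero Y) = h ≫ c.pi u f)
    (i : Y ⟶ O.Pos) : pt p i = pt p i ≫ c.pi D.pfst D.psnd := by
  rw [← pt_comp, D.path_pi u f h p _ hp]

/-- The function `m ↦ cod (p m) (tr j m a)`. -/
noncomputable def piFn (h : Y ⟶ Γ) (p : Y ⊗ O.Pos ⟶ U) (j : Y ⟶ O.Pos) (a : Y ⟶ T.total)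
    (hp : pt (p ≫ D.pfst) (O.zero Y) = h ≫ u) (ha : a ≫ T.disp = pt (p ≫ D.pfst) j) :
    Y ⊗ O.Pos ⟶ U :=
  D.cod p (r.curve h (p ≫ D.pfst) j a hp ha) (r.curve_disp _ _ _ _ _ _)

theorem pt_piFn (h : Y ⟶ Γ) (p : Y ⊗ O.Pos ⟶ U) (j : Y ⟶ O.Pos) (a : Y ⟶ T.total)
    (hp : pt (p ≫ D.pfst) (O.zero Y) = h ≫ u) (ha : a ≫ T.disp = pt (p ≫ D.pfst) j)
    (m : Y ⟶ O.Pos) : pt (D.piFn r h p j a hp ha) m =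
      D.cod (pt p m) (r.tr h (p ≫ D.pfst) j m a hp ha) (by rw [r.tr_disp, pt_comp]) := by
  rw [piFn, pt, comp_cod]
  exact cod_congr _ rfl (r.pt_curve _ _ _ _ _ _ _)

theorem comp_piFn (k : Z ⟶ Y) (h : Y ⟶ Γ) (p : Y ⊗ O.Pos ⟶ U) (j : Y ⟶ O.Pos) (a : Y ⟶ T.total)
    (hp : pt (p ≫ D.pfst) (O.zero Y) = h ≫ u) (ha : a ≫ T.disp = pt (p ≫ D.pfst) j)
    (hp' : pt ((k ▷ O.Pos ≫ p) ≫ D.pfst) (O.zero Z) = (k ≫ h) ≫ u)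
    (ha' : (k ≫ a) ≫ T.disp = pt ((k ▷ O.Pos ≫ p) ≫ D.pfst) (k ≫ j)) :
    k ▷ O.Pos ≫ D.piFn r h p j a hp ha =
      D.piFn r (k ≫ h) (k ▷ O.Pos ≫ p) (k ≫ j) (k ≫ a) hp' ha' := by
  rw [piFn, comp_cod]
  refine cod_congr _ rfl ((r.comp_curve _ _ _ _ _ _ _).trans ?_)
  exact r.curve_congr _ _ _ _ _ _ rfl (Category.assoc _ _ _).symm rfl rfl

/-- At argument `0` the code is `pi u f` itself, so the function of codomains starts at a value of
`f`. This is what brings it within reach of the recursive hypothesis for `f`. -/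
theorem piFn_start (h : Y ⟶ Γ) (p : Y ⊗ O.Pos ⟶ U) (j : Y ⟶ O.Pos) (a : Y ⟶ T.total)
    (hp : pt p (O.zero Y) = h ≫ c.pi u f) (ha : a ≫ T.disp = pt (p ≫ D.pfst) j) :
    pt (D.piFn r h p j a (start_pfst hp) ha) (O.zero Y) =
      T.mkExt u h (r.tr h (p ≫ D.pfst) j (O.zero Y) a (start_pfst hp) ha)
        ((r.tr_disp _ _ _ _ _ _ _).trans (start_pfst hp)) ≫ f := by
  rw [pt_piFn]
  refine (cod_congr _ hp rfl).trans ?_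
  exact D.pi_psnd u f h _ _ _

/-- The value at `a` of the transport of `t` in dependent products. -/
noncomputable def piVal (h : Y ⟶ Γ) (p : Y ⊗ O.Pos ⟶ U) (i j : Y ⟶ O.Pos) (t a : Y ⟶ T.total)
    (hp : pt p (O.zero Y) = h ≫ c.pi u f) (ht : t ≫ T.disp = pt p i)
    (ha : a ≫ T.disp = pt (p ≫ D.pfst) j) : Y ⟶ T.total :=
  s.tr (T.mkExt u h (r.tr h (p ≫ D.pfst) j (O.zero Y) a (start_pfst hp) ha)
      ((r.tr_disp _ _ _ _ _ _ _).trans (start_pfst hp)))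
    (D.piFn r h p j a (start_pfst hp) ha) i j
    (D.app (pt p i) t (ht.trans (D.pt_pi hp i))
      (r.tr h (p ≫ D.pfst) j i a (start_pfst hp) ha) (by rw [r.tr_disp, pt_comp]))
    (D.piFn_start r h p j a hp ha) (by rw [app_disp, pt_piFn])

/-- The transported value lies over the codomain at `tr j j a`. Only the law `tr_self` of the
recursive hypothesis turns this into the codomain at `a`, so the law cannot be postponed until after
the recursion. -/
theorem piVal_disp (h : Y ⟶ Γ) (p : Y ⊗ O.Pos ⟶ U) (i j : Y ⟶ O.Pos) (t a : Y ⟶ T.total)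
    (hp : pt p (O.zero Y) = h ≫ c.pi u f) (ht : t ≫ T.disp = pt p i)
    (ha : a ≫ T.disp = pt (p ≫ D.pfst) j) : D.piVal r s h p i j t a hp ht ha ≫ T.disp =
      D.cod (pt p j) a (by rw [ha, pt_comp]) := by
  rw [piVal, s.tr_disp, pt_piFn]
  exact cod_congr _ rfl (r.tr_self _ _ _ _ _ _)

theorem piVal_self (h : Y ⟶ Γ) (p : Y ⊗ O.Pos ⟶ U) (i : Y ⟶ O.Pos) (t a : Y ⟶ T.total)
    (hp : pt p (O.zero Y) = h ≫ c.pi u f) (ht : t ≫ T.disp = pt p i)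
    (ha : a ≫ T.disp = pt (p ≫ D.pfst) i) : D.piVal r s h p i i t a hp ht ha =
      D.app (pt p i) t (ht.trans (D.pt_pi hp i)) a (by rw [ha, pt_comp]) := by
  rw [piVal, s.tr_self]
  exact app_congr _ _ rfl rfl (r.tr_self _ _ _ _ _ _)

theorem piVal_congr {h h' : Y ⟶ Γ} {p p' : Y ⊗ O.Pos ⟶ U} {i i' j j' : Y ⟶ O.Pos}
    {t t' a a' : Y ⟶ T.total}
    (hp : pt p (O.zero Y) = h ≫ c.pi u f) (ht : t ≫ T.disp = pt p i)
    (ha : a ≫ T.disp = pt (p ≫ D.pfst) j) (eh : h = h') (ep : p = p') (ei : i = i') (ej : j = j')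
    (et : t = t') (ea : a = a') : D.piVal r s h p i j t a hp ht ha =
      D.piVal r s h' p' i' j' t' a' (ep ▸ eh ▸ hp) (et ▸ ep ▸ ei ▸ ht) (ea ▸ ep ▸ ej ▸ ha) := by
  subst eh ep ei ej et ea
  rfl

theorem comp_piVal (k : Z ⟶ Y) (h : Y ⟶ Γ) (p : Y ⊗ O.Pos ⟶ U) (i j : Y ⟶ O.Pos)
    (t a : Y ⟶ T.total)
    (hp : pt p (O.zero Y) = h ≫ c.pi u f) (ht : t ≫ T.disp = pt p i)
    (ha : a ≫ T.disp = pt (p ≫ D.pfst) j)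
    (ha' : (k ≫ a) ≫ T.disp = pt ((k ▷ O.Pos ≫ p) ≫ D.pfst) (k ≫ j)) :
    k ≫ D.piVal r s h p i j t a hp ht ha =
      D.piVal r s (k ≫ h) (k ▷ O.Pos ≫ p) (k ≫ i) (k ≫ j) (k ≫ t) (k ≫ a) (LTap.start_comp k hp)
        (LTap.disp_comp k ht) ha' := by
  have hr : ∀ m : Y ⟶ O.Pos, ∀ m', k ≫ m = m' →
      k ≫ r.tr h (p ≫ D.pfst) j m a (start_pfst hp) ha =
      r.tr (k ≫ h) ((k ▷ O.Pos ≫ p) ≫ D.pfst) (k ≫ j) m' (k ≫ a)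
        (start_pfst (LTap.start_comp k hp)) ha' := fun m m' e => by
    rw [r.comp_tr']
    exact r.tr_congr _ _ rfl (Category.assoc _ _ _).symm rfl e rfl
  rw [piVal, s.comp_tr', piVal]
  refine s.tr_congr _ _ ?_ (D.comp_piFn r k h p j a _ ha _ ha') rfl rfl ?_
  · rw [Ty.comp_mkExt]
    exact Ty.mkExt_congr _ _ rfl (hr _ _ (O.comp_zero k))
  · rw [comp_app]
    exact app_congr _ _ (comp_pt _ _ _) rfl (hr _ _ rfl)

theorem pt_pfst (p : Y ⊗ O.Pos ⟶ U) (k : Z ⟶ Y) (j : Y ⟶ O.Pos) :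
    (k ≫ pt p j) ≫ D.pfst = pt ((k ▷ O.Pos ≫ p) ≫ D.pfst) (k ≫ j) := by
  rw [comp_pt]
  exact (pt_comp _ _ _).symm

theorem exists_piTr (h : Y ⟶ Γ) (p : Y ⊗ O.Pos ⟶ U) (i j : Y ⟶ O.Pos) (t : Y ⟶ T.total)
    (hp : pt p (O.zero Y) = h ≫ c.pi u f) (ht : t ≫ T.disp = pt p i) :
    ∃ (t' : Y ⟶ T.total) (ht' : t' ≫ T.disp = pt p j),
      ∀ (Z : E) (k : Z ⟶ Y) (a : Z ⟶ T.total) (ha : a ≫ T.disp = (k ≫ pt p j) ≫ D.pfst),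
        D.app (k ≫ pt p j) (k ≫ t') (by rw [Category.assoc, ht', Category.assoc, ← D.pt_pi hp]) a
          ha = D.piVal r s (k ≫ h) (k ▷ O.Pos ≫ p) (k ≫ i) (k ≫ j) (k ≫ t) a
            (LTap.start_comp k hp) (LTap.disp_comp k ht) (ha.trans (D.pt_pfst p k j)) := by
  obtain ⟨t', ht', H⟩ := D.exists_lam (pt p j) (fun k a ha =>
    D.piVal r s (k ≫ h) (k ▷ O.Pos ≫ p) (k ≫ i) (k ≫ j) (k ≫ t) a
      (LTap.start_comp k hp) (LTap.disp_comp k ht) (ha.trans (D.pt_pfst p k j)))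
    (fun k a ha => by
      rw [piVal_disp]
      exact cod_congr _ (comp_pt _ _ _).symm rfl)
    (fun g k a ha ha' => by
      rw [D.comp_piVal r s g _ _ _ _ _ _ _ _ _ (ha'.trans ((D.pt_pfst p (g ≫ k) j).trans (by
        rw [whisker_comp, Category.assoc g k j])))]
      exact D.piVal_congr _ _ _ _ _ (Category.assoc _ _ _).symm (whisker_comp _ _ _)
        (Category.assoc _ _ _).symm (Category.assoc _ _ _).symm (Category.assoc _ _ _).symm rfl)
  exact ⟨t', ht'.trans (D.pt_pi hp j).symm, H⟩

/-- Transport in dependent products. -/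
noncomputable def piTap : LTap O T (c.pi u f) where
  tr h p i j t hp ht := (D.exists_piTr r s h p i j t hp ht).choose
  tr_disp h p i j t hp ht := (D.exists_piTr r s h p i j t hp ht).choose_spec.choose
  comp_tr k h p i j t hp ht hp' ht' := by
    have H1 := (D.exists_piTr r s h p i j t hp ht).choose_spec
    have H2 := (D.exists_piTr r s _ _ _ (k ≫ j) _ hp' ht').choose_spec
    have e : pt (k ▷ O.Pos ≫ p) (k ≫ j) = k ≫ pt p j := (comp_pt _ _ _).symm
    -- The elements at the two stages are chosen independently; they agree because an element of a
    -- product is determined by its applications.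
    refine D.app_ext (k ≫ pt p j) ?_ ?_ fun Z g a ha => ?_
    · rw [Category.assoc, H1.choose, Category.assoc, ← D.pt_pi hp]
    · rw [H2.choose, e, Category.assoc, ← D.pt_pi hp]
    refine Eq.trans ?_ ((H1.choose_spec Z (g ≫ k) a (by rw [ha]; simp)).trans
      (Eq.trans ?_ ((H2.choose_spec Z g a (by rw [ha, e])).symm.trans ?_)))
    · exact app_congr _ _ (Category.assoc _ _ _).symm (Category.assoc _ _ _).symm rfl
    · exact D.piVal_congr _ _ _ _ _ (Category.assoc _ _ _) (whisker_comp _ _ _).symm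
        (Category.assoc _ _ _) (Category.assoc _ _ _) (Category.assoc _ _ _) rfl
    · exact app_congr _ _ (by rw [e]) rfl rfl
  tr_self h p i t hp ht := by
    have H1 := (D.exists_piTr r s h p i i t hp ht).choose_spec
    refine D.app_ext (pt p i) ?_ ?_ fun Z g a ha => ?_
    · rw [H1.choose, ← D.pt_pi hp]
    · rw [ht, ← D.pt_pi hp]
    refine (H1.choose_spec Z g a ha).trans ((D.piVal_self _ _ _ _ _ _ _ _ _ _).trans ?_)
    exact app_congr _ _ (comp_pt _ _ _).symm rfl rfl

theorem app_piTap (h : Y ⟶ Γ) (p : Y ⊗ O.Pos ⟶ U) (i j : Y ⟶ O.Pos) (t : Y ⟶ T.total)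
    (hp : pt p (O.zero Y) = h ≫ c.pi u f) (ht : t ≫ T.disp = pt p i) (a : Y ⟶ T.total)
    (ha : a ≫ T.disp = pt p j ≫ D.pfst) :
    D.app (pt p j) ((D.piTap r s).tr h p i j t hp ht)
      (((D.piTap r s).tr_disp _ _ _ _ _ _ _).trans (D.pt_pi hp j)) a ha =
        D.piVal r s h p i j t a hp ht (by rw [ha, pt_comp]) := by
  have H := (D.exists_piTr r s h p i j t hp ht).choose_spec.choose_spec Y (𝟙 Y) a
    (by rw [ha, Category.id_comp])
  refine Eq.trans ?_ (H.trans ?_)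
  · exact app_congr _ _ (Category.id_comp _).symm (Category.id_comp _).symm rfl
  · exact D.piVal_congr _ _ _ _ _ (Category.id_comp _)
      (by rw [id_whiskerRight, Category.id_comp]) (Category.id_comp _) (Category.id_comp _)
      (Category.id_comp _) rfl

/-- Naturality of the recursion method. Choice is harmless, since both sides have the same
applications and these determine them. -/
theorem piTap_restr {Δ : E} (g : Δ ⟶ Γ) : (D.piTap r s).restr g (c.pi_comp g u f) =
    D.piTap (r.restr g rfl) (s.restr (T.extMap g u) rfl) := by
  refine LTap.ext ?_
  funext Y h p i j t hp ht
  have H1 := (D.exists_piTr r s (h ≫ g) p i j t (by rw [hp, ← c.pi_comp, Category.assoc])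
    ht).choose_spec
  have H2 := (D.exists_piTr (r.restr g rfl) (s.restr (T.extMap g u) rfl) h p i j t hp
    ht).choose_spec
  refine D.app_ext (pt p j) (H1.choose.trans (D.pt_pi hp j)) (H2.choose.trans (D.pt_pi hp j))
    fun Z k a ha => ?_
  refine (H1.choose_spec Z k a ha).trans (Eq.trans ?_ (H2.choose_spec Z k a ha).symm)
  refine (D.piVal_congr r s _ _ _ (Category.assoc _ _ _).symm rfl rfl rfl rfl rfl).trans ?_
  unfold piVal
  change s.tr _ _ _ _ _ _ _ = s.tr (_ ≫ T.extMap g u) _ _ _ _ _ _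
  refine s.tr_congr _ _ (Ty.mkExt_extMap _ _ _ _ _).symm ?_ rfl rfl rfl
  exact cod_congr _ rfl (r.tr_congr _ _ (Category.assoc _ _ _).symm rfl rfl rfl rfl)

end Pi

end Decode

end Codes

/-! ### Reversal and concatenation of functions on the positive cone -/

section Concat

variable {C C' Y Z : E}

theorem lift_comp (k : Z ⟶ Y) (j : Y ⟶ O.Pos) (g : Y ⊗ O.Pos ⟶ C) :
    lift k (k ≫ j) ≫ g = k ≫ pt g j := by
  rw [pt, ← Category.assoc, comp_lift, Category.comp_id]

/-- Two functions on the positive cone that agree below and above `l` are equal. -/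
theorem fn_ext_le (l : Y ⟶ O.Pos) {g g' : Y ⊗ O.Pos ⟶ C}
    (h1 : ∀ (Z : E) (k : Z ⟶ Y) (j : Z ⟶ O.Pos), O.Le j (k ≫ l) → lift k j ≫ g = lift k j ≫ g')
    (h2 : ∀ (Z : E) (k : Z ⟶ Y) (j : Z ⟶ O.Pos), O.Le (k ≫ l) j → lift k j ≫ g = lift k j ≫ g') :
    g = g' := by
  have eta : ∀ {Z : E} (h : Z ⟶ Y ⊗ O.Pos), lift (h ≫ fst _ _) (h ≫ snd _ _) = h := fun h => by
    ext <;> simp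
  refine RingOrder.hom_ext_le (snd Y O.Pos) (fst Y O.Pos ≫ l) (fun Z h hh => ?_) (fun Z h hh => ?_)
  · rw [← eta h]
    exact h1 _ _ _ (by rwa [Category.assoc])
  · rw [← eta h]
    exact h2 _ _ _ (by rwa [Category.assoc])

/-- The function `g` is constant with value `e` from `l` on. -/
def Ends (g : Y ⊗ O.Pos ⟶ C) (l : Y ⟶ O.Pos) (e : Y ⟶ C) : Prop :=
  ∀ (Z : E) (k : Z ⟶ Y) (j : Z ⟶ O.Pos), O.Le (k ≫ l) j → lift k j ≫ g = k ≫ e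

theorem Ends.pt_eq {g : Y ⊗ O.Pos ⟶ C} {l : Y ⟶ O.Pos} {e : Y ⟶ C} (h : Ends g l e) :
    pt g l = e := by
  have := h _ (𝟙 Y) l (RingOrder.Le.of_eq (Category.id_comp l))
  rwa [Category.id_comp] at this

theorem Ends.eq_const {g : Y ⊗ O.Pos ⟶ C} {l : Y ⟶ O.Pos} {e : Y ⟶ C} (h : Ends g l e)
    (hl : l = O.zero Y) : g = fst _ _ ≫ e := by
  have := h _ (fst _ _) (snd _ _) (by
    rw [hl, O.comp_zero]
    exact RingOrder.zero_le _)
  rwa [show lift (fst Y O.Pos) (snd Y O.Pos) = 𝟙 _ by ext <;> simp, Category.id_comp] at this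

/-- Reversal of a function on the positive cone at `l`. -/
noncomputable def flip (g : Y ⊗ O.Pos ⟶ C) (l : Y ⟶ O.Pos) : Y ⊗ O.Pos ⟶ C :=
  lift (fst _ _) (O.monus (fst _ _ ≫ l) (snd _ _)) ≫ g

theorem lift_flip (g : Y ⊗ O.Pos ⟶ C) (l : Y ⟶ O.Pos) (k : Z ⟶ Y) (j : Z ⟶ O.Pos) :
    lift k j ≫ flip g l = lift k (O.monus (k ≫ l) j) ≫ g := by
  rw [flip, ← Category.assoc, comp_lift, O.comp_monus, lift_fst, lift_snd, lift_fst_assoc]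

theorem comp_flip (k : Z ⟶ Y) (g : Y ⊗ O.Pos ⟶ C) (l : Y ⟶ O.Pos) :
    k ▷ O.Pos ≫ flip g l = flip (k ▷ O.Pos ≫ g) (k ≫ l) := by
  rw [flip, flip, ← Category.assoc, comp_lift, O.comp_monus, whiskerRight_fst, whiskerRight_snd,
    whiskerRight_fst_assoc, ← Category.assoc (lift _ _), lift_whiskerRight]

theorem flip_comp (g : Y ⊗ O.Pos ⟶ C) (l : Y ⟶ O.Pos) (γ : C ⟶ C') :
    flip g l ≫ γ = flip (g ≫ γ) l := Category.assoc _ _ _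

theorem flip_const (e : Y ⟶ C) (l : Y ⟶ O.Pos) : flip (fst _ _ ≫ e) l = fst _ _ ≫ e :=
  lift_fst_assoc _ _ _

theorem pt_flip_zero (g : Y ⊗ O.Pos ⟶ C) (l : Y ⟶ O.Pos) :
    pt (flip g l) (O.zero Y) = pt g l := by
  rw [pt, lift_flip, Category.id_comp, RingOrder.monus_zero, pt]

theorem flip_ends (g : Y ⊗ O.Pos ⟶ C) (l : Y ⟶ O.Pos) : Ends (flip g l) l (pt g (O.zero Y)) := by
  intro Z k j hj
  rw [lift_flip, RingOrder.monus_eq_zero hj, ← O.comp_zero k, lift_comp]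

/-- The function `g` follows `g₁` up to `l` and then follows `g₂`. -/
def IsConcat (g₁ : Y ⊗ O.Pos ⟶ C) (l : Y ⟶ O.Pos) (g₂ g : Y ⊗ O.Pos ⟶ C) : Prop :=
  (∀ (Z : E) (k : Z ⟶ Y) (j : Z ⟶ O.Pos), O.Le j (k ≫ l) → lift k j ≫ g = lift k j ≫ g₁) ∧
    ∀ (Z : E) (k : Z ⟶ Y) (j : Z ⟶ O.Pos), O.Le (k ≫ l) j →
      lift k j ≫ g = lift k (O.monus j (k ≫ l)) ≫ g₂

theorem exists_isConcat {g₁ g₂ : Y ⊗ O.Pos ⟶ C} {l : Y ⟶ O.Pos}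
    (h : pt g₁ l = pt g₂ (O.zero Y)) : ∃ g, IsConcat g₁ l g₂ g := by
  obtain ⟨g, h1, h2⟩ := O.exists_cases (snd Y O.Pos) (fst Y O.Pos ≫ l) g₁
    (lift (fst _ _) (O.monus (snd _ _) (fst _ _ ≫ l)) ≫ g₂) (by
      intro V k e
      have hk : k = lift (k ≫ fst _ _) ((k ≫ fst _ _) ≫ l) := by
        rw [Category.assoc, ← e]
        ext <;> simp
      rw [← Category.assoc, comp_lift, O.comp_monus, e, RingOrder.monus_self,
        ← O.comp_zero (k ≫ fst _ _), lift_comp, ← h, ← lift_comp, ← hk])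
  refine ⟨g, fun Z k j hj => h1 Z _ ?_, fun Z k j hj => (h2 Z (lift k j) ?_).trans ?_⟩
  · rwa [lift_snd, lift_fst_assoc]
  · rwa [lift_snd, lift_fst_assoc]
  · rw [← Category.assoc, comp_lift, O.comp_monus, lift_fst, lift_snd, lift_fst_assoc]

namespace IsConcat

variable {g₁ g₂ g g' : Y ⊗ O.Pos ⟶ C} {l : Y ⟶ O.Pos}

theorem unique (h : IsConcat g₁ l g₂ g) (h' : IsConcat g₁ l g₂ g') : g = g' :=
  fn_ext_le l (fun Z k j hj => (h.1 Z k j hj).trans (h'.1 Z k j hj).symm)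
    (fun Z k j hj => (h.2 Z k j hj).trans (h'.2 Z k j hj).symm)

theorem stage (h : IsConcat g₁ l g₂ g) (k : Z ⟶ Y) :
    IsConcat (k ▷ O.Pos ≫ g₁) (k ≫ l) (k ▷ O.Pos ≫ g₂) (k ▷ O.Pos ≫ g) := by
  refine ⟨fun W m j hj => ?_, fun W m j hj => ?_⟩
  · simp only [← Category.assoc, lift_whiskerRight]
    exact h.1 W _ j (by rwa [Category.assoc])
  · simp only [← Category.assoc, lift_whiskerRight]
    exact h.2 W _ j (by rwa [Category.assoc])

theorem comp (h : IsConcat g₁ l g₂ g) (γ : C ⟶ C') : IsConcat (g₁ ≫ γ) l (g₂ ≫ γ) (g ≫ γ) := by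
  refine ⟨fun W m j hj => ?_, fun W m j hj => ?_⟩
  · simp only [← Category.assoc, h.1 W m j hj]
  · simp only [← Category.assoc, h.2 W m j hj]

theorem pt_zero (h : IsConcat g₁ l g₂ g) : pt g (O.zero Y) = pt g₁ (O.zero Y) :=
  h.1 Y (𝟙 Y) _ (RingOrder.zero_le _)

theorem ends (h : IsConcat g₁ l g₂ g) {l' : Y ⟶ O.Pos} {e : Y ⟶ C} (h' : Ends g₂ l' e) :
    Ends g (O.add l l') e := fun Z k j hj => by
  rw [O.comp_add] at hj
  rw [h.2 Z k j ((O.le_add_right _ _).trans hj)]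
  exact h' Z k _ (RingOrder.le_monus hj)

theorem const (e : Y ⟶ C) (l : Y ⟶ O.Pos) :
    IsConcat (fst _ _ ≫ e) l (fst _ _ ≫ e) (fst _ _ ≫ e) :=
  ⟨fun _ _ _ _ => rfl, fun _ _ _ _ => by rw [lift_fst_assoc, lift_fst_assoc]⟩

theorem zero_left (h : pt g₁ (O.zero Y) = pt g₂ (O.zero Y)) :
    IsConcat g₁ (O.zero Y) g₂ g₂ := by
  refine ⟨fun Z k j hj => ?_, fun Z k j hj => ?_⟩
  · rw [O.comp_zero] at hj
    rw [hj.antisymm (RingOrder.zero_le j), ← O.comp_zero k, lift_comp, lift_comp, h]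
  · rw [O.comp_zero, RingOrder.monus_zero]

theorem const_right {e : Y ⟶ C} (h : Ends g₁ l e) : IsConcat g₁ l (fst _ _ ≫ e) g₁ :=
  ⟨fun _ _ _ _ => rfl, fun Z k j hj => by rw [lift_fst_assoc, h Z k j hj]⟩

end IsConcat

end Concat

/-! ### Codes of identity types -/

namespace Codes

variable (c : Codes O 𝔹 T) {X Y Z : E}

/-- The code of an identity type in terms of morphisms to the total object. -/
def eqCode (a b : Y ⟶ T.total) (hab : b ≫ T.disp = a ≫ T.disp) : Y ⟶ U :=
  c.eq (a ≫ T.disp) (T.ofTot a rfl) (T.ofTot b hab)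

theorem comp_eqCode (k : Z ⟶ Y) (a b : Y ⟶ T.total) (hab : b ≫ T.disp = a ≫ T.disp) :
    k ≫ c.eqCode a b hab = c.eqCode (k ≫ a) (k ≫ b) (by simp only [Category.assoc, hab]) := by
  rw [eqCode, c.eq_comp]
  refine c.eq_congr (Category.assoc _ _ _).symm ?_ ?_
  · rw [Ty.tot_restr, Ty.tot_ofTot, Ty.tot_ofTot]
  · rw [Ty.tot_restr, Ty.tot_ofTot, Ty.tot_ofTot]

theorem eqEquiv_congr {u u' : X ⟶ U} {a b : T.El u} {a' b' : T.El u'} {t : T.El (c.eq u a b)}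
    {t' : T.El (c.eq u' a' b')} (hu : u = u') (ha : T.tot a = T.tot a') (hb : T.tot b = T.tot b')
    (ht : T.tot t = T.tot t') :
    T.tot (c.eqEquiv u a b t).fn = T.tot (c.eqEquiv u' a' b' t').fn ∧
      (c.eqEquiv u a b t).len = (c.eqEquiv u' a' b' t').len := by
  subst hu
  obtain rfl := Ty.tot_injective ha
  obtain rfl := Ty.tot_injective hb
  obtain rfl := Ty.tot_injective ht
  exact ⟨rfl, rfl⟩

/-- The function underlying an element of an identity type. -/
noncomputable def eqFn (a b : Y ⟶ T.total) (hab : b ≫ T.disp = a ≫ T.disp) (t : Y ⟶ T.total)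
    (ht : t ≫ T.disp = c.eqCode a b hab) : Y ⊗ O.Pos ⟶ T.total :=
  T.tot (c.eqEquiv _ _ _ (T.ofTot t ht)).fn

/-- The shape of an element of an identity type. -/
noncomputable def eqLen (a b : Y ⟶ T.total) (hab : b ≫ T.disp = a ≫ T.disp) (t : Y ⟶ T.total)
    (ht : t ≫ T.disp = c.eqCode a b hab) : Y ⟶ O.Pos :=
  (c.eqEquiv _ _ _ (T.ofTot t ht)).len

theorem tot_start {Γ X : E} {A : Ty.{v, u} Γ} {x : X ⟶ Γ} {a b : A.El x}
    (q : MoorePath O A.toFam a b) : pt (A.tot q.fn) (O.zero X) = A.tot a := by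
  have := congrArg A.tot q.start
  rwa [Ty.tot_restr] at this

theorem tot_ends {Γ X : E} {A : Ty.{v, u} Γ} {x : X ⟶ Γ} {a b : A.El x}
    (q : MoorePath O A.toFam a b) : Ends (A.tot q.fn) q.len (A.tot b) := fun Z k j hj => by
  have := congrArg A.tot (q.finish k rfl j hj)
  rwa [Ty.tot_restr, Ty.tot_restr] at this

section

variable {c} (a b : Y ⟶ T.total) (hab : b ≫ T.disp = a ≫ T.disp) (t : Y ⟶ T.total)
  (ht : t ≫ T.disp = c.eqCode a b hab)

theorem eqFn_disp : c.eqFn a b hab t ht ≫ T.disp = fst _ _ ≫ a ≫ T.disp := Ty.tot_disp _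

theorem pt_eqFn_zero : pt (c.eqFn a b hab t ht) (O.zero Y) = a :=
  (tot_start _).trans (Ty.tot_ofTot _ _)

theorem eqFn_ends : Ends (c.eqFn a b hab t ht) (c.eqLen a b hab t ht) b := by
  have := tot_ends (c.eqEquiv _ _ _ (T.ofTot t ht))
  rwa [Ty.tot_ofTot] at this

theorem comp_eqFn_eqLen (k : Z ⟶ Y) :
    k ▷ O.Pos ≫ c.eqFn a b hab t ht = c.eqFn (k ≫ a) (k ≫ b) (by simp only [Category.assoc, hab])
      (k ≫ t) (by rw [Category.assoc, ht, comp_eqCode]) ∧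
    k ≫ c.eqLen a b hab t ht = c.eqLen (k ≫ a) (k ≫ b) (by simp only [Category.assoc, hab])
      (k ≫ t) (by rw [Category.assoc, ht, comp_eqCode]) := by
  have h := c.eqEquiv_restr k _ _ _ (T.ofTot t ht)
  have h1 := congrArg (fun q => T.tot q.fn) h
  have h2 := congrArg (fun q => q.len) h
  have h3 := Ty.tot_restr (A := T) (k ▷ O.Pos) (y := fst Z O.Pos ≫ k ≫ a ≫ T.disp)
    (by rw [whiskerRight_fst_assoc]) (c.eqEquiv _ _ _ (T.ofTot t ht)).fn
  have key := c.eqEquiv_congr (u := k ≫ a ≫ T.disp) (u' := (k ≫ a) ≫ T.disp)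
    (a := T.restr k rfl (T.ofTot a rfl)) (b := T.restr k rfl (T.ofTot b hab))
    (a' := T.ofTot (k ≫ a) rfl) (b' := T.ofTot (k ≫ b) (by simp only [Category.assoc, hab]))
    (t := T.restr k (c.eq_comp _ _ _ _) (T.ofTot t ht))
    (t' := T.ofTot (k ≫ t) (by rw [Category.assoc, ht, comp_eqCode]; rfl))
    (Category.assoc _ _ _).symm (by rw [Ty.tot_restr, Ty.tot_ofTot, Ty.tot_ofTot])
    (by rw [Ty.tot_restr, Ty.tot_ofTot, Ty.tot_ofTot])
    ((Ty.tot_restr _ _ _).trans ((congrArg (k ≫ ·) (Ty.tot_ofTot t ht)).trans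
      (Ty.tot_ofTot _ _).symm))
  exact ⟨h3.symm.trans (h1.symm.trans key.1), h2.symm.trans key.2⟩

theorem eqFn_eqLen_congr {a b t a' b' t' : Y ⟶ T.total} (hab : b ≫ T.disp = a ≫ T.disp)
    (ht : t ≫ T.disp = c.eqCode a b hab) (hab' : b' ≫ T.disp = a' ≫ T.disp)
    (ht' : t' ≫ T.disp = c.eqCode a' b' hab') (ea : a = a') (eb : b = b') (et : t = t') :
    c.eqFn a b hab t ht = c.eqFn a' b' hab' t' ht' ∧
      c.eqLen a b hab t ht = c.eqLen a' b' hab' t' ht' := by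
  subst ea eb et
  exact ⟨rfl, rfl⟩

theorem moorePath_ext {Γ X : E} {A : Ty.{v, u} Γ} {x : X ⟶ Γ} {a b : A.El x}
    {q q' : MoorePath O A.toFam a b} (h : A.tot q.fn = A.tot q'.fn) (hl : q.len = q'.len) :
    q = q' := MoorePath.ext (Ty.tot_injective h) hl

variable {t} in
theorem eqPath_ext {t' : Y ⟶ T.total} (ht' : t' ≫ T.disp = c.eqCode a b hab)
    (h : c.eqFn a b hab t ht = c.eqFn a b hab t' ht')
    (hl : c.eqLen a b hab t ht = c.eqLen a b hab t' ht') : t = t' := by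
  have := (c.eqEquiv _ _ _).injective (moorePath_ext h hl)
  exact (Ty.tot_ofTot t ht).symm.trans ((congrArg T.tot this).trans (Ty.tot_ofTot t' ht'))

theorem exists_eqPath (c : Codes O 𝔹 T) (g : Y ⊗ O.Pos ⟶ T.total) (l : Y ⟶ O.Pos)
    (hg : g ≫ T.disp = fst _ _ ≫ a ≫ T.disp) (h0 : pt g (O.zero Y) = a) (hl : Ends g l b) :
    ∃ (t : Y ⟶ T.total) (ht : t ≫ T.disp = c.eqCode a b hab),
      c.eqFn a b hab t ht = g ∧ c.eqLen a b hab t ht = l := by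
  let q : MoorePath O T.toFam (T.ofTot a rfl) (T.ofTot b hab) :=
    { fn := T.ofTot g hg
      len := l
      start := Ty.tot_injective (by rw [Ty.tot_restr, Ty.tot_ofTot, Ty.tot_ofTot]; exact h0)
      finish := fun h y e j hj => Ty.tot_injective (by
        rw [Ty.tot_restr, Ty.tot_restr, Ty.tot_ofTot, Ty.tot_ofTot]
        exact hl _ h j hj) }
  refine ⟨T.tot ((c.eqEquiv _ _ _).symm q), Ty.tot_disp _, ?_, ?_⟩
  · exact (congrArg (fun t => T.tot (c.eqEquiv _ _ _ t).fn) (Ty.ofTot_tot _)).trans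
      ((congrArg (fun q => T.tot q.fn) (Equiv.apply_symm_apply _ q)).trans (Ty.tot_ofTot g hg))
  · exact (congrArg (fun t => (c.eqEquiv _ _ _ t).len) (Ty.ofTot_tot _)).trans
      (congrArg (fun q => q.len) (Equiv.apply_symm_apply _ q))

end

end Codes

theorem RingOrder.toward_of_dist_le {X : E} {i j m : X ⟶ O.Pos} (h : O.Le (O.dist i j) m) :
    O.toward i j m = j := by
  rw [← add_monus_of_le h, ← toward_toward, toward_dist, toward_self]

/-! ### Transport in identity types -/

namespace LTap

variable {X Y Z : E} {x : X ⟶ U}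

section Slide

variable (r : LTap O T x) (h : Y ⟶ X) (q : Y ⊗ O.Pos ⟶ U) (σ : Y ⊗ O.Pos ⟶ T.total)
  (i j : Y ⟶ O.Pos) (hq : pt q (O.zero Y) = h ≫ x) (hσ : σ ≫ T.disp = q)

/-- For a section `σ` over `q`, the function `m ↦ tr k j (σ k)` to the fibre over `q j`, where `k`
moves from `i` towards `j`. -/
noncomputable def slide : Y ⊗ O.Pos ⟶ T.total :=
  r.tr (fst _ _ ≫ h) (fst _ _ ▷ O.Pos ≫ q) (O.toward (fst _ _ ≫ i) (fst _ _ ≫ j) (snd _ _))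
    (fst _ _ ≫ j) (lift (fst _ _) (O.toward (fst _ _ ≫ i) (fst _ _ ≫ j) (snd _ _)) ≫ σ)
    (start_comp _ hq) (by rw [Category.assoc, hσ, lift_comp_eq_pt])

include hσ in
theorem pt_section_disp (m : Y ⟶ O.Pos) : pt σ m ≫ T.disp = pt q m := by
  rw [← pt_comp, hσ]

theorem slide_disp : r.slide h q σ i j hq hσ ≫ T.disp = fst _ _ ≫ pt q j := by
  rw [slide, r.tr_disp, comp_pt]

theorem pt_slide (m : Y ⟶ O.Pos) : pt (r.slide h q σ i j hq hσ) m =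
    r.tr h q (O.toward i j m) j (pt σ (O.toward i j m)) hq (pt_section_disp q σ hσ _) := by
  rw [slide, pt, r.comp_tr']
  have e : lift (𝟙 Y) m ≫ O.toward (fst _ _ ≫ i) (fst _ _ ≫ j) (snd _ _) = O.toward i j m := by
    simp [RingOrder.comp_toward]
  refine r.tr_congr _ _ (by rw [lift_fst_assoc, Category.id_comp])
    (by rw [whisker_comp, lift_fst, id_whiskerRight, Category.id_comp]) e
    (by rw [lift_fst_assoc, Category.id_comp]) ?_
  rw [← Category.assoc, comp_lift, e, lift_fst, pt]

theorem comp_slide (k : Z ⟶ Y) : k ▷ O.Pos ≫ r.slide h q σ i j hq hσ =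
    r.slide (k ≫ h) (k ▷ O.Pos ≫ q) (k ▷ O.Pos ≫ σ) (k ≫ i) (k ≫ j) (start_comp k hq)
      (by rw [Category.assoc, hσ]) := by
  rw [slide, r.comp_tr']
  have e : k ▷ O.Pos ≫ O.toward (fst _ _ ≫ i) (fst _ _ ≫ j) (snd _ _) =
      O.toward (fst _ _ ≫ k ≫ i) (fst _ _ ≫ k ≫ j) (snd _ _) := by
    simp [RingOrder.comp_toward]
  refine r.tr_congr _ _ (by rw [whiskerRight_fst_assoc])
    (by rw [whisker_comp, whiskerRight_fst, ← whisker_comp]) e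
    (by rw [whiskerRight_fst_assoc]) ?_
  rw [← Category.assoc (k ▷ O.Pos), comp_lift, e, whiskerRight_fst, ← Category.assoc (lift _ _),
    lift_whiskerRight]

theorem pt_slide_zero : pt (r.slide h q σ i j hq hσ) (O.zero Y) =
    r.tr h q i j (pt σ i) hq (pt_section_disp q σ hσ _) := by
  rw [pt_slide]
  exact r.tr_congr _ _ rfl rfl (RingOrder.toward_zero _ _) rfl (by rw [RingOrder.toward_zero])

/-- After the distance from `i` to `j` the moving point rests at `j`, where transport to `j` is the
identity by `tr_self`. -/
theorem slide_ends : Ends (r.slide h q σ i j hq hσ) (O.dist i j) (pt σ j) := by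
  intro Z k m hm
  rw [O.comp_dist] at hm
  rw [lift_comp_eq_pt, comp_slide, pt_slide, comp_pt]
  have e := RingOrder.toward_of_dist_le hm
  refine (r.tr_congr _ _ rfl rfl e rfl (by rw [e])).trans (r.tr_self _ _ _ _ _ ?_)
  rw [← pt_comp, Category.assoc, hσ]

theorem slide_congr {h' : Y ⟶ X} {q' : Y ⊗ O.Pos ⟶ U} {σ' : Y ⊗ O.Pos ⟶ T.total}
    {i' j' : Y ⟶ O.Pos} (eh : h = h') (eq : q = q') (eσ : σ = σ') (ei : i = i') (ej : j = j') :
    r.slide h q σ i j hq hσ = r.slide h' q' σ' i' j' (eq ▸ eh ▸ hq) (eσ ▸ eq ▸ hσ) := by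
  subst eh eq eσ ei ej
  rfl

theorem restr_slide {W : E} (g : X ⟶ W) {w : W ⟶ U} (r : LTap O T w) (e : g ≫ w = x) :
    (r.restr g e).slide h q σ i j hq hσ = r.slide (h ≫ g) q σ i j
      (by rw [hq, Category.assoc, e]) hσ :=
  r.tr_congr _ _ (Category.assoc _ _ _) rfl rfl rfl rfl

end Slide

section TrFn

variable (r : LTap O T x) (h : Y ⟶ X) (q : Y ⊗ O.Pos ⟶ U) (i j : Y ⟶ O.Pos)
  (g : Y ⊗ O.Pos ⟶ T.total) (hq : pt q (O.zero Y) = h ≫ x) (hg : g ≫ T.disp = fst _ _ ≫ pt q i)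

/-- Transport of a function to the fibre over `q i`. -/
noncomputable def trFn : Y ⊗ O.Pos ⟶ T.total :=
  r.tr (fst _ _ ≫ h) (fst _ _ ▷ O.Pos ≫ q) (fst _ _ ≫ i) (fst _ _ ≫ j) g (start_comp _ hq)
    (hg.trans (comp_pt _ _ _))

theorem trFn_disp : r.trFn h q i j g hq hg ≫ T.disp = fst _ _ ≫ pt q j := by
  rw [trFn, r.tr_disp, comp_pt]

include hg in
theorem pt_fibre_disp (m : Y ⟶ O.Pos) : pt g m ≫ T.disp = pt q i := by
  rw [← pt_comp, hg, pt_fst]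

theorem pt_trFn (m : Y ⟶ O.Pos) : pt (r.trFn h q i j g hq hg) m =
    r.tr h q i j (pt g m) hq (pt_fibre_disp q i g hg m) := by
  rw [trFn, pt, r.comp_tr']
  exact r.tr_congr _ _ (by rw [lift_fst_assoc, Category.id_comp])
    (by rw [whisker_comp, lift_fst, id_whiskerRight, Category.id_comp])
    (by rw [lift_fst_assoc, Category.id_comp]) (by rw [lift_fst_assoc, Category.id_comp]) rfl

theorem comp_trFn (k : Z ⟶ Y) : k ▷ O.Pos ≫ r.trFn h q i j g hq hg =
    r.trFn (k ≫ h) (k ▷ O.Pos ≫ q) (k ≫ i) (k ≫ j) (k ▷ O.Pos ≫ g) (start_comp k hq)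
      (by rw [Category.assoc, hg, whiskerRight_fst_assoc, comp_pt]) := by
  rw [trFn, r.comp_tr']
  exact r.tr_congr _ _ (by rw [whiskerRight_fst_assoc])
    (by rw [whisker_comp, whiskerRight_fst, ← whisker_comp]) (by rw [whiskerRight_fst_assoc])
    (by rw [whiskerRight_fst_assoc]) rfl

theorem trFn_ends {l : Y ⟶ O.Pos} {e : Y ⟶ T.total} (he : e ≫ T.disp = pt q i)
    (hl : Ends g l e) : Ends (r.trFn h q i j g hq hg) l (r.tr h q i j e hq he) := by
  intro Z k m hm
  rw [lift_comp_eq_pt, comp_trFn, pt_trFn, r.comp_tr']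
  exact r.tr_congr _ _ rfl rfl rfl rfl (by rw [← lift_comp_eq_pt, hl Z k m hm])

theorem trFn_self (hg : g ≫ T.disp = fst _ _ ≫ pt q i) : r.trFn h q i i g hq hg = g :=
  r.tr_self _ _ _ _ _ _

theorem trFn_congr {h' : Y ⟶ X} {q' : Y ⊗ O.Pos ⟶ U} {i' j' : Y ⟶ O.Pos}
    {g' : Y ⊗ O.Pos ⟶ T.total} (eh : h = h') (eq : q = q') (ei : i = i') (ej : j = j')
    (eg : g = g') :
    r.trFn h q i j g hq hg = r.trFn h' q' i' j' g' (eq ▸ eh ▸ hq) (eg ▸ ei ▸ eq ▸ hg) := by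
  subst eh eq ei ej eg
  rfl

theorem restr_trFn {W : E} (k : X ⟶ W) {w : W ⟶ U} (r : LTap O T w) (e : k ≫ w = x) :
    (r.restr k e).trFn h q i j g hq hg = r.trFn (h ≫ k) q i j g
      (by rw [hq, Category.assoc, e]) hg :=
  r.tr_congr _ _ (Category.assoc _ _ _) rfl rfl rfl rfl

end TrFn

end LTap

/-- The function `g` of shape `l'` is the concatenation of the reverse of `A`, of `F` and of `B`,
where `A` and `B` have shape `d` and `F` has shape `l`. -/
def IsConjugate {C Y : E} (d : Y ⟶ O.Pos) (A F : Y ⊗ O.Pos ⟶ C) (l : Y ⟶ O.Pos)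
    (B g : Y ⊗ O.Pos ⟶ C) (l' : Y ⟶ O.Pos) : Prop :=
  ∃ m, IsConcat (flip A d) d F m ∧ IsConcat m (O.add d l) B g ∧ l' = O.add (O.add d l) d

namespace IsConjugate

variable {C Y Z : E} {d l l' d' m m' : Y ⟶ O.Pos} {A F B g A' F' B' g' : Y ⊗ O.Pos ⟶ C}

theorem unique (H : IsConjugate d A F l B g l') (H' : IsConjugate d' A' F' m B' g' m')
    (ed : d = d') (eA : A = A') (eF : F = F') (el : l = m) (eB : B = B') : g = g' ∧ l' = m' := by
  subst ed eA eF el eB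
  obtain ⟨m, h1, h2, rfl⟩ := H
  obtain ⟨m', h1', h2', rfl⟩ := H'
  obtain rfl := h1.unique h1'
  exact ⟨h2.unique h2', rfl⟩

theorem stage (H : IsConjugate d A F l B g l') (k : Z ⟶ Y) :
    IsConjugate (k ≫ d) (k ▷ O.Pos ≫ A) (k ▷ O.Pos ≫ F) (k ≫ l) (k ▷ O.Pos ≫ B)
      (k ▷ O.Pos ≫ g) (k ≫ l') := by
  obtain ⟨m, h1, h2, rfl⟩ := H
  refine ⟨_, (comp_flip k A d ▸ h1.stage k), ?_, ?_⟩
  · have := h2.stage k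
    rwa [O.comp_add] at this
  · simp only [O.comp_add]

/-- For distance zero both outer pieces are degenerate and conjugation does nothing. This yields
`tr_self` for identity types. -/
theorem zero {e e' : Y ⟶ C} (hA : Ends A (O.zero Y) e) (hB : Ends B (O.zero Y) e')
    (h0 : pt F (O.zero Y) = e) (hF : Ends F l e') :
    IsConjugate (O.zero Y) A F l B F l := by
  obtain rfl := hA.eq_const rfl
  obtain rfl := hB.eq_const rfl
  refine ⟨F, ?_, ?_, ?_⟩
  · refine IsConcat.zero_left ?_
    rw [pt_flip_zero, pt_fst, h0]
  · rw [RingOrder.zero_add']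
    exact IsConcat.const_right hF
  · rw [RingOrder.zero_add', RingOrder.add_zero']

end IsConjugate

namespace Codes

variable {c : Codes O 𝔹 T}

namespace Decode

variable (D : Decode c)

section Eq

variable {Γ Y Z : E} {u : Γ ⟶ U} {a b : T.El u}

theorem eq_of_path {p : Y ⊗ O.Pos ⟶ U} (hp : p ≫ c.eqCode D.ea D.eb D.eb_disp = p)
    (i : Y ⟶ O.Pos) : pt p i = c.eqCode (pt p i ≫ D.ea) (pt p i ≫ D.eb)
      (by rw [Category.assoc, D.eb_disp, Category.assoc]) := by
  rw [← comp_eqCode _ _ _ _ D.eb_disp, ← pt_comp, hp]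

theorem eb_path (p : Y ⊗ O.Pos ⟶ U) : (p ≫ D.eb) ≫ T.disp = (p ≫ D.ea) ≫ T.disp := by
  rw [Category.assoc, D.eb_disp, Category.assoc]

theorem path_eq' {h : Y ⟶ Γ} {p : Y ⊗ O.Pos ⟶ U} (hp : pt p (O.zero Y) = h ≫ c.eq u a b) :
    p ≫ c.eqCode D.ea D.eb D.eb_disp = p := D.path_eq u a b h p _ hp

variable {D} in
theorem start_ea {h : Y ⟶ Γ} {p : Y ⊗ O.Pos ⟶ U} (hp : pt p (O.zero Y) = h ≫ c.eq u a b) :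
    pt ((p ≫ D.ea) ≫ T.disp) (O.zero Y) = h ≫ u := by
  rw [pt_comp, pt_comp, hp, Category.assoc h, D.eq_ea, Category.assoc, Ty.tot_disp]

/-- The function underlying an element of the identity type at `i`. -/
noncomputable def ptEqFn (p : Y ⊗ O.Pos ⟶ U) (hp : p ≫ c.eqCode D.ea D.eb D.eb_disp = p)
    (i : Y ⟶ O.Pos) (t : Y ⟶ T.total) (ht : t ≫ T.disp = pt p i) : Y ⊗ O.Pos ⟶ T.total :=
  c.eqFn (pt p i ≫ D.ea) (pt p i ≫ D.eb) (by rw [Category.assoc, D.eb_disp, Category.assoc]) t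
    (ht.trans (D.eq_of_path hp i))

/-- The shape of an element of the identity type at `i`. -/
noncomputable def ptEqLen (p : Y ⊗ O.Pos ⟶ U) (hp : p ≫ c.eqCode D.ea D.eb D.eb_disp = p)
    (i : Y ⟶ O.Pos) (t : Y ⟶ T.total) (ht : t ≫ T.disp = pt p i) : Y ⟶ O.Pos :=
  c.eqLen (pt p i ≫ D.ea) (pt p i ≫ D.eb) (by rw [Category.assoc, D.eb_disp, Category.assoc]) t
    (ht.trans (D.eq_of_path hp i))

section

variable {D} (p : Y ⊗ O.Pos ⟶ U) (hp : p ≫ c.eqCode D.ea D.eb D.eb_disp = p)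
    (i : Y ⟶ O.Pos) (t : Y ⟶ T.total) (ht : t ≫ T.disp = pt p i)

theorem ptEqFn_disp : D.ptEqFn p hp i t ht ≫ T.disp = fst _ _ ≫ pt ((p ≫ D.ea) ≫ T.disp) i := by
  rw [ptEqFn, eqFn_disp, pt_comp, pt_comp]

theorem comp_ptEqFn_ptEqLen (k : Z ⟶ Y) (hp' : (k ▷ O.Pos ≫ p) ≫ c.eqCode D.ea D.eb D.eb_disp =
      k ▷ O.Pos ≫ p) (ht' : (k ≫ t) ≫ T.disp = pt (k ▷ O.Pos ≫ p) (k ≫ i)) :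
    k ▷ O.Pos ≫ D.ptEqFn p hp i t ht = D.ptEqFn (k ▷ O.Pos ≫ p) hp' (k ≫ i) (k ≫ t) ht' ∧
      k ≫ D.ptEqLen p hp i t ht = D.ptEqLen (k ▷ O.Pos ≫ p) hp' (k ≫ i) (k ≫ t) ht' := by
  have h1 := comp_eqFn_eqLen (c := c) (pt p i ≫ D.ea) (pt p i ≫ D.eb)
    (by rw [Category.assoc, D.eb_disp, Category.assoc]) t (ht.trans (D.eq_of_path hp i)) k
  have h2 := eqFn_eqLen_congr (c := c) (a := k ≫ pt p i ≫ D.ea) (b := k ≫ pt p i ≫ D.eb)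
    (t := k ≫ t) (a' := pt (k ▷ O.Pos ≫ p) (k ≫ i) ≫ D.ea)
    (b' := pt (k ▷ O.Pos ≫ p) (k ≫ i) ≫ D.eb) (t' := k ≫ t)
    (by simp only [Category.assoc, D.eb_disp])
    (by
      rw [Category.assoc, ht, ← comp_eqCode, ← D.eq_of_path hp i]
      simp only [Category.assoc, D.eb_disp])
    (by simp only [Category.assoc, D.eb_disp])
    (ht'.trans (D.eq_of_path hp' _)) (by rw [← comp_pt, Category.assoc])
    (by rw [← comp_pt, Category.assoc]) rfl
  exact ⟨h1.1.trans h2.1, h1.2.trans h2.2⟩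

theorem pt_ptEqFn_zero : pt (D.ptEqFn p hp i t ht) (O.zero Y) = pt p i ≫ D.ea :=
  pt_eqFn_zero _ _ _ _ _

theorem ptEqFn_ends : Ends (D.ptEqFn p hp i t ht) (D.ptEqLen p hp i t ht) (pt p i ≫ D.eb) :=
  eqFn_ends _ _ _ _ _

theorem ptEqFn_ptEqLen_congr {p' : Y ⊗ O.Pos ⟶ U} {i' : Y ⟶ O.Pos} {t' : Y ⟶ T.total}
    (hp' : p' ≫ c.eqCode D.ea D.eb D.eb_disp = p') (ht' : t' ≫ T.disp = pt p' i')
    (e : pt p i = pt p' i') (et : t = t') : D.ptEqFn p hp i t ht = D.ptEqFn p' hp' i' t' ht' ∧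
      D.ptEqLen p hp i t ht = D.ptEqLen p' hp' i' t' ht' :=
  eqFn_eqLen_congr _ _ _ _ (by rw [e]) (by rw [e]) et

theorem ptEq_ext {t t' : Y ⟶ T.total} (ht : t ≫ T.disp = pt p i) (ht' : t' ≫ T.disp = pt p i)
    (h1 : D.ptEqFn p hp i t ht = D.ptEqFn p hp i t' ht')
    (h2 : D.ptEqLen p hp i t ht = D.ptEqLen p hp i t' ht') : t = t' :=
  eqPath_ext _ _ _ _ _ h1 h2

end

variable (r : LTap O T u)

/-- The three pieces can be concatenated: the slide of each endpoint starts at the transport of that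
endpoint from `i` to `j`, which is where the transported path begins or ends, and the slide finishes
at the corresponding endpoint over `p j`. -/
theorem exists_eqTr (h : Y ⟶ Γ) (p : Y ⊗ O.Pos ⟶ U) (i j : Y ⟶ O.Pos) (t : Y ⟶ T.total)
    (hp : pt p (O.zero Y) = h ≫ c.eq u a b) (ht : t ≫ T.disp = pt p i) :
    ∃ (t' : Y ⟶ T.total) (ht' : t' ≫ T.disp = pt p j),
      IsConjugate (O.dist i j)
        (r.slide h ((p ≫ D.ea) ≫ T.disp) (p ≫ D.ea) i j (start_ea hp) rfl)
        (r.trFn h ((p ≫ D.ea) ≫ T.disp) i j (D.ptEqFn p (D.path_eq' hp) i t ht) (start_ea hp)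
          (ptEqFn_disp _ _ _ _ _))
        (D.ptEqLen p (D.path_eq' hp) i t ht)
        (r.slide h ((p ≫ D.ea) ≫ T.disp) (p ≫ D.eb) i j (start_ea hp) (D.eb_path p))
        (D.ptEqFn p (D.path_eq' hp) j t' ht') (D.ptEqLen p (D.path_eq' hp) j t' ht') := by
  have hea : (pt p i ≫ D.ea) ≫ T.disp = pt ((p ≫ D.ea) ≫ T.disp) i := by
    rw [pt_comp, pt_comp]
  have heb : (pt p i ≫ D.eb) ≫ T.disp = pt ((p ≫ D.ea) ≫ T.disp) i := by
    rw [Category.assoc, D.eb_disp, ← Category.assoc, hea]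
  have hF := r.trFn_ends h ((p ≫ D.ea) ≫ T.disp) i j (D.ptEqFn p (D.path_eq' hp) i t ht)
    (start_ea hp) (ptEqFn_disp _ _ _ _ _) heb (ptEqFn_ends _ _ _ _ _)
  obtain ⟨m, hm⟩ := exists_isConcat (l := O.dist i j)
    (g₁ := flip (r.slide h ((p ≫ D.ea) ≫ T.disp) (p ≫ D.ea) i j (start_ea hp) rfl) (O.dist i j))
    (g₂ := r.trFn h ((p ≫ D.ea) ≫ T.disp) i j (D.ptEqFn p (D.path_eq' hp) i t ht) (start_ea hp)
      (ptEqFn_disp _ _ _ _ _)) (by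
      rw [(flip_ends _ _).pt_eq, r.pt_slide_zero, r.pt_trFn]
      refine r.tr_congr _ _ rfl rfl rfl rfl ?_
      rw [pt_comp]
      exact (pt_ptEqFn_zero _ _ _ _ _).symm)
  obtain ⟨g, hg⟩ := exists_isConcat (l := O.add (O.dist i j) (D.ptEqLen p (D.path_eq' hp) i t ht))
    (g₁ := m) (g₂ := r.slide h ((p ≫ D.ea) ≫ T.disp) (p ≫ D.eb) i j (start_ea hp) (D.eb_path p))
    (by
      rw [(hm.ends hF).pt_eq, r.pt_slide_zero]
      exact r.tr_congr _ _ rfl rfl rfl rfl (pt_comp _ _ _).symm)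
  have hj : pt ((p ≫ D.ea) ≫ T.disp) j = (pt p j ≫ D.ea) ≫ T.disp := by
    rw [pt_comp, pt_comp]
  obtain ⟨t', ht', h1, h2⟩ := exists_eqPath (pt p j ≫ D.ea) (pt p j ≫ D.eb)
    (by rw [Category.assoc, D.eb_disp, Category.assoc]) c g
    (O.add (O.add (O.dist i j) (D.ptEqLen p (D.path_eq' hp) i t ht)) (O.dist i j)) (by
      -- The concatenation stays in one fibre: all pieces have the same constant image in `U`, and
      -- concatenations are unique.
      have hm' := hm.comp T.disp
      rw [flip_comp, r.slide_disp, r.trFn_disp, flip_const] at hm'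
      have hg' := hg.comp T.disp
      rw [hm'.unique (IsConcat.const _ _), r.slide_disp] at hg'
      rw [hg'.unique (IsConcat.const _ _), hj])
    (by rw [hg.pt_zero, hm.pt_zero, pt_flip_zero, (r.slide_ends _ _ _ _ _ _ _).pt_eq, pt_comp])
    (by
      have := hg.ends (r.slide_ends h _ _ i j (start_ea hp) (D.eb_path p))
      rwa [pt_comp] at this)
  refine ⟨t', ht'.trans (D.eq_of_path (D.path_eq' hp) j).symm, m, hm, ?_, h2⟩
  rwa [show D.ptEqFn p (D.path_eq' hp) j t' (ht'.trans (D.eq_of_path (D.path_eq' hp) j).symm) = g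
    from h1]

/-- Transport in identity types. -/
noncomputable def eqTap : LTap O T (c.eq u a b) where
  tr h p i j t hp ht := (D.exists_eqTr r h p i j t hp ht).choose
  tr_disp h p i j t hp ht := (D.exists_eqTr r h p i j t hp ht).choose_spec.choose
  comp_tr k h p i j t hp ht hp' ht' := by
    obtain ⟨e1, H1⟩ := (D.exists_eqTr r h p i j t hp ht).choose_spec
    obtain ⟨e2, H2⟩ := (D.exists_eqTr r _ _ _ (k ≫ j) _ hp' ht').choose_spec
    have e := comp_ptEqFn_ptEqLen _ (D.path_eq' hp) _ _ ht k (D.path_eq' hp') (LTap.disp_comp k ht)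
    have e' := comp_ptEqFn_ptEqLen _ (D.path_eq' hp) _ _ e1 k (D.path_eq' hp') (LTap.disp_comp k e1)
    -- The conjugate is unique, so the independent choices made at the two stages have the same
    -- underlying function and the same shape.
    obtain ⟨h1, h2⟩ := (H1.stage k).unique H2 (O.comp_dist _ _ _)
      ((r.comp_slide _ _ _ _ _ _ _ _).trans (r.slide_congr _ _ _ _ _ _ _ rfl
        (by simp only [Category.assoc]) (Category.assoc _ _ _).symm rfl rfl))
      ((r.comp_trFn _ _ _ _ _ _ _ _).trans (r.trFn_congr _ _ _ _ _ _ _ rfl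
        (by simp only [Category.assoc]) rfl rfl e.1)) e.2
      ((r.comp_slide _ _ _ _ _ _ _ _).trans (r.slide_congr _ _ _ _ _ _ _ rfl
        (by simp only [Category.assoc]) (Category.assoc _ _ _).symm rfl rfl))
    exact ptEq_ext _ _ _ _ _ (e'.1.symm.trans h1) (e'.2.symm.trans h2)
  tr_self h p i t hp ht := by
    obtain ⟨e1, H1⟩ := (D.exists_eqTr r h p i i t hp ht).choose_spec
    have hA := r.slide_ends h ((p ≫ D.ea) ≫ T.disp) (p ≫ D.ea) i i (start_ea hp) rfl
    have hB := r.slide_ends h ((p ≫ D.ea) ≫ T.disp) (p ≫ D.eb) i i (start_ea hp) (D.eb_path p)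
    rw [RingOrder.dist_self', pt_comp] at hA hB
    obtain ⟨h1, h2⟩ := H1.unique (IsConjugate.zero hA hB (pt_ptEqFn_zero _ _ _ _ _)
      (ptEqFn_ends _ _ _ _ _)) (RingOrder.dist_self' _) rfl (r.trFn_self _ _ _ _ _ _) rfl rfl
    exact ptEq_ext _ _ _ _ _ h1 h2

theorem eqTap_spec (h : Y ⟶ Γ) (p : Y ⊗ O.Pos ⟶ U) (i j : Y ⟶ O.Pos) (t : Y ⟶ T.total)
    (hp : pt p (O.zero Y) = h ≫ c.eq u a b) (ht : t ≫ T.disp = pt p i) :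
      IsConjugate (O.dist i j)
        (r.slide h ((p ≫ D.ea) ≫ T.disp) (p ≫ D.ea) i j (start_ea hp) rfl)
        (r.trFn h ((p ≫ D.ea) ≫ T.disp) i j (D.ptEqFn p (D.path_eq' hp) i t ht) (start_ea hp)
          (ptEqFn_disp _ _ _ _ _))
        (D.ptEqLen p (D.path_eq' hp) i t ht)
        (r.slide h ((p ≫ D.ea) ≫ T.disp) (p ≫ D.eb) i j (start_ea hp) (D.eb_path p))
        (D.ptEqFn p (D.path_eq' hp) j ((D.eqTap r).tr h p i j t hp ht)
          ((D.eqTap r).tr_disp _ _ _ _ _ _ _))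
        (D.ptEqLen p (D.path_eq' hp) j ((D.eqTap r).tr h p i j t hp ht)
          ((D.eqTap r).tr_disp _ _ _ _ _ _ _)) :=
  (D.exists_eqTr r h p i j t hp ht).choose_spec.choose_spec

theorem eqTap_restr {Δ : E} (g : Δ ⟶ Γ) (a b : T.El u) :
    (D.eqTap (a := a) (b := b) r).restr g (c.eq_comp g u a b) =
      D.eqTap (r.restr g rfl) := by
  refine LTap.ext ?_
  funext Y h p i j t hp ht
  have hp' : pt p (O.zero Y) = (h ≫ g) ≫ c.eq u a b := by
    rw [hp, ← c.eq_comp, Category.assoc]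
  have H1 := D.eqTap_spec r (h ≫ g) p i j t hp' ht
  have H2 := D.eqTap_spec (r.restr g rfl) h p i j t hp ht
  obtain ⟨h1, h2⟩ := H1.unique H2 rfl (LTap.restr_slide _ _ _ _ _ _ _ _ _ _).symm
    (LTap.restr_trFn _ _ _ _ _ _ _ _ _ _).symm rfl (LTap.restr_slide _ _ _ _ _ _ _ _ _ _).symm
  exact ptEq_ext _ _ _ _ _ h1 h2

end Eq

end Decode

end Codes

/-! ### Global transport -/

namespace LTap

variable {X Y Z : E} (s : LTap O T (𝟙 U))

/-- Transport from `i` to `j` along a function on the positive cone. -/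
noncomputable def gl (p : Y ⊗ O.Pos ⟶ U) (i j : Y ⟶ O.Pos) (t : Y ⟶ T.total) (ht : t ≫ T.disp = pt p i) :
    Y ⟶ T.total :=
  s.tr (pt p (O.zero Y)) p i j t (Category.comp_id _).symm ht

theorem gl_disp (p : Y ⊗ O.Pos ⟶ U) (i j : Y ⟶ O.Pos) (t : Y ⟶ T.total)
    (ht : t ≫ T.disp = pt p i) : s.gl p i j t ht ≫ T.disp = pt p j := s.tr_disp _ _ _ _ _ _ _

theorem gl_self (p : Y ⊗ O.Pos ⟶ U) (i : Y ⟶ O.Pos) (t : Y ⟶ T.total)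
    (ht : t ≫ T.disp = pt p i) : s.gl p i i t ht = t := s.tr_self _ _ _ _ _ _

theorem gl_congr {p p' : Y ⊗ O.Pos ⟶ U} {i i' j j' : Y ⟶ O.Pos} {t t' : Y ⟶ T.total}
    (ht : t ≫ T.disp = pt p i) (ep : p = p') (ei : i = i') (ej : j = j') (et : t = t') :
    s.gl p i j t ht = s.gl p' i' j' t' (et ▸ ep ▸ ei ▸ ht) := by
  subst ep ei ej et
  rfl

theorem tr_eq_gl (h : Y ⟶ U) (p : Y ⊗ O.Pos ⟶ U) (i j : Y ⟶ O.Pos) (t : Y ⟶ T.total)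
    (hp : pt p (O.zero Y) = h ≫ 𝟙 U) (ht : t ≫ T.disp = pt p i) :
    s.tr h p i j t hp ht = s.gl p i j t ht :=
  s.tr_congr _ _ (by rw [hp, Category.comp_id]) rfl rfl rfl rfl

/-- Over the generic code the base point of a transport is forced to be `p 0`. Hence all
restrictions of `s`, and with them the recursive hypotheses in its computation rules, are instances
of `gl`. -/
theorem restr_tr_eq_gl {x : X ⟶ U} (h : Y ⟶ X) (p : Y ⊗ O.Pos ⟶ U) (i j : Y ⟶ O.Pos)
    (t : Y ⟶ T.total) (hp : pt p (O.zero Y) = h ≫ x) (ht : t ≫ T.disp = pt p i) :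
    (s.restr x (Category.comp_id _)).tr h p i j t hp ht = s.gl p i j t ht :=
  s.tr_congr _ _ hp.symm rfl rfl rfl rfl

theorem comp_gl (k : Z ⟶ Y) (p : Y ⊗ O.Pos ⟶ U) (i j : Y ⟶ O.Pos) (t : Y ⟶ T.total)
    (ht : t ≫ T.disp = pt p i) : k ≫ s.gl p i j t ht =
      s.gl (k ▷ O.Pos ≫ p) (k ≫ i) (k ≫ j) (k ≫ t) (disp_comp k ht) := by
  rw [gl, s.comp_tr', tr_eq_gl]

/-- The function `m ↦ tr k j (σ k)` for a section `σ` over `q`, where `k` moves from `i` to `j`. -/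
noncomputable def glSlide (q : Y ⊗ O.Pos ⟶ U) (σ : Y ⊗ O.Pos ⟶ T.total) (i j : Y ⟶ O.Pos)
    (hσ : σ ≫ T.disp = q) : Y ⊗ O.Pos ⟶ T.total :=
  s.slide (pt q (O.zero Y)) q σ i j (Category.comp_id _).symm hσ

theorem comp_glSlide (k : Z ⟶ Y) (q : Y ⊗ O.Pos ⟶ U) (σ : Y ⊗ O.Pos ⟶ T.total) (i j : Y ⟶ O.Pos)
    (hσ : σ ≫ T.disp = q) : k ▷ O.Pos ≫ s.glSlide q σ i j hσ =
      s.glSlide (k ▷ O.Pos ≫ q) (k ▷ O.Pos ≫ σ) (k ≫ i) (k ≫ j)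
        (by rw [Category.assoc, hσ]) := by
  rw [glSlide, comp_slide, glSlide]
  exact s.slide_congr _ _ _ _ _ _ _ (by rw [comp_pt, O.comp_zero]) rfl rfl rfl rfl

theorem pt_glSlide (q : Y ⊗ O.Pos ⟶ U) (σ : Y ⊗ O.Pos ⟶ T.total) (i j : Y ⟶ O.Pos)
    (hσ : σ ≫ T.disp = q) (m : Y ⟶ O.Pos) : pt (s.glSlide q σ i j hσ) m =
      s.gl q (O.toward i j m) j (pt σ (O.toward i j m)) (pt_section_disp q σ hσ _) := by
  rw [glSlide, pt_slide, gl]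

/-- Transport of a function to the fibre over `q i`. -/
noncomputable def glFn (q : Y ⊗ O.Pos ⟶ U) (i j : Y ⟶ O.Pos) (g : Y ⊗ O.Pos ⟶ T.total)
    (hg : g ≫ T.disp = fst _ _ ≫ pt q i) : Y ⊗ O.Pos ⟶ T.total :=
  s.trFn (pt q (O.zero Y)) q i j g (Category.comp_id _).symm hg

theorem comp_glFn (k : Z ⟶ Y) (q : Y ⊗ O.Pos ⟶ U) (i j : Y ⟶ O.Pos) (g : Y ⊗ O.Pos ⟶ T.total)
    (hg : g ≫ T.disp = fst _ _ ≫ pt q i) : k ▷ O.Pos ≫ s.glFn q i j g hg =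
      s.glFn (k ▷ O.Pos ≫ q) (k ≫ i) (k ≫ j) (k ▷ O.Pos ≫ g)
        (by rw [Category.assoc, hg, whiskerRight_fst_assoc, comp_pt]) := by
  rw [glFn, comp_trFn, glFn]
  exact s.trFn_congr _ _ _ _ _ _ _ (by rw [comp_pt, O.comp_zero]) rfl rfl rfl rfl

theorem pt_glFn (q : Y ⊗ O.Pos ⟶ U) (i j : Y ⟶ O.Pos) (g : Y ⊗ O.Pos ⟶ T.total)
    (hg : g ≫ T.disp = fst _ _ ≫ pt q i) (m : Y ⟶ O.Pos) : pt (s.glFn q i j g hg) m =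
      s.gl q i j (pt g m) (pt_fibre_disp q i g hg m) := by
  rw [glFn, pt_trFn, gl]

end LTap

namespace Codes.Decode

variable {c : Codes O 𝔹 T} (D : Decode c) {Y Z : E}

theorem pi_of_path {p : Y ⊗ O.Pos ⟶ U} (hp : p ≫ c.pi D.pfst D.psnd = p) (i : Y ⟶ O.Pos) :
    pt p i = pt p i ≫ c.pi D.pfst D.psnd := by
  rw [← pt_comp, hp]

/-- The function `m ↦ cod (p m) (tr j m a)`. -/
noncomputable def glPiFn (s : LTap O T (𝟙 U)) (p : Y ⊗ O.Pos ⟶ U) (j : Y ⟶ O.Pos)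
    (a : Y ⟶ T.total) (ha : a ≫ T.disp = pt (p ≫ D.pfst) j) : Y ⊗ O.Pos ⟶ U :=
  D.piFn s (pt (p ≫ D.pfst) (O.zero Y)) p j a (Category.comp_id _).symm ha

theorem pt_glPiFn (s : LTap O T (𝟙 U)) (p : Y ⊗ O.Pos ⟶ U) (j : Y ⟶ O.Pos)
    (a : Y ⟶ T.total) (ha : a ≫ T.disp = pt (p ≫ D.pfst) j) (m : Y ⟶ O.Pos) :
    pt (D.glPiFn s p j a ha) m = D.cod (pt p m) (s.gl (p ≫ D.pfst) j m a ha)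
      (by rw [s.gl_disp, pt_comp]) :=
  D.pt_piFn s _ p j a _ ha m

theorem comp_glPiFn (s : LTap O T (𝟙 U)) (k : Z ⟶ Y) (p : Y ⊗ O.Pos ⟶ U) (j : Y ⟶ O.Pos)
    (a : Y ⟶ T.total) (ha : a ≫ T.disp = pt (p ≫ D.pfst) j)
    (ha' : (k ≫ a) ≫ T.disp = pt ((k ▷ O.Pos ≫ p) ≫ D.pfst) (k ≫ j)) :
    k ▷ O.Pos ≫ D.glPiFn s p j a ha = D.glPiFn s (k ▷ O.Pos ≫ p) (k ≫ j) (k ≫ a) ha' := by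
  refine fn_ext fun W g m => ?_
  have e : (k ≫ pt (p ≫ D.pfst) (O.zero Y)) = pt ((k ▷ O.Pos ≫ p) ≫ D.pfst) (O.zero Z) := by
    rw [comp_pt, O.comp_zero, Category.assoc]
  rw [glPiFn, D.comp_piFn s k _ p j a _ ha (by rw [Category.comp_id, e]) ha', glPiFn]
  congr 2
  congr 1

/-- The computation rules of a global transport. -/
structure IsTransport (s : LTap O T (𝟙 U)) : Prop where
  bool : ∀ {Y : E} (p : Y ⊗ O.Pos ⟶ U) (i j : Y ⟶ O.Pos) (t : Y ⟶ T.total)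
    (ht : t ≫ T.disp = pt p i), p = toUnit _ ≫ c.bool → s.gl p i j t ht = t
  pi : ∀ {Y : E} (p : Y ⊗ O.Pos ⟶ U) (hp : p ≫ c.pi D.pfst D.psnd = p) (i j : Y ⟶ O.Pos)
    (t : Y ⟶ T.total) (ht : t ≫ T.disp = pt p i) (a : Y ⟶ T.total)
    (ha : a ≫ T.disp = pt (p ≫ D.pfst) j),
    D.app (pt p j) (s.gl p i j t ht) ((s.gl_disp _ _ _ _ _).trans (D.pi_of_path hp j)) a
        (ha.trans (pt_comp _ _ _)) =
      s.gl (D.glPiFn s p j a ha) i j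
        (D.app (pt p i) t (ht.trans (D.pi_of_path hp i)) (s.gl (p ≫ D.pfst) j i a ha)
          (by rw [s.gl_disp, pt_comp])) (by rw [app_disp, pt_glPiFn])
  eq : ∀ {Y : E} (p : Y ⊗ O.Pos ⟶ U) (hp : p ≫ c.eqCode D.ea D.eb D.eb_disp = p)
    (i j : Y ⟶ O.Pos) (t : Y ⟶ T.total) (ht : t ≫ T.disp = pt p i),
    IsConjugate (O.dist i j) (s.glSlide ((p ≫ D.ea) ≫ T.disp) (p ≫ D.ea) i j rfl)
      (s.glFn ((p ≫ D.ea) ≫ T.disp) i j (D.ptEqFn p hp i t ht) (ptEqFn_disp _ _ _ _ _))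
      (D.ptEqLen p hp i t ht) (s.glSlide ((p ≫ D.ea) ≫ T.disp) (p ≫ D.eb) i j (D.eb_path p))
      (D.ptEqFn p hp j (s.gl p i j t ht) (s.gl_disp _ _ _ _ _))
      (D.ptEqLen p hp j (s.gl p i j t ht) (s.gl_disp _ _ _ _ _))

/-- A function of `pi` codes starts at an instance of the single code `pi pfst psnd`, and a function
of `eq` codes at an instance of the code rebuilt from `ea` and `eb`. The recursion equations at
these universal codes therefore give the computation rules for all such functions, whatever their
starting point. -/
theorem exists_isTransport (hIR : c.IsInductiveRecursive) :
    ∃ s : LTap O T (𝟙 U), D.IsTransport s := by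
  obtain ⟨s, h1, h2, h3⟩ := hIR.exists_lTap D.boolTap (fun u f r s => D.piTap r s)
    (fun h u f r s => D.piTap_restr r s h) (fun u a b r => D.eqTap r)
    (fun h u a b r => D.eqTap_restr r h a b)
  refine ⟨s, fun {Y} p i j t ht hp => ?_, fun {Y} p hp i j t ht a ha => ?_,
    fun {Y} p hp i j t ht => ?_⟩
  · have hp' : pt p (O.zero Y) = toUnit Y ≫ c.bool := by
      rw [hp, pt, ← Category.assoc, comp_toUnit]
    rw [← s.restr_tr_eq_gl (toUnit Y) p i j t hp' ht, h1]
    rfl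
  -- The starting point `p 0` of the function is used as the base morphism into the universal `pi`
  -- code.
  · have e : s.gl p i j t ht =
        (D.piTap (s.restr D.pfst (Category.comp_id _)) (s.restr D.psnd (Category.comp_id _))).tr
          (pt p (O.zero Y)) p i j t (D.pi_of_path hp _) ht := by
      rw [← h2, s.restr_tr_eq_gl]
    refine (app_congr _ _ rfl e rfl).trans ((D.app_piTap _ _ _ _ _ _ _ _ _ _
      (ha.trans (pt_comp _ _ _))).trans ?_)
    rw [piVal, s.restr_tr_eq_gl]
    refine s.gl_congr _ ?_ rfl rfl ?_
    · exact cod_congr _ rfl (s.tr_congr _ _ (by rw [Category.assoc, ← pt_comp]) rfl rfl rfl rfl)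
    · exact app_congr _ _ rfl rfl (s.restr_tr_eq_gl _ _ _ _ _ _ _)
  · have hp' : pt p (O.zero Y) = pt p (O.zero Y) ≫ c.eq (D.ea ≫ T.disp) (T.ofTot D.ea rfl)
        (T.ofTot D.eb D.eb_disp) := by
      conv_lhs => rw [← hp, pt_comp]
      rfl
    have e : s.gl p i j t ht = (D.eqTap (s.restr (D.ea ≫ T.disp) (Category.comp_id _))).tr
          (pt p (O.zero Y)) p i j t hp' ht := by
      rw [← h3, s.restr_tr_eq_gl]
    have H := D.eqTap_spec (s.restr (D.ea ≫ T.disp) (Category.comp_id _)) (pt p (O.zero Y)) p i j t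
      hp' ht
    rw [LTap.restr_slide, LTap.restr_slide, LTap.restr_trFn] at H
    simp only [← e] at H
    have e' : pt p (O.zero Y) ≫ D.ea ≫ T.disp = pt ((p ≫ D.ea) ≫ T.disp) (O.zero Y) := by
      rw [pt_comp, pt_comp, Category.assoc]
    rw [s.slide_congr _ _ _ _ _ _ _ e' rfl rfl rfl rfl, s.slide_congr _ _ (p ≫ D.eb) _ _ _ _ e' rfl
      rfl rfl rfl, s.trFn_congr _ _ _ _ _ _ _ e' rfl rfl rfl rfl] at H
    exact H

end Codes.Decode

/-! ### Transport depends only on the interval along which it takes place -/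

section Seg

variable {C C' Y Z : E}

/-- The function `m ↦ p k`, where `k` moves from `i` to `j`. -/
noncomputable def seg (p : Y ⊗ O.Pos ⟶ C) (i j : Y ⟶ O.Pos) : Y ⊗ O.Pos ⟶ C :=
  lift (fst _ _) (O.toward (fst _ _ ≫ i) (fst _ _ ≫ j) (snd _ _)) ≫ p

theorem comp_seg (k : Z ⟶ Y) (p : Y ⊗ O.Pos ⟶ C) (i j : Y ⟶ O.Pos) :
    k ▷ O.Pos ≫ seg p i j = seg (k ▷ O.Pos ≫ p) (k ≫ i) (k ≫ j) := by
  have e : k ▷ O.Pos ≫ O.toward (fst _ _ ≫ i) (fst _ _ ≫ j) (snd _ _) =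
      O.toward (fst _ _ ≫ k ≫ i) (fst _ _ ≫ k ≫ j) (snd _ _) := by
    simp [RingOrder.comp_toward]
  rw [seg, seg, ← Category.assoc (k ▷ O.Pos), comp_lift, e, whiskerRight_fst,
    ← Category.assoc (lift _ _), lift_whiskerRight]

theorem pt_seg (p : Y ⊗ O.Pos ⟶ C) (i j m : Y ⟶ O.Pos) :
    pt (seg p i j) m = pt p (O.toward i j m) := by
  have e : lift (𝟙 Y) m ≫ O.toward (fst _ _ ≫ i) (fst _ _ ≫ j) (snd _ _) = O.toward i j m := by
    simp [RingOrder.comp_toward]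
  rw [seg, pt, ← Category.assoc, comp_lift, e, lift_fst, pt]

theorem seg_comp (p : Y ⊗ O.Pos ⟶ C) (i j : Y ⟶ O.Pos) (γ : C ⟶ C') :
    seg (p ≫ γ) i j = seg p i j ≫ γ := (Category.assoc _ _ _).symm

/-- The restrictions of `p` to the interval from `i` to `j` and of `p'` to the interval from `i'` to
`j'` agree. -/
structure SameSeg (p : Y ⊗ O.Pos ⟶ C) (i j : Y ⟶ O.Pos) (p' : Y ⊗ O.Pos ⟶ C)
    (i' j' : Y ⟶ O.Pos) : Prop where
  dist_eq : O.dist i j = O.dist i' j'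
  seg_eq : seg p i j = seg p' i' j'

namespace SameSeg

variable {p p' : Y ⊗ O.Pos ⟶ C} {i j i' j' : Y ⟶ O.Pos}

theorem stage (H : SameSeg p i j p' i' j') (k : Z ⟶ Y) :
    SameSeg (k ▷ O.Pos ≫ p) (k ≫ i) (k ≫ j) (k ▷ O.Pos ≫ p') (k ≫ i') (k ≫ j') :=
  ⟨by rw [← O.comp_dist, H.dist_eq, O.comp_dist], by rw [← comp_seg, H.seg_eq, comp_seg]⟩

theorem comp (H : SameSeg p i j p' i' j') (γ : C ⟶ C') :
    SameSeg (p ≫ γ) i j (p' ≫ γ) i' j' :=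
  ⟨H.dist_eq, by rw [seg_comp, H.seg_eq, seg_comp]⟩

theorem pt_toward (H : SameSeg p i j p' i' j') (m : Y ⟶ O.Pos) :
    pt p (O.toward i j m) = pt p' (O.toward i' j' m) := by
  rw [← pt_seg, H.seg_eq, pt_seg]

theorem pt_src (H : SameSeg p i j p' i' j') : pt p i = pt p' i' := by
  have := H.pt_toward (O.zero Y)
  rwa [RingOrder.toward_zero, RingOrder.toward_zero] at this

theorem pt_tgt (H : SameSeg p i j p' i' j') : pt p j = pt p' j' := by
  have := H.pt_toward (O.dist i j)
  rwa [RingOrder.toward_dist, H.dist_eq, RingOrder.toward_dist] at this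

theorem of_pt (hd : O.dist i j = O.dist i' j') (h : ∀ (Z : E) (k : Z ⟶ Y) (m : Z ⟶ O.Pos),
    pt (k ▷ O.Pos ≫ p) (O.toward (k ≫ i) (k ≫ j) m) =
      pt (k ▷ O.Pos ≫ p') (O.toward (k ≫ i') (k ≫ j') m)) : SameSeg p i j p' i' j' :=
  ⟨hd, fn_ext fun Z k m => by rw [comp_seg, comp_seg, pt_seg, pt_seg, h]⟩

/-- The final part of the interval, starting at `m`. -/
theorem rest (H : SameSeg p i j p' i' j') (m : Y ⟶ O.Pos) :
    SameSeg p (O.toward i j m) j p' (O.toward i' j' m) j' :=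
  of_pt (by rw [RingOrder.dist_toward, RingOrder.dist_toward, H.dist_eq]) fun Z k n => by
    rw [O.comp_toward, O.comp_toward, RingOrder.toward_toward, RingOrder.toward_toward,
      (H.stage k).pt_toward]

/-- The final part of the interval, reversed. -/
theorem rest_symm (H : SameSeg p i j p' i' j') (m : Y ⟶ O.Pos) :
    SameSeg p j (O.toward i j m) p' j' (O.toward i' j' m) :=
  of_pt (by rw [RingOrder.dist_comm' j, RingOrder.dist_comm' j', RingOrder.dist_toward,
    RingOrder.dist_toward, H.dist_eq]) fun Z k n => by
    rw [O.comp_toward, O.comp_toward, RingOrder.toward_toward_flip,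
      RingOrder.toward_toward_flip, (H.stage k).dist_eq, (H.stage k).pt_toward]

theorem symm_dir (H : SameSeg p i j p' i' j') : SameSeg p j i p' j' i' := by
  have := H.rest_symm (O.zero Y)
  rwa [RingOrder.toward_zero, RingOrder.toward_zero] at this

end SameSeg

end Seg

namespace LTap

variable (s : LTap O T (𝟙 U)) {X Y Z : E}

/-- Transports along functions that start at `x` only depend on the restriction of the function to
the interval. -/
def IsCoherent (x : X ⟶ U) : Prop :=
  ∀ (Y : E) (h : Y ⟶ X) (p p' : Y ⊗ O.Pos ⟶ U) (i j i' j' : Y ⟶ O.Pos) (t : Y ⟶ T.total)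
    (ht : t ≫ T.disp = pt p i) (ht' : t ≫ T.disp = pt p' i'), pt p (O.zero Y) = h ≫ x →
    SameSeg p i j p' i' j' → s.gl p i j t ht = s.gl p' i' j' t ht'

/-- Equality of two functions on the positive cone is a universal quantification over their
argument. -/
theorem rep_whisker_eq {A : E} (f g : X ⊗ O.Pos ⟶ A) :
    Rep fun {Y} (z : Y ⟶ X) => z ▷ O.Pos ≫ f = z ▷ O.Pos ≫ g := by
  refine (Rep.all O.Pos (Rep.eq f g)).of_iff fun {Y} z => ⟨fun H => fn_ext fun Z k m => ?_,
    fun H Z k m => ?_⟩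
  · rw [whisker_comp, whisker_comp, ← lift_comp_eq_pt, ← lift_comp_eq_pt]
    exact H Z k m
  · rw [lift_comp_eq_pt, lift_comp_eq_pt, ← whisker_comp, ← whisker_comp, H]

/-- Needed because induction is available only for representable predicates. `S` is the object of
pairs of transport problems with the same element and the same segment; coherence at `x` says that
the two generic solutions `v` and `v'` agree wherever the first function starts at `x`. -/
theorem rep_isCoherent : Rep fun {_} x => s.IsCoherent x := by
  let d := fst (TapData O T) (TapData O T)
  let d' := snd (TapData O T) (TapData O T)
  obtain ⟨S, hS⟩ := (Rep.eq (TapData.elt d ≫ T.disp) (pt (TapData.fn d) (TapData.src d))).and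
    ((Rep.eq (TapData.elt d' ≫ T.disp) (pt (TapData.fn d') (TapData.src d'))).and
    ((Rep.eq (TapData.elt d) (TapData.elt d')).and
    ((Rep.eq (O.dist (TapData.src d) (TapData.tgt d)) (O.dist (TapData.src d') (TapData.tgt d'))).and
    (rep_whisker_eq (seg (TapData.fn d) (TapData.src d) (TapData.tgt d))
      (seg (TapData.fn d') (TapData.src d') (TapData.tgt d'))))))
  have hS' : ∀ {Y : E} (e e' : Y ⟶ TapData O T), S.Factors (lift e e') ↔
      TapData.elt e ≫ T.disp = pt (TapData.fn e) (TapData.src e) ∧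
      TapData.elt e' ≫ T.disp = pt (TapData.fn e') (TapData.src e') ∧
      TapData.elt e = TapData.elt e' ∧
      O.dist (TapData.src e) (TapData.tgt e) = O.dist (TapData.src e') (TapData.tgt e') ∧
      seg (TapData.fn e) (TapData.src e) (TapData.tgt e) =
        seg (TapData.fn e') (TapData.src e') (TapData.tgt e') := by
    intro Y e e'
    rw [hS]
    simp only [← Category.assoc, comp_pt, comp_seg, O.comp_dist, ← TapData.fn_comp,
      ← TapData.src_comp, ← TapData.tgt_comp, ← TapData.elt_comp, d, d', lift_fst, lift_snd]
  let a : (S : E) ⟶ TapData O T := S.arrow ≫ d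
  let a' : (S : E) ⟶ TapData O T := S.arrow ≫ d'
  have ha : lift a a' = S.arrow := by ext <;> simp [a, a', d, d']
  obtain ⟨h1, h2, h3, h4, h5⟩ := (hS' a a').1 (by rw [ha]; exact S.factors_self)
  let v := s.gl (TapData.fn a) (TapData.src a) (TapData.tgt a) (TapData.elt a) h1
  let v' := s.gl (TapData.fn a') (TapData.src a') (TapData.tgt a') (TapData.elt a') h2
  refine (Rep.forall_over (pt (TapData.fn a) (O.zero _)) (Rep.eq v v')).of_iff
    fun {X} x => ⟨fun H Y h p p' i j i' j' t ht ht' hp hs => ?_, fun H Y h b hb => ?_⟩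
  · have hf : S.Factors (lift (TapData.mk p i j t) (TapData.mk p' i' j' t)) := by
      rw [hS']
      simp only [TapData.fn_mk, TapData.src_mk, TapData.tgt_mk, TapData.elt_mk]
      exact ⟨ht, ht', trivial, hs.1, hs.2⟩
    have e1 : S.factorThru _ hf ≫ a = TapData.mk p i j t := by
      rw [← Category.assoc, Subobject.factorThru_arrow, lift_fst]
    have e2 : S.factorThru _ hf ≫ a' = TapData.mk p' i' j' t := by
      rw [← Category.assoc, Subobject.factorThru_arrow, lift_snd]
    have key := H Y h (S.factorThru _ hf) (by
      rw [comp_pt, O.comp_zero, ← TapData.fn_comp, e1, TapData.fn_mk, hp])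
    rw [s.comp_gl, s.comp_gl] at key
    refine (s.gl_congr _ ?_ ?_ ?_ ?_).trans (key.trans (s.gl_congr _ ?_ ?_ ?_ ?_))
    · rw [← TapData.fn_comp, e1, TapData.fn_mk]
    · rw [← TapData.src_comp, e1, TapData.src_mk]
    · rw [← TapData.tgt_comp, e1, TapData.tgt_mk]
    · rw [← TapData.elt_comp, e1, TapData.elt_mk]
    · rw [← TapData.fn_comp, e2, TapData.fn_mk]
    · rw [← TapData.src_comp, e2, TapData.src_mk]
    · rw [← TapData.tgt_comp, e2, TapData.tgt_mk]
    · rw [← TapData.elt_comp, e2, TapData.elt_mk]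
  · rw [s.comp_gl, s.comp_gl]
    refine (H Y h _ _ _ _ _ _ _ _ (by
      rw [← disp_comp b h2, h3]) (by rw [← hb, comp_pt, O.comp_zero])
      (SameSeg.stage ⟨h4, h5⟩ b)).trans (s.gl_congr _ rfl rfl rfl (by rw [h3]))

namespace IsCoherent

variable {s} {x : X ⟶ U} (hx : s.IsCoherent x) {h : Y ⟶ X} {q q' : Y ⊗ O.Pos ⟶ U}
  {i j i' j' : Y ⟶ O.Pos}

include hx

/-- Each value of a slide is a transport along the rest of the segment, and the rests of equal
segments are equal. -/
theorem glSlide_eq {σ σ' : Y ⊗ O.Pos ⟶ T.total} (hq : pt q (O.zero Y) = h ≫ x)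
    (hσ : σ ≫ T.disp = q) (hσ' : σ' ≫ T.disp = q') (H : SameSeg q i j q' i' j')
    (H' : SameSeg σ i j σ' i' j') : s.glSlide q σ i j hσ = s.glSlide q' σ' i' j' hσ' := by
  refine fn_ext fun Z k m => ?_
  rw [s.comp_glSlide, s.comp_glSlide, s.pt_glSlide, s.pt_glSlide]
  refine (hx Z (k ≫ h) _ _ _ _ _ _ _ _ ?_ (start_comp k hq) ((H.stage k).rest m)).trans
    (s.gl_congr _ rfl rfl rfl ((H'.stage k).pt_toward m))
  rw [(H'.stage k).pt_toward, ← pt_comp, Category.assoc, hσ']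

theorem glFn_eq {g : Y ⊗ O.Pos ⟶ T.total} (hq : pt q (O.zero Y) = h ≫ x)
    (hg : g ≫ T.disp = fst _ _ ≫ pt q i) (hg' : g ≫ T.disp = fst _ _ ≫ pt q' i')
    (H : SameSeg q i j q' i' j') : s.glFn q i j g hg = s.glFn q' i' j' g hg' := by
  refine fn_ext fun Z k m => ?_
  rw [s.comp_glFn, s.comp_glFn, s.pt_glFn, s.pt_glFn]
  exact hx Z (k ≫ h) _ _ _ _ _ _ _ _ _ (start_comp k hq) (H.stage k)

end IsCoherent

end LTap

namespace Codes.Decode.IsTransport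

variable {c : Codes O 𝔹 T} {D : Decode c} {s : LTap O T (𝟙 U)} {X Y Z : E}

theorem coherent_bool (hs : D.IsTransport s) : s.IsCoherent c.bool := by
  intro Y h p p' i j i' j' t ht ht' hp H
  have e := D.path_bool p (O.zero Y) (hp.trans (congrArg (· ≫ c.bool) (toUnit_unique _ _)))
  have e' := D.path_bool p' i' (H.pt_src.symm.trans (by
    rw [e, pt, ← Category.assoc, comp_toUnit]))
  rw [hs.bool p i j t ht e, hs.bool p' i' j' t ht' e']

/-- By extensionality it is enough to apply both sides to an argument `a` over the end of the
segment. Coherence at `u` for the reversed segment makes the arguments transported back agree.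
Coherence at `u` for its reversed final parts shows that the two functions of codomains have the
same segment. Coherence at `f` finishes the comparison. -/
theorem coherent_pi (hs : D.IsTransport s) {Γ : E} (u : Γ ⟶ U) (f : T.ext u ⟶ U)
    (hu : s.IsCoherent u) (hf : s.IsCoherent f) : s.IsCoherent (c.pi u f) := by
  intro Y h p p' i j i' j' t ht ht' hp H
  have e := D.path_pi u f h p _ hp
  -- Nothing is assumed about the start of `p'`, but at the source of the segment it meets a `pi`
  -- code of `p`, so all its codes are `pi` codes.
  have e' := D.path_pi D.pfst D.psnd (pt p i) p' i'
    (H.pt_src.symm.trans (D.pi_of_path e i))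
  have main : ∀ (Z : E) (k : Z ⟶ Y) (a : Z ⟶ T.total)
      (ha : a ≫ T.disp = pt ((k ▷ O.Pos ≫ p) ≫ D.pfst) (k ≫ j))
      (ha' : a ≫ T.disp = pt ((k ▷ O.Pos ≫ p') ≫ D.pfst) (k ≫ j')),
      D.app (pt (k ▷ O.Pos ≫ p) (k ≫ j)) (k ≫ s.gl p i j t ht)
        (by rw [Category.assoc, s.gl_disp, ← D.pi_of_path (by rw [Category.assoc, e]), comp_pt])
        a (ha.trans (pt_comp _ _ _)) =
      D.app (pt (k ▷ O.Pos ≫ p') (k ≫ j')) (k ≫ s.gl p' i' j' t ht')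
        (by rw [Category.assoc, s.gl_disp, ← D.pi_of_path (by rw [Category.assoc, e']), comp_pt])
        a (ha'.trans (pt_comp _ _ _)) := by
    intro Z k a ha ha'
    have Hk := H.stage k
    have hk := LTap.start_comp k hp
    have hpk : pt ((k ▷ O.Pos ≫ p) ≫ D.pfst) (O.zero Z) = (k ≫ h) ≫ u := start_pfst hk
    have ek : (k ▷ O.Pos ≫ p) ≫ c.pi D.pfst D.psnd = k ▷ O.Pos ≫ p := by rw [Category.assoc, e]
    have ek' : (k ▷ O.Pos ≫ p') ≫ c.pi D.pfst D.psnd = k ▷ O.Pos ≫ p' := by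
      rw [Category.assoc, e']
    refine (app_congr _ _ rfl (s.comp_gl _ _ _ _ _ _) rfl).trans ((hs.pi _ ek _ _ _ _ a ha).trans
      (Eq.trans ?_ ((hs.pi _ ek' _ _ _ (LTap.disp_comp k ht') a ha').symm.trans
        (app_congr _ _ rfl (s.comp_gl _ _ _ _ _ _).symm rfl))))
    have happ := app_congr (D := D) ((LTap.disp_comp k ht).trans (D.pi_of_path ek _))
      (by rw [s.gl_disp, pt_comp]) Hk.pt_src rfl
      (hu Z (k ≫ h) _ _ _ _ _ _ a ha ha' hpk (Hk.comp D.pfst).symm_dir)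
    refine (s.gl_congr _ rfl rfl rfl happ).trans ?_
    -- The function of codomains along `p` starts at the value of `f` at `a` transported back to
    -- `0`; this is the base point for coherence at `f`.
    refine hf Z (T.mkExt u (k ≫ h) (s.gl ((k ▷ O.Pos ≫ p) ≫ D.pfst) (k ≫ j) (O.zero Z) a ha)
      (by rw [s.gl_disp, hpk])) _ _ _ _ _ _ _ _ _ ?_ (SameSeg.of_pt Hk.dist_eq ?_)
    · rw [D.pt_glPiFn]
      exact (cod_congr _ hk rfl).trans (D.pi_psnd u f (k ≫ h) _ _ _)
    · intro W g m
      have Hg := Hk.stage g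
      have hg := LTap.start_comp g hpk
      rw [D.comp_glPiFn s g _ _ a ha ((LTap.disp_comp g ha).trans
          (congrArg (pt · _) (Category.assoc _ _ _).symm)),
        D.comp_glPiFn s g _ _ a ha' ((LTap.disp_comp g ha').trans
          (congrArg (pt · _) (Category.assoc _ _ _).symm)),
        D.pt_glPiFn, D.pt_glPiFn]
      refine cod_congr _ (Hg.pt_toward m) (hu W (g ≫ k ≫ h) _ _ _ _ _ _ _ _ _ ?_
        ((Hg.comp D.pfst).rest_symm m))
      exact (congrArg (pt · _) (Category.assoc _ _ _)).trans hg
  refine D.app_ext (pt p j) ((s.gl_disp _ _ _ _ _).trans (D.pi_of_path e j))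
    ((s.gl_disp _ _ _ _ _).trans (H.pt_tgt.symm.trans (D.pi_of_path e j))) fun Z k a ha => ?_
  refine (app_congr _ _ (comp_pt _ _ _) rfl rfl).trans ((main Z k a ?_ ?_).trans
    (app_congr _ _ (by rw [← comp_pt, H.pt_tgt]) rfl rfl))
  · rw [ha, D.pt_pfst]
  · rw [ha, H.pt_tgt, D.pt_pfst]

/-- Both results are conjugates. The distances agree, the slides and the transported path agree by
coherence at `u`, and conjugates are unique. -/
theorem coherent_eq (hs : D.IsTransport s) {Γ : E} (u : Γ ⟶ U) (a b : T.El u)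
    (hu : s.IsCoherent u) : s.IsCoherent (c.eq u a b) := by
  intro Y h p p' i j i' j' t ht ht' hp H
  have e := D.path_eq' hp
  have e' : p' ≫ c.eqCode D.ea D.eb D.eb_disp = p' :=
    D.path_eq (D.ea ≫ T.disp) (T.ofTot D.ea rfl) (T.ofTot D.eb D.eb_disp) (pt p i) p' i'
      (H.pt_src.symm.trans
        (show pt p i = pt p i ≫ c.eqCode D.ea D.eb D.eb_disp by rw [← pt_comp, e]))
  have Hq := (H.comp D.ea).comp T.disp
  have hq : pt ((p ≫ D.ea) ≫ T.disp) (O.zero Y) = h ≫ u := start_ea hp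
  have hfn := ptEqFn_ptEqLen_congr p e i t ht e' ht' H.pt_src rfl
  obtain ⟨h1, h2⟩ := (hs.eq p e i j t ht).unique (hs.eq p' e' i' j' t ht') H.dist_eq
    (hu.glSlide_eq hq rfl rfl Hq (H.comp D.ea))
    ((hu.glFn_eq hq (ptEqFn_disp _ _ _ _ _) ((ptEqFn_disp _ _ _ _ _).trans (by rw [Hq.pt_src]))
      Hq).trans (s.trFn_congr _ _ _ _ _ _ _ rfl rfl rfl rfl hfn.1)) hfn.2
    (hu.glSlide_eq hq (D.eb_path p) (D.eb_path p') Hq (H.comp D.eb))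
  have hj := ptEqFn_ptEqLen_congr p' e' j' (s.gl p' i' j' t ht') (s.gl_disp _ _ _ _ _) e
    ((s.gl_disp _ _ _ _ _).trans H.pt_tgt.symm) H.pt_tgt.symm rfl
  exact ptEq_ext _ _ _ _ _ (h1.trans hj.1) (h2.trans hj.2)

theorem coherent (hs : D.IsTransport s) (hIR : c.IsInductiveRecursive) (x : X ⟶ U) :
    s.IsCoherent x :=
  hIR.induction s.rep_isCoherent hs.coherent_bool hs.coherent_pi hs.coherent_eq x

end Codes.Decode.IsTransport

/-! ### Segments of paths and the tap structure of a global transport -/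

section PathSegments

variable {C Y : E} (p : Y ⊗ O.Pos ⟶ C) (l m : Y ⟶ O.Pos)

theorem pt_lift (k : Y ⊗ O.Pos ⟶ O.Pos) (i : Y ⟶ O.Pos) :
    pt (lift (fst _ _) k ≫ p) i = pt p (pt k i) := by
  simp [pt, comp_lift_assoc]

/-- The final segment of a path starting at `min m l` agrees with its re-parametrization. -/
theorem sameSeg_onward {n : Y ⟶ O.Pos} (hn : n = O.monus l m) :
    SameSeg p (O.toward (O.zero Y) l m) l
      (lift (fst _ _) (O.monus (fst _ _ ≫ l) (O.min (O.monus (fst _ _ ≫ n) (snd _ _))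
        (fst _ _ ≫ n))) ≫ p) (O.zero Y) n := by
  subst hn
  refine SameSeg.of_pt ?_ fun Z k j => ?_
  · rw [RingOrder.dist_toward, RingOrder.zero_dist, RingOrder.zero_dist]
  · have e : k ▷ O.Pos ≫ lift (fst _ _) (O.monus (fst _ _ ≫ l) (O.min (O.monus (fst _ _ ≫ O.monus l m)
        (snd _ _)) (fst _ _ ≫ O.monus l m))) ≫ p = lift (fst _ _) (O.monus (fst _ _ ≫ k ≫ l)
          (O.min (O.monus (fst _ _ ≫ O.monus (k ≫ l) (k ≫ m)) (snd _ _))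
            (fst _ _ ≫ O.monus (k ≫ l) (k ≫ m)))) ≫ k ▷ O.Pos ≫ p := by
      simp [comp_lift_assoc, RingOrder.comp_min, RingOrder.comp_monus]
    rw [e, pt_lift, O.comp_toward, O.comp_monus, O.comp_zero, RingOrder.toward_toward,
      RingOrder.zero_toward, RingOrder.zero_toward]
    congr 1
    simp only [pt, RingOrder.comp_monus, RingOrder.comp_min, lift_fst_assoc, lift_snd,
      Category.id_comp]
    -- Both points are `min (m + j) l`: the re-parametrized side reduces to `l ∸ ((l ∸ m) ∸ j) = l ∸
    -- (l ∸ (m + j))`.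
    rw [RingOrder.min_eq_left (RingOrder.monus_le _ _), RingOrder.monus_min,
      RingOrder.monus_monus_eq, RingOrder.monus_monus, RingOrder.min_comm']

/-- The segment of a path from its end to `min m l` agrees with its re-parametrization. -/
theorem sameSeg_upto_rev {n : Y ⟶ O.Pos} (hn : n = O.monus l m) :
    SameSeg p l (O.toward (O.zero Y) l m)
      (lift (fst _ _) (O.monus (fst _ _ ≫ l) (O.min (snd _ _) (fst _ _ ≫ n))) ≫ p)
      (O.zero Y) n := by
  subst hn
  refine SameSeg.of_pt ?_ fun Z k j => ?_
  · rw [RingOrder.dist_comm', RingOrder.dist_toward, RingOrder.zero_dist, RingOrder.zero_dist]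
  · have e : k ▷ O.Pos ≫ lift (fst _ _) (O.monus (fst _ _ ≫ l) (O.min (snd _ _)
        (fst _ _ ≫ O.monus l m))) ≫ p = lift (fst _ _) (O.monus (fst _ _ ≫ k ≫ l)
          (O.min (snd _ _) (fst _ _ ≫ O.monus (k ≫ l) (k ≫ m)))) ≫ k ▷ O.Pos ≫ p := by
      simp [comp_lift_assoc, RingOrder.comp_min, RingOrder.comp_monus]
    rw [e, pt_lift, O.comp_toward, O.comp_monus, O.comp_zero, RingOrder.toward_toward_flip,
      RingOrder.zero_toward, RingOrder.zero_toward, RingOrder.zero_dist]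
    congr 1
    simp only [pt, RingOrder.comp_monus, RingOrder.comp_min, lift_fst_assoc, lift_snd,
      Category.id_comp]
    rw [RingOrder.min_eq_left (RingOrder.monus_le _ _),
      RingOrder.min_eq_left (RingOrder.min_le_right _ _)]

/-- A path agrees with its reverse, traversed backwards. -/
theorem sameSeg_flip : SameSeg p l (O.zero Y) (flip p l) (O.zero Y) l := by
  refine SameSeg.of_pt (RingOrder.dist_comm' _ _) fun Z k j => ?_
  rw [comp_flip, flip, pt_lift, O.comp_zero, RingOrder.toward_zero_right, RingOrder.zero_toward]
  congr 1
  simp only [pt, RingOrder.comp_monus, lift_fst_assoc, lift_snd, Category.id_comp]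
  rw [RingOrder.monus_min]

end PathSegments

namespace LTap

variable (s : LTap O T (𝟙 U)) {X Y Γ : E}

/-- The tap structure given by transport from `0` to the length of a path. -/
noncomputable def tap : Tap O T.toFam where
  tr {_ _ _} p a := T.ofTot (s.gl p.fn (O.zero _) p.len (T.tot a)
    ((Ty.tot_disp a).trans p.at_zero.symm)) ((s.gl_disp _ _ _ _ _).trans p.at_len)
  tr_restr {_ _} h {_ _} _ _ := Ty.tot_injective
    ((Ty.tot_restr _ _ _).trans ((congrArg (h ≫ ·) (Ty.tot_ofTot _ _)).trans
      ((s.comp_gl _ _ _ _ _ _).trans ((s.gl_congr _ rfl (O.comp_zero h) rfl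
        (Ty.tot_restr _ _ _).symm).trans (Ty.tot_ofTot _ _).symm))))
  tr_idp _ _ := Ty.tot_injective ((Ty.tot_ofTot _ _).trans (s.gl_self _ _ _ _))

theorem tot_tap {x y : X ⟶ U} (p : Path O x y) (a : T.El x) : T.tot (s.tap.tr p a) =
    s.gl p.fn (O.zero X) p.len (T.tot a) ((Ty.tot_disp a).trans p.at_zero.symm) :=
  Ty.tot_ofTot (s.gl p.fn (O.zero X) p.len (T.tot a) ((Ty.tot_disp a).trans p.at_zero.symm))
    ((s.gl_disp _ _ _ _ _).trans p.at_len)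

end LTap

section Comp

variable {Γ X : E} {A : Ty.{v, u} Γ} {x : X ⟶ Γ} {a b d : A.El x}

theorem isConcat_comp (p : MoorePath O A.toFam a b) (q : MoorePath O A.toFam b d) :
    IsConcat (A.tot p.fn) p.len (A.tot q.fn) (A.tot (p.comp q).fn) := by
  obtain ⟨-, h1, h2⟩ := (MoorePath.exists_comp p q).choose_spec
  refine ⟨fun Y k j hj => ?_, fun Y k j hj => ?_⟩
  · have := congrArg A.tot (h1 Y k j hj)
    rwa [Ty.tot_restr, Ty.tot_restr] at this
  · have := congrArg A.tot (h2 Y k j hj)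
    rwa [Ty.tot_restr, Ty.tot_restr] at this

theorem len_comp (p : MoorePath O A.toFam a b) (q : MoorePath O A.toFam b d) :
    (p.comp q).len = O.add p.len q.len := (MoorePath.exists_comp p q).choose_spec.1

/-- Translates the composite in the definition of `idTransport` into the relation that characterizes
transport in `eqTap`. Both outer paths must have the same shape, as they do there, where it is the
shape of the base path. -/
theorem isConjugate_comp {a' : A.El x} (p : MoorePath O A.toFam a a') (q : MoorePath O A.toFam a b)
    (r : MoorePath O A.toFam b d) (h : r.len = p.len) : IsConjugate p.len (A.tot p.fn) (A.tot q.fn)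
      q.len (A.tot r.fn) (A.tot ((p.rev.comp q).comp r).fn) ((p.rev.comp q).comp r).len := by
  have h1 := isConcat_comp p.rev q
  have h2 := isConcat_comp (p.rev.comp q) r
  have hr : A.tot p.rev.fn = flip (A.tot p.fn) p.len := Ty.tot_restr _ _ _
  rw [hr] at h1
  rw [len_comp] at h2
  refine ⟨_, h1, h2, ?_⟩
  rw [len_comp, len_comp, h]
  rfl

end Comp

namespace Codes.Decode

variable {c : Codes O 𝔹 T} (D : Decode c) {Γ X : E}

/-- Rebuilding a `pi` code returns it: this is the statement about functions of codes, applied to a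
constant function. -/
theorem pi_pi (u : Γ ⟶ U) (f : T.ext u ⟶ U) : c.pi u f ≫ c.pi D.pfst D.psnd = c.pi u f := by
  have := D.pi_of_path (D.path_pi u f (𝟙 Γ) (fst _ _ ≫ c.pi u f) (O.zero Γ)
    (by rw [lift_fst_assoc])) (O.zero Γ)
  rwa [pt_fst, eq_comm] at this

/-- Identifies application as phrased in the universe conditions, through the given `u` and `f`,
with application through the destructors. The destructors recover `u` and `f`, and decoding is
natural. -/
theorem tot_appAt_piAt (u : Γ ⟶ U) (f : T.ext u ⟶ U) (x : X ⟶ Γ) (t : T.El (x ≫ c.pi u f))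
    (a : T.El (x ≫ u)) : T.tot (appAt u f x (c.piAt u f x t) a) =
      D.app (x ≫ c.pi u f) (T.tot t) (by rw [Ty.tot_disp, Category.assoc, D.pi_pi]) (T.tot a)
        (by rw [Ty.tot_disp, Category.assoc, D.pi_pfst]) := by
  have e : T.restr (𝟙 X) ((Category.id_comp _).trans (c.pi_comp x u f)) t =
      T.ofTot (T.tot t) ((Ty.tot_disp t).trans (c.pi_comp x u f)) :=
    Ty.tot_injective ((Ty.tot_restr _ _ _).trans ((Category.id_comp _).trans
      (Ty.tot_ofTot _ _).symm))
  have h1 : T.tot (appAt u f x (c.piAt u f x t) a) = c.papp (x ≫ u) (T.extMap x u ≫ f) (T.tot t)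
      ((Ty.tot_disp t).trans (c.pi_comp x u f)) (𝟙 X) (T.tot a)
      ((Ty.tot_disp a).trans (Category.id_comp _).symm) := by
    rw [appAt, Ty.tot_restr, Codes.piAt, e, Ty.pair_eq_mkExt, papp]
    congr 1
    exact Ty.mkExt_congr _ _ rfl ((Ty.tot_restr _ _ _).trans (Category.id_comp _))
  refine h1.trans (papp_congr _ _ ?_ (fun k b h h' => ?_) rfl _ _ rfl rfl)
  · rw [Category.assoc, D.pi_pfst]
  · have h2 := Ty.mkExt_extMap (x ≫ c.pi u f) D.pfst k b h'
    have h3 := D.pi_psnd u f (k ≫ x) b (h'.trans (by simp only [Category.assoc]))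
      (h.trans (Category.assoc _ _ _).symm)
    rw [← Category.assoc, Ty.mkExt_extMap, ← h3, ← Category.assoc (T.mkExt _ _ _ h'), h2]
    congr 1
    exact Ty.mkExt_congr _ _ (Category.assoc _ _ _) rfl

end Codes.Decode

/-! ### The tap structure of the universe -/

namespace LTap

variable (s : LTap O T (𝟙 U)) {Y : E}

theorem glSlide_congr {q q' : Y ⊗ O.Pos ⟶ U} {σ σ' : Y ⊗ O.Pos ⟶ T.total} {i j : Y ⟶ O.Pos}
    (hσ : σ ≫ T.disp = q) (eq : q = q') (eσ : σ = σ') :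
    s.glSlide q σ i j hσ = s.glSlide q' σ' i j (eσ ▸ eq ▸ hσ) := by
  subst eq eσ
  rfl

theorem glFn_congr {q q' : Y ⊗ O.Pos ⟶ U} {g g' : Y ⊗ O.Pos ⟶ T.total} {i j : Y ⟶ O.Pos}
    (hg : g ≫ T.disp = fst _ _ ≫ pt q i) (eq : q = q') (eg : g = g') :
    s.glFn q i j g hg = s.glFn q' i j g' (eg ▸ eq ▸ hg) := by
  subst eq eg
  rfl

end LTap

namespace Codes.Decode.IsTransport

variable {c : Codes O 𝔹 T} {D : Decode c} {s : LTap O T (𝟙 U)} (hs : D.IsTransport s)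
  {Γ X Y : E}

include hs

theorem gl_eq_of_sameSeg (hIR : c.IsInductiveRecursive) {p p' : Y ⊗ O.Pos ⟶ U}
    {i j i' j' : Y ⟶ O.Pos} {t t' : Y ⟶ T.total} (ht : t ≫ T.disp = pt p i) (et : t = t')
    (H : SameSeg p i j p' i' j') :
    s.gl p i j t ht = s.gl p' i' j' t' (et ▸ ht.trans H.pt_src) := by
  subst et
  exact hs.coherent hIR (𝟙 U) Y (pt p (O.zero Y)) _ _ _ _ _ _ _ _ _ (Category.comp_id _).symm H

theorem tap_bool (p : Path O (toUnit X) (toUnit X)) (t : T.El (toUnit X ≫ c.bool)) :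
    s.tap.tr (p.map c.bool) t = t := by
  refine Ty.tot_injective ((s.tot_tap _ _).trans (hs.bool _ _ _ _ _ ?_))
  exact congrArg (· ≫ c.bool) (toUnit_unique p.fn _)

/-- The path of codes along which values of functions are transported. -/
theorem sameSeg_liftPath (hIR : c.IsInductiveRecursive) (u : Γ ⟶ U) (f : T.ext u ⟶ U)
    {x y : X ⟶ Γ} (p : Path O x y) (a : T.El (y ≫ u))
    (ha : T.tot a ≫ T.disp = pt ((p.fn ≫ c.pi u f) ≫ D.pfst) p.len) :
    SameSeg (D.glPiFn s (p.fn ≫ c.pi u f) p.len (T.tot a) ha) (O.zero X) p.len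
      ((MoorePath.rev (liftPath s.tap u (MoorePath.rev p) a)).fn ≫ f) (O.zero X) p.len := by
  refine SameSeg.of_pt rfl fun Z k m => ?_
  let p' : Path O y x := MoorePath.rev p
  -- The body of the bounded abstraction that defines the lift of `rev p` at `a`. At `m` the
  -- reversed lift evaluates it at `|p| ∸ m`.
  let W : X ⊗ O.Pos ⟶ T.ext u := T.pair u ((p'.stage (fst X O.Pos)).pt (snd X O.Pos))
    (s.tap.tr (((p'.stage (fst X O.Pos)).upto (snd X O.Pos)).map u)
      (T.restr (fst X O.Pos) (Category.assoc _ _ _).symm a))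
  have ha' := LTap.disp_comp k ha
  rw [← Category.assoc] at ha'
  have hW : pt (k ▷ O.Pos ≫ (MoorePath.rev (liftPath s.tap u (MoorePath.rev p) a)).fn ≫ f)
      (O.toward (O.zero Z) (k ≫ p.len) m) = (lift k (O.monus (k ≫ p.len) m) ≫ W) ≫ f := by
    rw [← lift_comp_eq_pt, RingOrder.zero_toward]
    change lift k (O.min m (k ≫ p.len)) ≫ (lift (fst _ _) (O.monus (fst _ _ ≫ p.len) (snd _ _)) ≫
      lift (fst _ _) (O.min (snd _ _) (fst _ _ ≫ p.len)) ≫ W) ≫ f = _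
    simp only [comp_lift_assoc, RingOrder.comp_monus, RingOrder.comp_min, lift_fst, lift_snd,
      lift_fst_assoc, Category.assoc]
    rw [RingOrder.monus_min, RingOrder.min_eq_left (RingOrder.monus_le _ _)]
  have hpt : lift k (O.monus (k ≫ p.len) m) ≫ (p'.stage (fst X O.Pos)).pt (snd X O.Pos) =
      pt (k ▷ O.Pos ≫ p.fn) (O.toward (O.zero Z) (k ≫ p.len) m) := by
    rw [← lift_comp_eq_pt, RingOrder.zero_toward]
    change lift k (O.monus (k ≫ p.len) m) ≫ lift (𝟙 _) (snd _ _) ≫ fst _ _ ▷ O.Pos ≫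
      lift (fst _ _) (O.monus (fst _ _ ≫ p.len) (snd _ _)) ≫ p.fn = _
    simp only [comp_lift_assoc, RingOrder.comp_monus, lift_fst, lift_snd,
      lift_fst_assoc, Category.id_comp, lift_whiskerRight_assoc]
    rw [RingOrder.monus_monus, RingOrder.min_comm']
  have hcod : pt (k ▷ O.Pos ≫ p.fn ≫ c.pi u f) (O.toward (O.zero Z) (k ≫ p.len) m) =
      pt (k ▷ O.Pos ≫ p.fn) (O.toward (O.zero Z) (k ≫ p.len) m) ≫ c.pi u f := by
    rw [← Category.assoc, pt_comp]
  have hu : (k ▷ O.Pos ≫ p.fn ≫ c.pi u f) ≫ D.pfst = (k ▷ O.Pos ≫ p.fn) ≫ u := by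
    simp only [Category.assoc, D.pi_pfst]
  -- Transport along the part of `rev p` up to `|p| ∸ m` follows the segment of `p` from `|p|` back
  -- to `min m |p|`, so coherence equates it with the argument carried along `p` itself.
  have H := sameSeg_upto_rev ((k ▷ O.Pos ≫ p.fn) ≫ u) (k ≫ p.len) m rfl
  rw [O.comp_zero, hW, D.comp_glPiFn s k _ _ _ ha ha', D.pt_glPiFn]
  refine (cod_congr _ hcod rfl).trans ((D.pi_psnd u f _ _ _ ?_).trans (congrArg (· ≫ f) ?_))
  · rw [s.gl_disp, hu, pt_comp]
  simp only [W]
  rw [Ty.pair_eq_mkExt, Ty.comp_mkExt]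
  refine Ty.mkExt_congr _ _ hpt.symm ?_
  rw [s.tot_tap, s.comp_gl]
  refine (hs.gl_eq_of_sameSeg hIR _ rfl (by rw [hu]; exact H)).trans (s.gl_congr _ ?_ ?_ ?_ ?_)
  · change _ = lift k (O.monus (k ≫ p.len) m) ▷ O.Pos ≫ (lift (fst _ _) (O.min (snd _ _)
      (fst _ _ ≫ O.min (fst _ _ ≫ p.len) (snd _ _))) ≫ fst _ _ ▷ O.Pos ≫
        lift (fst _ _) (O.monus (fst _ _ ≫ p.len) (snd _ _)) ≫ p.fn) ≫ u
    simp [comp_lift_assoc, RingOrder.comp_monus, RingOrder.comp_min,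
      RingOrder.min_eq_right (RingOrder.monus_le _ _)]
  · rw [O.comp_zero]
  · change _ = lift k (O.monus (k ≫ p.len) m) ≫ O.min (fst _ _ ≫ p.len) (snd _ _)
    simp only [RingOrder.comp_min, lift_fst_assoc, lift_snd]
    exact (RingOrder.min_eq_right (RingOrder.monus_le _ _)).symm
  · rw [Ty.tot_restr, lift_fst_assoc]

/-- The computation rule for products differs from `piTransport` in two places: the function of
codomains is read along `p` instead of along the reversed lift, and the argument is carried back
along `p` instead of forwards along `rev p`. Coherence removes both differences. -/
theorem tap_pi (hIR : c.IsInductiveRecursive) (u : Γ ⟶ U) (f : T.ext u ⟶ U) {x y : X ⟶ Γ}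
    (p : Path O x y) (t : T.El (x ≫ c.pi u f)) (a : T.El (y ≫ u)) :
    appAt u f y (c.piAt u f y (s.tap.tr (p.map (c.pi u f)) t)) a =
      piTransport s.tap s.tap u f p (c.piAt u f x t) a := by
  have h0 : pt (p.fn ≫ c.pi u f) (O.zero X) = x ≫ c.pi u f :=
    (pt_comp _ _ _).trans (congrArg (· ≫ c.pi u f) p.at_zero)
  have hl : pt (p.fn ≫ c.pi u f) p.len = y ≫ c.pi u f :=
    (pt_comp _ _ _).trans (congrArg (· ≫ c.pi u f) p.at_len)
  have hP := D.path_pi u f x (p.fn ≫ c.pi u f) (O.zero X) h0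
  have hu : (p.fn ≫ c.pi u f) ≫ D.pfst = p.fn ≫ u := by rw [Category.assoc, D.pi_pfst]
  have ha : T.tot a ≫ T.disp = pt ((p.fn ≫ c.pi u f) ≫ D.pfst) p.len := by
    rw [Ty.tot_disp, hu, pt_comp]
    exact congrArg (· ≫ u) p.at_len.symm
  have H := (sameSeg_flip p.fn p.len).comp u
  refine Ty.tot_injective ((D.tot_appAt_piAt u f y _ a).trans
    ((app_congr _ _ hl.symm (s.tot_tap _ _) rfl).trans ((hs.pi _ hP _ _ _ _ _ ha).trans ?_)))
  refine (hs.gl_eq_of_sameSeg hIR _ ?_ (hs.sameSeg_liftPath hIR u f p a ha)).trans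
    (s.tot_tap (Path.map (MoorePath.rev (liftPath s.tap u (MoorePath.rev p) a)) f) _).symm
  refine Eq.trans ?_ (D.tot_appAt_piAt u f x t _).symm
  refine app_congr _ _ h0 rfl (Eq.trans ?_ (s.tot_tap _ _).symm)
  -- The argument: going along `p` from `|p|` to `0` is going along `rev p` from `0` to `|p|`.
  refine hs.gl_eq_of_sameSeg hIR _ rfl ?_
  rw [hu]
  exact H

/-- Decoding through the given `u`, `a`, `b` agrees with decoding through the destructors at any
argument `i` where a function `P` of `eq` codes passes through this code. -/
theorem tot_eqAt (u : Γ ⟶ U) (a b : T.El u) (x : X ⟶ Γ) (t : T.El (x ≫ c.eq u a b))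
    {P : X ⊗ O.Pos ⟶ U} (hP : P ≫ c.eqCode D.ea D.eb D.eb_disp = P) (i : X ⟶ O.Pos)
    (h : pt P i = x ≫ c.eq u a b) :
    T.tot (c.eqAt u a b x t).fn = D.ptEqFn P hP i (T.tot t) ((Ty.tot_disp t).trans h.symm) ∧
      (c.eqAt u a b x t).len = D.ptEqLen P hP i (T.tot t) ((Ty.tot_disp t).trans h.symm) := by
  refine c.eqEquiv_congr ?_ ?_ ?_ ?_
  · rw [h, Category.assoc, Category.assoc, reassoc_of% D.eq_ea, Ty.tot_disp]
  · refine Eq.trans ?_ (Ty.tot_ofTot _ _).symm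
    rw [Ty.tot_restr, h, Category.assoc, D.eq_ea]
  · refine Eq.trans ?_ (Ty.tot_ofTot _ _).symm
    rw [Ty.tot_restr, h, Category.assoc, D.eq_eb]
  · exact (Ty.tot_restr _ _ _).trans ((Category.id_comp _).trans (Ty.tot_ofTot _ _).symm)

/-- At `m`, `apd` transports along the `onward` path from `min m |p|`, which is a re-parametrization
of the segment of `p` from there to `|p|`. The slide transports along that segment itself, so
coherence applies at every point. -/
theorem tot_apd (hIR : c.IsInductiveRecursive) {u : Γ ⟶ U} (a : T.El u) {x y : X ⟶ Γ}
    (p : Path O x y) (hσ : (p.fn ≫ T.tot a) ≫ T.disp = p.fn ≫ u) :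
    T.tot (apd s.tap a p).fn = s.glSlide (p.fn ≫ u) (p.fn ≫ T.tot a) (O.zero X) p.len hσ := by
  -- The re-parametrization `m ↦ min m |p|` built into bounded abstraction.
  let κ : X ⊗ O.Pos ⟶ X ⊗ O.Pos := lift (fst _ _) (O.min (snd _ _) (fst _ _ ≫ p.len))
  have hn : O.min (fst X O.Pos ≫ p.len) (O.monus (fst X O.Pos ≫ p.len) (snd X O.Pos)) =
      O.monus (fst X O.Pos ≫ p.len) (snd X O.Pos) :=
    RingOrder.min_eq_right (RingOrder.monus_le _ _)
  have H := sameSeg_onward (fst X O.Pos ▷ O.Pos ≫ p.fn ≫ u) (fst X O.Pos ≫ p.len) (snd X O.Pos) rfl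
  refine Eq.trans ?_ (s.tr_eq_gl _ _ _ _ _ _ _).symm
  have h1 : T.tot (apd s.tap a p).fn = κ ≫ 𝟙 _ ≫
      T.tot (s.tap.tr (((p.stage (fst X O.Pos)).onward (snd X O.Pos)).map u)
        (T.restr ((p.stage (fst X O.Pos)).pt (snd X O.Pos)) rfl a)) :=
    (Ty.tot_restr _ _ _).trans (congrArg (κ ≫ ·) (Ty.tot_restr _ _ _))
  rw [h1, Category.id_comp, s.tot_tap, s.comp_gl]
  symm
  refine (s.gl_congr _ rfl ?_ rfl rfl).trans ((hs.gl_eq_of_sameSeg hIR ?_ ?_ H).trans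
    (s.gl_congr _ ?_ ?_ ?_ rfl))
  · rw [O.comp_zero]
  · rw [Category.assoc, Category.assoc, Ty.tot_disp, O.comp_zero, lift_comp_eq_pt]
  · rw [Ty.tot_restr, O.comp_zero, RingOrder.zero_toward]
    change _ = κ ≫ (lift (𝟙 _) (snd _ _) ≫ fst _ _ ▷ O.Pos ≫ p.fn) ≫ _
    simp [κ]
  · change _ = κ ▷ O.Pos ≫ ((p.stage (fst X O.Pos)).onward (snd X O.Pos)).fn ≫ u
    rw [Path.onward_fn]
    change _ = κ ▷ O.Pos ≫ (lift (fst _ _) (O.monus (fst _ _ ≫ fst _ _ ≫ p.len)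
      (O.min (O.monus (fst _ _ ≫ O.min (fst _ _ ≫ p.len) (O.monus (fst _ _ ≫ p.len) (snd _ _)))
        (snd _ _)) (fst _ _ ≫ O.min (fst _ _ ≫ p.len) (O.monus (fst _ _ ≫ p.len) (snd _ _))))) ≫
          fst _ _ ▷ O.Pos ≫ p.fn) ≫ u
    simp [κ, comp_lift_assoc, RingOrder.comp_monus, RingOrder.comp_min, RingOrder.monus_min,
      RingOrder.min_eq_right (RingOrder.monus_le _ _)]
  · rw [O.comp_zero]
  · change _ = κ ≫ O.min (fst _ _ ≫ p.len) (O.monus (fst _ _ ≫ p.len) (snd _ _))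
    simp [κ, RingOrder.comp_monus, RingOrder.monus_min,
      RingOrder.min_eq_right (RingOrder.monus_le _ _)]

theorem tot_trMap {x y : X ⟶ U} (p : Path O x y) {a b : T.El x}
    (q : MoorePath O T.toFam a b) (hq : T.tot q.fn ≫ T.disp = fst _ _ ≫ pt p.fn (O.zero X)) :
    T.tot (trMap s.tap p q).fn = s.glFn p.fn (O.zero X) p.len (T.tot q.fn) hq := by
  refine (s.tot_tap _ _).trans (Eq.trans ?_ (s.tr_eq_gl _ _ _ _ _ _ _).symm)
  exact s.gl_congr _ rfl (O.comp_zero _).symm rfl rfl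

/-- Both sides are conjugates of the same data: the distance from `0` to `|p|` is `|p|`, the slides
of the endpoints are the `apd` paths, and the middle piece is `trMap`. Uniqueness of conjugates
gives equal functions and equal shapes. -/
theorem tap_eq (hIR : c.IsInductiveRecursive) (u : Γ ⟶ U) (a b : T.El u) {x y : X ⟶ Γ}
    (p : Path O x y) (t : T.El (x ≫ c.eq u a b)) :
    c.eqAt u a b y (s.tap.tr (p.map (c.eq u a b)) t) =
      idTransport s.tap a b p (c.eqAt u a b x t) := by
  have h0 : pt (p.fn ≫ c.eq u a b) (O.zero X) = x ≫ c.eq u a b :=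
    (pt_comp _ _ _).trans (congrArg (· ≫ c.eq u a b) p.at_zero)
  have hl : pt (p.fn ≫ c.eq u a b) p.len = y ≫ c.eq u a b :=
    (pt_comp _ _ _).trans (congrArg (· ≫ c.eq u a b) p.at_len)
  have hP : (p.fn ≫ c.eq u a b) ≫ c.eqCode D.ea D.eb D.eb_disp = p.fn ≫ c.eq u a b :=
    D.path_eq u a b x _ _ h0
  have ea : (p.fn ≫ c.eq u a b) ≫ D.ea = p.fn ≫ T.tot a := by rw [Category.assoc, D.eq_ea]
  have eb : (p.fn ≫ c.eq u a b) ≫ D.eb = p.fn ≫ T.tot b := by rw [Category.assoc, D.eq_eb]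
  have ha : (p.fn ≫ T.tot a) ≫ T.disp = p.fn ≫ u := by rw [Category.assoc, Ty.tot_disp]
  have hb : (p.fn ≫ T.tot b) ≫ T.disp = p.fn ≫ u := by rw [Category.assoc, Ty.tot_disp]
  have hx := hs.tot_eqAt u a b x t hP _ h0
  have hy := hs.tot_eqAt u a b y (s.tap.tr (p.map (c.eq u a b)) t) hP _ hl
  have e := ptEqFn_ptEqLen_congr (p.fn ≫ c.eq u a b) hP p.len _
    ((Ty.tot_disp _).trans hl.symm) hP (s.gl_disp _ _ _ _ _) rfl
    (s.tot_tap (p.map (c.eq u a b)) t)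
  have H := hs.eq _ hP (O.zero X) p.len (T.tot t) ((Ty.tot_disp t).trans h0.symm)
  have H' := isConjugate_comp (apd s.tap a p) (trMap s.tap (p.map u) (c.eqAt u a b x t))
    (apd s.tap b p) rfl
  have hu : p.fn ≫ u = ((p.fn ≫ c.eq u a b) ≫ D.ea) ≫ T.disp := by rw [ea, ha]
  have hF := (hs.tot_trMap (p.map u) (c.eqAt u a b x t) ((Ty.tot_disp _).trans
    (congrArg (fst X O.Pos ≫ ·) (p.map u).at_zero.symm))).trans (s.glFn_congr _ hu hx.1)
  obtain ⟨h1, h2⟩ := H.unique H' (RingOrder.zero_dist _)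
    ((s.glSlide_congr _ hu.symm ea).trans (hs.tot_apd hIR a p ha).symm) hF.symm hx.2.symm
    ((s.glSlide_congr _ hu.symm eb).trans (hs.tot_apd hIR b p hb).symm)
  exact moorePath_ext ((hy.1.trans e.1).trans h1) ((hy.2.trans e.2).trans h2)

theorem isTarskiUniverse (hIR : c.IsInductiveRecursive) : c.IsTarskiUniverse s.tap where
  bool p t := congrArg c.boolEquiv (hs.tap_bool p t)
  pi u f _ _ p t a := hs.tap_pi hIR u f p t a
  eq u a b _ _ p t := hs.tap_eq hIR u a b p t

end Codes.Decode.IsTransport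

end MooreTopos

/-! ### Conclusion: the tap structure of the universe. -/

theorem theorem6p2 {E : Type u} [Category.{v} E] [CartesianMonoidalCategory E] [BraidedCategory E]
    [MonoidalClosed E] [HasFiniteLimits E] [HasSubobjectClassifier E] (hN : HasNNO E)
    (R : E) [CommRingObj R] (O : RingOrder R)
    (𝔹 : E) (tt ff : 𝟙_ E ⟶ 𝔹) (h𝔹 : IsColimit (BinaryCofan.mk tt ff))
    (hR : IsConnectedObject 𝔹 R)
    (U : E) (T : Ty U) (c : Codes O 𝔹 T) (hIR : c.IsInductiveRecursive) :
    ∃ τ : Tap O T.toFam, c.IsTarskiUniverse τ := by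
  obtain ⟨D⟩ := c.exists_decode h𝔹 hR hIR
  obtain ⟨s, hs⟩ := D.exists_isTransport hIR
  exact ⟨s.tap, hs.isTarskiUniverse hIR⟩
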